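/- **Theorem.** Let $f:\mathbb R^n\to\mathbb R$, $G:\mathbb R^n\to\mathbb S^m$ and $h:\mathbb R^n\to\mathbb R^s$ be twice continuously differentiable, where $\mathbb S^m$ denotes the real symmetric $m\times m$ matrices, and consider the problem of minimizing $f(x)$ subject to $G(x)\succeq 0$, $h(x)=0$. Write $A\bullet B=\operatorname{tr}(AB)$, $\mathcal G_i=\partial G/\partial x_i$, $\Delta G(x;d)=\sum_i d_i\mathcal G_i(x)$, $\mathcal JG(x)^*Y=(\mathcal G_i(x)\bullet Y)_{i=1}^n$, $L(x,Y,z)=f(x)-G(x)\bullet Y+h(x)^\top z$, and let $\nabla h(x)$ be the $n\times s$ matrix with columns $\nabla h_i(x)$. Let $\Lambda(x)$ be the set of all $(Y,z)\in\mathbb S^m\times\mathbb R^s$ such that $\nabla_xL(x,Y,z)=0$, $G(x)\bullet Y=0$, $G(x)\succeq0$, $Y\succeq0$, $h(x)=0$; $x$ is a KKT point if $\Lambda(x)\ne\emptyset$. For $\mu>0$, $x$ is a *BKKT point with barrier parameter $\mu$* if there are $Y\in\mathbb S^m$ and $z\in\mathbb R^s$ with $\nabla_xL(x,Y,z)=0$,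 $G(x)Y=\mu I$, $G(x)\succ0$, $Y\succ0$, $h(x)=0$. Let $x^*$ be a KKT point, and let $E$ be a matrix whose columns form an orthonormal basis of the null space of $G(x^*)$. Assume: 1. (strict complementarity) $G(x^*)+Y\succ0$ for some $(Y,z)\in\Lambda(x^*)$; 2. (strong second-order sufficient condition) for all $(Y,z)\in\Lambda(x^*)$ and all $d\neq0$ with $\nabla f(x^*)^\top d=0$, $\nabla h(x^*)^\top d=0$ and $E^\top\Delta G(x^*;d)E\succeq0$, $$d^\top\big(\nabla^2_{xx}L(x^*,Y,z)+\Omega(x^*,Y)\big)d>0,\qquad \Omega(x,Y)_{ij}=2\,Y\bullet\big(\mathcal G_i(x)G(x)^\dagger\mathcal G_j(x)\big),$$ where $\dagger$ is the Moore–Penrose inverse; 3. (Mangasarian–Fromovitz) $\nabla h(x^*)$ has full column rank and there is $d$ with $G(x^*)+\Delta G(x^*;d)\succ0$ and $\nabla h(x^*)^\top d=0$; 4. $x^*$ is not itself a BKKT point for any $\mu>0$ (this holds automatically if $G(x^*)$ is singular). An *analytic center* is a pair $(Y_{\rm a},z^{\rm a})$ minimizing $-\log\det(E^\top YE)$ over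 $(Y,z)\in\Lambda(x^*)$, where $-\log 0=+\infty$. Let $\mathcal U=\{d\in\mathbb R^n: E^\top\Delta G(x^*;d)E=0,\ \nabla h(x^*)^\top d=0\}$. Let $V\subseteq\mathbb R^{n-s}$ be an open ball and $\Phi:V\to\Phi(V)\subseteq\mathbb R^n$ a $\mathcal C^2$-diffeomorphism onto its image with $x^*\in\Phi(V)\subseteq\{x: h(x)=0\}$. Then there is exactly one vector $\xi^*\in\mathbb R^n$ for which there exist an analytic center $(Y_{\rm a},z^{\rm a})$ and $\Delta Y\in\mathbb S^m$ such that $$\nabla^2_{xx}L(x^*,Y_{\rm a},z^{\rm a})\xi^*-\mathcal JG(x^*)^*\Delta Y\ \perp\ \mathcal U,$$ $$G(x^*)\Delta Y+\Delta Y\,G(x^*)+Y_{\rm a}\Delta G(x^*;\xi^*)+\Delta G(x^*;\xi^*)Y_{\rm a}=2I,\qquad \nabla h(x^*)^\top\xi^*=0.$$ Put $\mathcal P_\rho(\mu)=\{x\in\mathbb R^n:\|x^*+\mu\xi^*-x\|<\rho\mu\|\xi^*\|\}$. For every $\bar\rho>0$ there is $\mu_0>0$ such that for every $\bar\mu\in(0,\mu_0]$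 and every $\mu\in(0,\bar\mu]$ there is exactly one BKKT point $x(\mu)$ with barrier parameter $\mu$ in $$\Phi(V)\cap\bigcup_{\nu\in(0,\bar\mu]}\mathcal P_{\bar\rho}(\nu).$$ Moreover, $x(\mu)$ is a strict local optimum of the reduced barrier problem $$\min_{v\in V}\ f(\Phi(v))-\mu\log\det G(\Phi(v))\quad\text{s.t. } G(\Phi(v))\succ0,$$ that is, $x(\mu)=\Phi(v(\mu))$ for some $v(\mu)\in V$ that is a strict local minimizer of this problem. -/

import Mathlib

open Set Filter Topology Matrix

noncomputable section

/-- The four Penrose equations: `B` is the Moore-Penrose inverse of the real square matrix `A`. -/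
structure IsMoorePenroseInverse {m : ℕ} (A B : Matrix (Fin m) (Fin m) ℝ) : Prop where
  mul_mul_left : A * B * A = A
  mul_mul_right : B * A * B = B
  symm_left : (A * B)ᵀ = A * B
  symm_right : (B * A)ᵀ = B * A

theorem IsMoorePenroseInverse.unique {m : ℕ} {A B C : Matrix (Fin m) (Fin m) ℝ}
    (hB : IsMoorePenroseInverse A B) (hC : IsMoorePenroseInverse A C) : B = C := by
  have h1 : A * B = A * C := by
    calc A * B = (A * B)ᵀ := hB.symm_left.symm
      _ = ((A * C) * (A * B))ᵀ := by
        rw [← Matrix.mul_assoc (A * C) A B, hC.mul_mul_left]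
      _ = (A * B) * (A * C) := by
        rw [Matrix.transpose_mul, hB.symm_left, hC.symm_left]
      _ = A * C := by rw [← Matrix.mul_assoc (A * B) A C, hB.mul_mul_left]
  have h2 : B * A = C * A := by
    calc B * A = (B * A)ᵀ := hB.symm_right.symm
      _ = ((B * A) * (C * A))ᵀ := by
        rw [Matrix.mul_assoc B A (C * A), ← Matrix.mul_assoc A C A, hC.mul_mul_left]
      _ = (C * A) * (B * A) := by
        rw [Matrix.transpose_mul, hB.symm_right, hC.symm_right]
      _ = C * A := by
        rw [Matrix.mul_assoc C A (B * A), ← Matrix.mul_assoc A B A, hB.mul_mul_left]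
  calc B = B * A * B := hB.mul_mul_right.symm
    _ = C * (A * B) := by rw [h2, Matrix.mul_assoc]
    _ = C := by rw [h1, ← Matrix.mul_assoc, hC.mul_mul_right]

open Classical in
/-- The Moore-Penrose inverse `A†`. -/
def pinv {m : ℕ} (A : Matrix (Fin m) (Fin m) ℝ) : Matrix (Fin m) (Fin m) ℝ :=
  if h : ∃ B, IsMoorePenroseInverse A B then h.choose else 0

/-- The Moore-Penrose inverse of a symmetric matrix exists, so `pinv` takes its intended value. -/
theorem isMoorePenroseInverse_pinv {m : ℕ} {A : Matrix (Fin m) (Fin m) ℝ} (hA : A.IsSymm) :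
    IsMoorePenroseInverse A (pinv A) := by
  have hex : ∃ B, IsMoorePenroseInverse A B := by
    have hH : A.IsHermitian := by
      rw [Matrix.IsHermitian, Matrix.conjTranspose_eq_transpose_of_trivial]
      exact hA
    obtain ⟨U, D, hU, hAD⟩ : ∃ (U : Matrix (Fin m) (Fin m) ℝ) (D : Fin m → ℝ),
        Uᵀ * U = 1 ∧ A = U * Matrix.diagonal D * Uᵀ := by
      refine ⟨hH.eigenvectorUnitary, hH.eigenvalues, ?_, ?_⟩
      · have h := Unitary.coe_star_mul_self hH.eigenvectorUnitary
        rwa [Matrix.star_eq_conjTranspose, Matrix.conjTranspose_eq_transpose_of_trivial] at h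
      · have h := hH.spectral_theorem
        rw [Unitary.conjStarAlgAut_apply, Matrix.star_eq_conjTranspose,
          Matrix.conjTranspose_eq_transpose_of_trivial] at h
        exact h
    have key : ∀ X Y : Matrix (Fin m) (Fin m) ℝ,
        (U * X * Uᵀ) * (U * Y * Uᵀ) = U * (X * Y) * Uᵀ := by
      intro X Y
      calc (U * X * Uᵀ) * (U * Y * Uᵀ) = U * X * (Uᵀ * U) * Y * Uᵀ := by
            simp only [Matrix.mul_assoc]
        _ = U * (X * Y) * Uᵀ := by rw [hU]; simp only [Matrix.mul_one, Matrix.mul_assoc]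
    refine ⟨U * Matrix.diagonal (fun i => (D i)⁻¹) * Uᵀ, ?_, ?_, ?_, ?_⟩
    · rw [hAD, key, key, Matrix.diagonal_mul_diagonal, Matrix.diagonal_mul_diagonal]
      simp only [mul_inv_mul_cancel]
    · rw [hAD, key, key, Matrix.diagonal_mul_diagonal, Matrix.diagonal_mul_diagonal]
      have hinv : ∀ t : ℝ, t⁻¹ * t * t⁻¹ = t⁻¹ := by
        intro t
        by_cases ht : t = 0 <;> simp [ht]
      simp only [hinv]
    · rw [hAD, key, Matrix.diagonal_mul_diagonal]
      simp [Matrix.transpose_mul, Matrix.mul_assoc]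
    · rw [hAD, key, Matrix.diagonal_mul_diagonal]
      simp [Matrix.transpose_mul, Matrix.mul_assoc]
  unfold pinv
  rw [dif_pos hex]
  exact hex.choose_spec

/-- The columns of `E` form an orthonormal basis of the null space of `A`. -/
def IsOrthonormalKernelBasis {m k : ℕ} (A : Matrix (Fin m) (Fin m) ℝ)
    (E : Matrix (Fin m) (Fin k) ℝ) : Prop :=
  Eᵀ * E = 1 ∧ ∀ v : Fin m → ℝ, A *ᵥ v = 0 ↔ ∃ u : Fin k → ℝ, v = E *ᵥ u

/-- `v` is a strict local optimum of `min Ψ` over the feasible set `S`. -/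
def IsStrictLocalOptimum {X : Type*} [TopologicalSpace X] (Ψ : X → ℝ) (S : Set X) (v : X) : Prop :=
  v ∈ S ∧ ∀ᶠ u in 𝓝 v, u ∈ S → u ≠ v → Ψ v < Ψ u

/-- The data of the nonlinear semidefinite problem
`min f(x)` subject to `G(x)` positive semidefinite and `h(x) = 0`,
with twice continuously differentiable `f : ℝⁿ → ℝ`, `G : ℝⁿ → 𝕊ᵐ`, `h : ℝⁿ → ℝˢ`. -/
structure NSDP (n m s : ℕ) where
  f : EuclideanSpace ℝ (Fin n) → ℝ
  G : EuclideanSpace ℝ (Fin n) → Matrix (Fin m) (Fin m) ℝ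
  h : EuclideanSpace ℝ (Fin n) → EuclideanSpace ℝ (Fin s)
  symm_G : ∀ x, (G x).IsSymm
  contDiff_f : ContDiff ℝ 2 f
  contDiff_G : ∀ i j, ContDiff ℝ 2 (fun x => G x i j)
  contDiff_h : ContDiff ℝ 2 h

namespace NSDP

variable {n m s : ℕ} (P : NSDP n m s)

/-- `ΔG(x; d) = ∑ i, d i • ∂G(x)/∂x_i`, the directional derivative of `G`. -/
def dG (x d : EuclideanSpace ℝ (Fin n)) : Matrix (Fin m) (Fin m) ℝ :=
  Matrix.of fun i j => fderiv ℝ (fun y => P.G y i j) x d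

/-- The partial derivative `∂G(x)/∂x_i`. -/
def partialG (x : EuclideanSpace ℝ (Fin n)) (i : Fin n) : Matrix (Fin m) (Fin m) ℝ :=
  P.dG x (EuclideanSpace.single i 1)

/-- `𝒥G(x)^* Y`, the vector with entries `trace (∂G(x)/∂x_i * Y)`. -/
def adjG (x : EuclideanSpace ℝ (Fin n)) (Y : Matrix (Fin m) (Fin m) ℝ) :
    EuclideanSpace ℝ (Fin n) :=
  WithLp.toLp 2 fun i => (P.partialG x i * Y).trace

/-- The gradient of the `i`-th equality constraint, i.e. the `i`-th column of `∇h(x)`. -/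
def gradH (x : EuclideanSpace ℝ (Fin n)) (i : Fin s) : EuclideanSpace ℝ (Fin n) :=
  gradient (fun y => P.h y i) x

/-- The Lagrange function `L(x, Y, z) = f(x) - G(x) • Y + h(x)ᵀ z`. -/
def lagrangian (x : EuclideanSpace ℝ (Fin n)) (Y : Matrix (Fin m) (Fin m) ℝ)
    (z : EuclideanSpace ℝ (Fin s)) : ℝ :=
  P.f x - (P.G x * Y).trace + ∑ i, P.h x i * z i

/-- `∇ₓL(x, Y, z)`. -/
def gradL (x : EuclideanSpace ℝ (Fin n)) (Y : Matrix (Fin m) (Fin m) ℝ)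
    (z : EuclideanSpace ℝ (Fin s)) : EuclideanSpace ℝ (Fin n) :=
  gradient (fun y => P.lagrangian y Y z) x

/-- `∇²ₓₓL(x, Y, z)`, as a linear operator on `ℝⁿ`. -/
def hessL (x : EuclideanSpace ℝ (Fin n)) (Y : Matrix (Fin m) (Fin m) ℝ)
    (z : EuclideanSpace ℝ (Fin s)) : EuclideanSpace ℝ (Fin n) →L[ℝ] EuclideanSpace ℝ (Fin n) :=
  fderiv ℝ (fun y => P.gradL y Y z) x

/-- The set `Λ(x)` of pairs of multipliers satisfying the KKT conditions at `x`. -/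
def multipliers (x : EuclideanSpace ℝ (Fin n)) :
    Set (Matrix (Fin m) (Fin m) ℝ × EuclideanSpace ℝ (Fin s)) :=
  {p | P.gradL x p.1 p.2 = 0 ∧ (P.G x * p.1).trace = 0 ∧ (P.G x).PosSemidef ∧
    p.1.PosSemidef ∧ P.h x = 0}

def IsKKTPoint (x : EuclideanSpace ℝ (Fin n)) : Prop :=
  (P.multipliers x).Nonempty

/-- `x` is a barrier KKT point with barrier parameter `μ`. -/
def IsBKKTPoint (μ : ℝ) (x : EuclideanSpace ℝ (Fin n)) : Prop :=
  ∃ (Y : Matrix (Fin m) (Fin m) ℝ) (z : EuclideanSpace ℝ (Fin s)),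
    P.gradL x Y z = 0 ∧ P.G x * Y = μ • (1 : Matrix (Fin m) (Fin m) ℝ) ∧
      (P.G x).PosDef ∧ Y.PosDef ∧ P.h x = 0

/-- Mangasarian-Fromovitz constraint qualification at `x`. -/
def MFCQ (x : EuclideanSpace ℝ (Fin n)) : Prop :=
  LinearIndependent ℝ (P.gradH x) ∧
    ∃ d : EuclideanSpace ℝ (Fin n),
      (P.G x + P.dG x d).PosDef ∧ ∀ i, inner ℝ (P.gradH x i) d = 0

/-- Strict complementarity holds at `x` for some Lagrange multiplier matrix. -/
def StrictComplementarity (x : EuclideanSpace ℝ (Fin n)) : Prop :=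
  ∃ p ∈ P.multipliers x, (P.G x + p.1).PosDef

/-- The matrix `Ω(x, Y)` of the sigma term, `Ω_{ij} = 2 Y • (𝒢_i(x) G(x)† 𝒢_j(x))`. -/
def sigmaMatrix (x : EuclideanSpace ℝ (Fin n)) (Y : Matrix (Fin m) (Fin m) ℝ) :
    Matrix (Fin n) (Fin n) ℝ :=
  Matrix.of fun i j => 2 * (Y * (P.partialG x i * pinv (P.G x) * P.partialG x j)).trace

/-- The critical cone at `x`; the columns of `E` are an orthonormal basis of the null space of
`G(x)`, so that `{X | Eᵀ X E ⪰ 0}` is the tangent cone of the semidefinite cone at `G(x)`. -/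
def criticalCone {k : ℕ} (x : EuclideanSpace ℝ (Fin n)) (E : Matrix (Fin m) (Fin k) ℝ) :
    Set (EuclideanSpace ℝ (Fin n)) :=
  {d | inner ℝ (gradient P.f x) d = 0 ∧ (∀ i, inner ℝ (P.gradH x i) d = 0) ∧
    (Eᵀ * P.dG x d * E).PosSemidef}

/-- Strong second-order sufficient condition at `x`. -/
def SSOSC {k : ℕ} (x : EuclideanSpace ℝ (Fin n)) (E : Matrix (Fin m) (Fin k) ℝ) : Prop :=
  ∀ p ∈ P.multipliers x, ∀ d ∈ P.criticalCone x E, d ≠ 0 →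
    0 < inner ℝ d (P.hessL x p.1 p.2 d) + d.ofLp ⬝ᵥ (P.sigmaMatrix x p.1 *ᵥ d.ofLp)

/-- `-log det M` for a positive semidefinite matrix `M`, with the value `+∞` if `det M = 0`. -/
def negLogDet {k : ℕ} (M : Matrix (Fin k) (Fin k) ℝ) : EReal :=
  -(ENNReal.log (ENNReal.ofReal M.det))

/-- `(Y, z)` is an analytic center at `x`: it minimizes `-log det (Eᵀ Y E)` over `Λ(x)`. -/
def IsAnalyticCenter {k : ℕ} (x : EuclideanSpace ℝ (Fin n)) (E : Matrix (Fin m) (Fin k) ℝ)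
    (p : Matrix (Fin m) (Fin m) ℝ × EuclideanSpace ℝ (Fin s)) : Prop :=
  p ∈ P.multipliers x ∧
    ∀ q ∈ P.multipliers x, negLogDet (Eᵀ * p.1 * E) ≤ negLogDet (Eᵀ * q.1 * E)

/-- The subspace `{d | Eᵀ ΔG(x; d) E = 0, ∇h(x)ᵀ d = 0}` (as a set). -/
def flatDirections {k : ℕ} (x : EuclideanSpace ℝ (Fin n)) (E : Matrix (Fin m) (Fin k) ℝ) :
    Set (EuclideanSpace ℝ (Fin n)) :=
  {d | Eᵀ * P.dG x d * E = 0 ∧ ∀ i, inner ℝ (P.gradH x i) d = 0}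

/-- `ξ` is the `x`-component of a solution `(ξ, ΔY)` of the linear system at the
analytic center `(Y, z)`:
`Uᵀ (∇²ₓₓL ξ - 𝒥G^* ΔY) = 0`, `G ΔY + ΔY G + Y ΔG(ξ) + ΔG(ξ) Y = 2 I`, `∇hᵀ ξ = 0`,
where the columns of `U` are an orthonormal basis of `flatDirections`; the first equation says
that `∇²ₓₓL ξ - 𝒥G^* ΔY` is orthogonal to that subspace. -/
def IsPathDirection {k : ℕ} (x : EuclideanSpace ℝ (Fin n)) (E : Matrix (Fin m) (Fin k) ℝ)
    (ξ : EuclideanSpace ℝ (Fin n)) : Prop :=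
  ∃ (Y : Matrix (Fin m) (Fin m) ℝ) (z : EuclideanSpace ℝ (Fin s))
    (ΔY : Matrix (Fin m) (Fin m) ℝ),
    P.IsAnalyticCenter x E (Y, z) ∧ ΔY.IsSymm ∧
    (∀ d ∈ P.flatDirections x E, inner ℝ d (P.hessL x Y z ξ - P.adjG x ΔY) = 0) ∧
    P.G x * ΔY + ΔY * P.G x + (Y * P.dG x ξ + P.dG x ξ * Y) =
      (2 : ℝ) • (1 : Matrix (Fin m) (Fin m) ℝ) ∧
    ∀ i, inner ℝ (P.gradH x i) ξ = 0

/-- `Φ` is a `C²`-diffeomorphism from the open set `V` of `ℝ^(n-s)` onto a subset `Φ(V)` of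
`{h = 0}` that contains `x`. -/
structure IsLocalParametrization (x : EuclideanSpace ℝ (Fin n))
    (V : Set (EuclideanSpace ℝ (Fin (n - s))))
    (Φ : EuclideanSpace ℝ (Fin (n - s)) → EuclideanSpace ℝ (Fin n)) : Prop where
  contDiffOn : ContDiffOn ℝ 2 Φ V
  contDiffOn_inverse : ∃ Θ : EuclideanSpace ℝ (Fin n) → EuclideanSpace ℝ (Fin (n - s)),
    ContDiffOn ℝ 2 Θ (Φ '' V) ∧ LeftInvOn Θ Φ V
  mem : x ∈ Φ '' V
  subset : ∀ v ∈ V, P.h (Φ v) = 0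

/-- The objective `Ψ_μ(v) = f(Φ(v)) - μ log det G(Φ(v))` of the reduced barrier problem. -/
def reducedBarrier (μ : ℝ) (Φ : EuclideanSpace ℝ (Fin (n - s)) → EuclideanSpace ℝ (Fin n))
    (v : EuclideanSpace ℝ (Fin (n - s))) : ℝ :=
  P.f (Φ v) - μ * Real.log (P.G (Φ v)).det

/-- The feasible set `{v ∈ V | G(Φ(v)) ≻ 0}` of the reduced barrier problem. -/
def reducedFeasible (V : Set (EuclideanSpace ℝ (Fin (n - s))))
    (Φ : EuclideanSpace ℝ (Fin (n - s)) → EuclideanSpace ℝ (Fin n)) :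
    Set (EuclideanSpace ℝ (Fin (n - s))) :=
  {v ∈ V | (P.G (Φ v)).PosDef}

end NSDP

/-- `𝒫_ρ(μ) = {x | ‖x⋆ + μ ξ - x‖ < ρ μ ‖ξ‖}`. -/
def pathBall {n : ℕ} (xs ξ : EuclideanSpace ℝ (Fin n)) (ρ μ : ℝ) :
    Set (EuclideanSpace ℝ (Fin n)) :=
  {x | ‖xs + μ • ξ - x‖ < ρ * μ * ‖ξ‖}

end

/-! A chart removes the equality constraints, so that stationarity is tested on tangent vectors only
(`IsChart`). Put N = G + E Eᵀ, which is positive definite near x*. Then G = N - E Eᵀ, and the Schur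
complement S = 1 - Eᵀ N⁻¹ E vanishes at x*, satisfies det G = det N · det S, and is positive
definite exactly when G is. The barrier function becomes f + μ φ - μ log det S with φ = -log det N
smooth: x* is now a vertex, where the whole constraint matrix vanishes. On flat directions the
curvature of S adds exactly the sigma term Ω to the Hessian of the Lagrangian, so the hypotheses on
x* become `VertexBarrier.Regular`.

For a vertex barrier the dual matrices μ S⁻¹ stay bounded by Mangasarian-Fromovitz and accumulate at
multipliers Y. Strict complementarity and the second-order condition force v = O(μ) at critical
points v, so a limit w of v/μ satisfies Y S'(0) w = 1 and a linear equation on the kernel of S'(0)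
(`Regular.exists_isDirection`). The first equation says that Y is the multiplier of largest
determinant, that is, the analytic center; hence Y is unique, then w is, and v/μ → w
(`Regular.isDirection_unique`).

Critical points exist because 0 is a strict local minimizer of f over S ⪰ 0, so that for small μ
minimizers of the barrier function over a small ball are interior (`Regular.exists_isCritical`).
After the blow-up v = μ a, the gradient of the barrier function is strictly monotone for a near w
(`Regular.eventually_grad_lt`); this gives uniqueness and strict local minimality.

The linear system for ξ* is equivalent through the chart to the equations for w. Since x* is not a
BKKT point, w ≠ 0 and the path balls are not empty; they all lie within O(μ̄) of x*, so uniqueness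
in a small ball around x* gives uniqueness in their union. -/

set_option linter.unusedSectionVars false

/-! ### Positive semidefinite matrices, determinant maximization and Schur complements. -/

section MatrixLemmas

variable {ι κ : Type*} [Fintype ι] [DecidableEq ι] [Fintype κ] [DecidableEq κ]

theorem Matrix.PosSemidef.exists_transpose_mul_self {Z : Matrix ι ι ℝ} (hZ : Z.PosSemidef) :
    ∃ C : Matrix ι ι ℝ, Z = Cᵀ * C := by
  open scoped MatrixOrder in
  obtain ⟨C, hC⟩ := CStarAlgebra.nonneg_iff_eq_star_mul_self.mp hZ.nonneg
  exact ⟨C, by rw [hC, star_eq_conjTranspose, conjTranspose_eq_transpose_of_trivial]⟩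

theorem Matrix.PosSemidef.transpose_mul_mul {M : Matrix ι ι ℝ} (hM : M.PosSemidef)
    (B : Matrix ι κ ℝ) : (Bᵀ * M * B).PosSemidef := by
  simpa [conjTranspose_eq_transpose_of_trivial] using hM.conjTranspose_mul_mul_same B

theorem Matrix.PosSemidef.mul_mul_transpose {M : Matrix ι ι ℝ} (hM : M.PosSemidef)
    (B : Matrix κ ι ℝ) : (B * M * Bᵀ).PosSemidef := by
  simpa [conjTranspose_eq_transpose_of_trivial] using hM.mul_mul_conjTranspose_same B

theorem Matrix.PosSemidef.transpose_eq {M : Matrix ι ι ℝ} (hM : M.PosSemidef) : Mᵀ = M := by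
  have := hM.1
  rwa [Matrix.IsHermitian, conjTranspose_eq_transpose_of_trivial] at this

theorem Matrix.PosSemidef.trace_mul_nonneg {Z M : Matrix ι ι ℝ} (hZ : Z.PosSemidef)
    (hM : M.PosSemidef) : 0 ≤ (Z * M).trace := by
  obtain ⟨C, rfl⟩ := hZ.exists_transpose_mul_self
  rw [Matrix.mul_assoc, Matrix.trace_mul_comm]
  exact (hM.mul_mul_transpose C).trace_nonneg

/-- A positive semidefinite matrix with nonpositive pairing against a positive definite one
vanishes. -/
theorem Matrix.PosSemidef.eq_zero_of_trace_mul_nonpos {Z M : Matrix ι ι ℝ} (hZ : Z.PosSemidef)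
    (hM : M.PosDef) (h : (Z * M).trace ≤ 0) : Z = 0 := by
  obtain ⟨C, rfl⟩ := hM.posSemidef.exists_transpose_mul_self
  -- Congruence by the invertible factor `C` of `M` turns the pairing into a trace.
  have h0 : (C * Z * Cᵀ).trace = 0 := by
    refine le_antisymm ?_ (hZ.mul_mul_transpose C).trace_nonneg
    rwa [← Matrix.mul_assoc, Matrix.trace_mul_comm, ← Matrix.mul_assoc] at h
  rw [(hZ.mul_mul_transpose C).trace_eq_zero_iff] at h0
  have hu : IsUnit (Cᵀ * C) := hM.isUnit
  rw [Matrix.isUnit_iff_isUnit_det, Matrix.det_mul] at hu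
  have h1 : IsUnit C.det := (IsUnit.mul_iff.mp hu).2
  have h2 : IsUnit Cᵀ.det := (IsUnit.mul_iff.mp hu).1
  calc Z = C⁻¹ * (C * Z * Cᵀ) * Cᵀ⁻¹ := by
        simp only [Matrix.mul_assoc]
        rw [Matrix.mul_nonsing_inv _ h2, Matrix.mul_one, Matrix.nonsing_inv_mul_cancel_left _ _ h1]
    _ = 0 := by rw [h0]; simp

/-- With Z = CᵀC and M = BᵀB, the pairing is the squared Frobenius norm of C Bᵀ. -/
theorem Matrix.PosSemidef.mul_eq_zero_of_trace_eq_zero {Z M : Matrix ι ι ℝ} (hZ : Z.PosSemidef)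
    (hM : M.PosSemidef) (h : (Z * M).trace = 0) : Z * M = 0 := by
  obtain ⟨C, rfl⟩ := hZ.exists_transpose_mul_self
  obtain ⟨B, rfl⟩ := hM.exists_transpose_mul_self
  have h0 : ((C * Bᵀ)ᵀ * (C * Bᵀ)).trace = 0 := by
    rw [← h, Matrix.transpose_mul, Matrix.transpose_transpose, Matrix.mul_assoc,
      Matrix.trace_mul_comm]
    simp only [Matrix.mul_assoc]
  have h1 : C * Bᵀ = 0 := by
    rw [← conjTranspose_eq_transpose_of_trivial] at h0
    exact trace_conjTranspose_mul_self_eq_zero_iff.mp h0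
  calc Cᵀ * C * (Bᵀ * B) = Cᵀ * (C * Bᵀ) * B := by simp only [Matrix.mul_assoc]
    _ = 0 := by rw [h1]; simp

/-- Uniqueness for the Lyapunov equation. -/
theorem Matrix.PosDef.lyapunov_eq_zero {Y Z : Matrix ι ι ℝ} (hY : Y.PosDef) (hZ : Zᵀ = Z)
    (h : Y * Z + Z * Y = 0) : Z = 0 := by
  -- By cyclicity, pairing the equation with `Z` gives twice this trace.
  have h1 : (Z * Z * Y).trace = 0 := by
    have h2 : (Z * (Y * Z + Z * Y)).trace = 0 := by rw [h]; simp
    rw [Matrix.mul_add, Matrix.trace_add, Matrix.trace_mul_comm, Matrix.mul_assoc Y,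
      Matrix.trace_mul_comm Y, ← Matrix.mul_assoc] at h2
    linarith
  have h3 : (Z * Z).PosSemidef := by
    have := Matrix.posSemidef_conjTranspose_mul_self Z
    rwa [conjTranspose_eq_transpose_of_trivial, hZ] at this
  have h4 := h3.eq_zero_of_trace_mul_nonpos hY h1.le
  have h5 : Zᴴ * Z = 0 := by rw [conjTranspose_eq_transpose_of_trivial, hZ, h4]
  exact Matrix.conjTranspose_mul_self_eq_zero.mp h5

theorem Matrix.isClosed_posSemidef : IsClosed {M : Matrix ι ι ℝ | M.PosSemidef} := by
  have : {M : Matrix ι ι ℝ | M.PosSemidef} =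
      {M | Mᵀ = M} ∩ ⋂ x : ι → ℝ, {M | 0 ≤ x ⬝ᵥ (M *ᵥ x)} := by
    ext M
    simp only [mem_ofPred_eq, mem_inter_iff, mem_iInter, posSemidef_iff_dotProduct_mulVec,
      Matrix.IsHermitian, conjTranspose_eq_transpose_of_trivial, star_trivial]
  rw [this]
  refine (isClosed_eq (by fun_prop) continuous_id).inter (isClosed_iInter fun x => ?_)
  exact isClosed_le continuous_const (by fun_prop)

/-- Positive definiteness is an open condition among Hermitian matrices. -/
theorem Matrix.PosDef.eventually {α : Type*} {l : Filter α} {F : α → Matrix ι ι ℝ}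
    {M : Matrix ι ι ℝ} (hM : M.PosDef) (hF : Tendsto F l (𝓝 M)) (hs : ∀ᶠ a in l, (F a)ᵀ = F a) :
    ∀ᶠ a in l, (F a).PosDef := by
  have hK : IsCompact (Metric.sphere (0 : EuclideanSpace ℝ ι) 1) := isCompact_sphere _ _
  -- Compactness of the unit sphere makes positivity of the quadratic form uniform; homogeneity
  -- extends it to all vectors.
  have h1 : ∀ᶠ B in 𝓝 M, ∀ x ∈ Metric.sphere (0 : EuclideanSpace ℝ ι) 1,
      0 < x.ofLp ⬝ᵥ (B *ᵥ x.ofLp) := by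
    apply hK.eventually_forall_of_forall_eventually
    intro x hx
    have hx0 : x.ofLp ≠ 0 := by
      intro h
      have : x = 0 := by ext i; simpa using congrFun h i
      simp [this] at hx
    have hpos : 0 < x.ofLp ⬝ᵥ (M *ᵥ x.ofLp) := by simpa using hM.dotProduct_mulVec_pos hx0
    have hc : Continuous fun q : Matrix ι ι ℝ × EuclideanSpace ℝ ι =>
        q.2.ofLp ⬝ᵥ (q.1 *ᵥ q.2.ofLp) := by fun_prop
    have := hc.tendsto (M, x) |>.eventually (lt_mem_nhds hpos)
    exact this
  filter_upwards [hF.eventually h1, hs] with a ha hsa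
  refine Matrix.PosDef.of_dotProduct_mulVec_pos ?_ fun {x} hx => ?_
  · rwa [Matrix.IsHermitian, conjTranspose_eq_transpose_of_trivial]
  · set y : EuclideanSpace ℝ ι := WithLp.toLp 2 x with hy
    have hy0 : y ≠ 0 := by
      intro h
      apply hx
      have := congrArg WithLp.ofLp h
      simpa [hy] using this
    have hn : 0 < ‖y‖ := norm_pos_iff.mpr hy0
    have h2 := ha (‖y‖⁻¹ • y) (by simp [norm_smul, hn.ne'])
    have h3 : (‖y‖⁻¹ • y).ofLp = ‖y‖⁻¹ • x := by simp [hy]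
    rw [h3, Matrix.mulVec_smul, smul_dotProduct, dotProduct_smul, smul_smul, smul_eq_mul] at h2
    have h4 : 0 < ‖y‖⁻¹ * ‖y‖⁻¹ := by positivity
    simpa using (mul_pos_iff_of_pos_left h4).mp h2

/-- Among positive semidefinite `Q` with `tr (Q Y⁻¹)` fixed to its value at the positive definite
matrix `Y`, the determinant is maximal at `Y` only. -/
theorem Matrix.PosDef.det_le_of_trace_eq {Y X Q : Matrix ι ι ℝ} (hY : Y.PosDef)
    (hYX : Y * X = 1) (hQ : Q.PosSemidef) (ht : (Q * X).trace = Fintype.card ι) :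
    Q.det ≤ Y.det ∧ (Y.det ≤ Q.det → Q = Y) := by
  have hXY : X * Y = 1 := mul_eq_one_comm.mp hYX
  obtain ⟨C, hC⟩ := hY.posSemidef.exists_transpose_mul_self
  have hdet : Y.det = C.det * C.det := by rw [hC, Matrix.det_mul, Matrix.det_transpose]
  have hu : IsUnit C.det := by
    have := hY.det_pos
    rw [hdet] at this
    exact isUnit_iff_ne_zero.mpr fun h => by simp [h] at this
  have hut : IsUnit Cᵀ.det := by rwa [Matrix.det_transpose]
  have hX : X = C⁻¹ * Cᵀ⁻¹ := by
    calc X = X * (Y * (C⁻¹ * Cᵀ⁻¹)) := by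
          rw [hC, Matrix.mul_assoc Cᵀ, Matrix.mul_nonsing_inv_cancel_left _ _ hu,
            Matrix.mul_nonsing_inv _ hut, Matrix.mul_one]
      _ = C⁻¹ * Cᵀ⁻¹ := by rw [← Matrix.mul_assoc, hXY, Matrix.one_mul]
  -- In coordinates where `Y` is the identity, the trace condition says that the eigenvalues of `M`
  -- sum to their number, and the claim is det M ≤ 1.
  set M : Matrix ι ι ℝ := Cᵀ⁻¹ * Q * C⁻¹ with hMdef
  have hM : M.PosSemidef := by
    have := hQ.transpose_mul_mul C⁻¹
    rwa [Matrix.transpose_nonsing_inv] at this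
  have hQM : Q = Cᵀ * M * C := by
    rw [hMdef]
    simp only [Matrix.mul_assoc]
    rw [Matrix.nonsing_inv_mul _ hu, Matrix.mul_one, Matrix.mul_nonsing_inv_cancel_left _ _ hut]
  have htr : M.trace = Fintype.card ι := by
    rw [← ht, hX, hMdef, Matrix.mul_assoc, Matrix.trace_mul_comm, Matrix.mul_assoc]
  have hQdet : Q.det = Y.det * M.det := by
    rw [hQM, hdet]; simp only [Matrix.det_mul, Matrix.det_transpose]; ring
  have hev : ∀ i, 0 ≤ hM.1.eigenvalues i := hM.eigenvalues_nonneg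
  have hMdet : M.det = ∏ i, hM.1.eigenvalues i := by
    simpa using hM.1.det_eq_prod_eigenvalues
  have hMtr : ∑ i, (hM.1.eigenvalues i - 1) = 0 := by
    have h := hM.1.trace_eq_sum_eigenvalues
    rw [Finset.sum_sub_distrib]
    simp only [RCLike.ofReal_real_eq_id, id_eq] at h
    rw [← h, htr]; simp
  -- Multiplying t ≤ exp (t - 1), strict for t ≠ 1, over the eigenvalues gives the
  -- arithmetic-geometric mean inequality with its equality case.
  have hexp : ∏ i, Real.exp (hM.1.eigenvalues i - 1) = 1 := by
    rw [← Real.exp_sum, hMtr, Real.exp_zero]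
  have hle : ∀ i, hM.1.eigenvalues i ≤ Real.exp (hM.1.eigenvalues i - 1) := fun i => by
    linarith [Real.add_one_le_exp (hM.1.eigenvalues i - 1)]
  have hM1 : M.det ≤ 1 := by
    rw [hMdet, ← hexp]
    exact Finset.prod_le_prod (fun i _ => hev i) fun i _ => hle i
  refine ⟨by rw [hQdet]; nlinarith [hY.det_pos], fun hge => ?_⟩
  have hM2 : 1 ≤ M.det := by
    rw [hQdet] at hge
    nlinarith [hY.det_pos]
  have hone : ∀ i, hM.1.eigenvalues i = 1 := by
    by_contra! hne
    obtain ⟨i, hi⟩ := hne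
    have hpos : ∀ j, 0 < hM.1.eigenvalues j := by
      intro j
      refine lt_of_le_of_ne (hev j) fun h => ?_
      have : M.det = 0 := by rw [hMdet]; exact Finset.prod_eq_zero (Finset.mem_univ j) h.symm
      linarith
    have : M.det < 1 := by
      rw [hMdet, ← hexp]
      refine Finset.prod_lt_prod (fun j _ => hpos j) (fun j _ => hle j) ⟨i, Finset.mem_univ i, ?_⟩
      have := Real.add_one_lt_exp (x := hM.1.eigenvalues i - 1) (by
        intro h; apply hi; linarith)
      linarith
    linarith
  have hMone : M = 1 := by
    rw [hM.1.spectral_theorem]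
    have : hM.1.eigenvalues = fun _ => 1 := funext hone
    rw [this]
    simp
  rw [hQM, hMone, Matrix.mul_one, hC]

theorem Matrix.PosDef.det_sub_mul_transpose {N : Matrix ι ι ℝ} (hN : N.PosDef)
    (E : Matrix ι κ ℝ) : (N - E * Eᵀ).det = N.det * (1 - Eᵀ * N⁻¹ * E).det := by
  have h := Matrix.det_add_mul (A := N) E (-Eᵀ) (Matrix.isUnit_iff_isUnit_det _ |>.mp hN.isUnit)
  simpa [sub_eq_add_neg] using h

/-- Both sides are Schur complements of the block matrix with diagonal blocks 1 and N and
off-diagonal blocks Eᵀ and E, which settles semidefiniteness; the determinant identity upgrades it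
to definiteness. -/
theorem Matrix.PosDef.sub_mul_transpose_iff {N : Matrix ι ι ℝ} (hN : N.PosDef)
    (E : Matrix ι κ ℝ) : (N - E * Eᵀ).PosDef ↔ (1 - Eᵀ * N⁻¹ * E).PosDef := by
  have hpsd : (N - E * Eᵀ).PosSemidef ↔ (1 - Eᵀ * N⁻¹ * E).PosSemidef := by
    have : Invertible N := hN.isUnit.invertible
    have : Invertible (1 : Matrix κ κ ℝ) := invertibleOne
    have h1 := Matrix.PosDef.fromBlocks₁₁ Eᵀ N (Matrix.PosDef.one (n := κ) (R := ℝ))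
    have h2 := Matrix.PosDef.fromBlocks₂₂ (1 : Matrix κ κ ℝ) Eᵀ hN
    simp only [conjTranspose_eq_transpose_of_trivial, transpose_transpose, inv_one,
      Matrix.mul_one] at h1 h2
    rw [← h1, ← h2]
  have hdet := hN.det_sub_mul_transpose E
  constructor
  · intro h
    have h1 := hpsd.mp h.posSemidef
    rw [h1.posDef_iff_det_ne_zero]
    intro h0
    rw [h0, mul_zero] at hdet
    exact h.det_pos.ne' hdet
  · intro h
    have h1 := hpsd.mpr h.posSemidef
    rw [h1.posDef_iff_det_ne_zero, hdet]
    exact (mul_pos hN.det_pos h.det_pos).ne'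

end MatrixLemmas

/-! ### Derivatives of the determinant and of the matrix inverse. -/

section MatrixCalculus

open scoped Matrix.Norms.Operator

variable {ι κ : Type*} [Fintype ι] [DecidableEq ι] [Fintype κ] [DecidableEq κ]
variable {X : Type*} [NormedAddCommGroup X] [NormedSpace ℝ X]

/-- The functional `M ↦ tr (Y M)`. -/
noncomputable def Matrix.tracePairing (Y : Matrix ι ι ℝ) : Matrix ι ι ℝ →L[ℝ] ℝ :=
  LinearMap.toContinuousLinearMap
    ((Matrix.traceLinearMap ι ℝ ℝ).comp (LinearMap.mulLeft ℝ Y))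

theorem Matrix.tracePairing_apply (Y M : Matrix ι ι ℝ) : Y.tracePairing M = (Y * M).trace := rfl

/-- The congruence `M ↦ Eᵀ M E`. -/
noncomputable def Matrix.congruence (E : Matrix ι κ ℝ) : Matrix ι ι ℝ →L[ℝ] Matrix κ κ ℝ :=
  LinearMap.toContinuousLinearMap
    { toFun := fun M => Eᵀ * M * E
      map_add' := fun M N => by rw [Matrix.mul_add, Matrix.add_mul]
      map_smul' := fun c M => by simp }

theorem Matrix.congruence_apply (E : Matrix ι κ ℝ) (M : Matrix ι ι ℝ) :
    E.congruence M = Eᵀ * M * E := rfl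

theorem tendsto_trace_mul {α : Type*} {l : Filter α} {F G : α → Matrix ι ι ℝ} {A B : Matrix ι ι ℝ}
    (hF : Tendsto F l (𝓝 A)) (hG : Tendsto G l (𝓝 B)) :
    Tendsto (fun a => (F a * G a).trace) l (𝓝 (A * B).trace) := by
  have : Continuous fun M : Matrix ι ι ℝ => M.trace := by fun_prop
  exact (this.tendsto _).comp (hF.mul hG)

/-- The coordinate functional `M ↦ M i j`. -/
noncomputable def Matrix.entryL (i : ι) (j : κ) : Matrix ι κ ℝ →L[ℝ] ℝ :=
  LinearMap.toContinuousLinearMap (Matrix.entryLinearMap ℝ ℝ i j)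

theorem Matrix.contDiff_entry (i : ι) (j : κ) {n : WithTop ℕ∞} :
    ContDiff ℝ n fun M : Matrix ι κ ℝ => M i j :=
  (Matrix.entryL i j).contDiff

theorem Matrix.contDiff_det {n : WithTop ℕ∞} : ContDiff ℝ n fun M : Matrix ι ι ℝ => M.det := by
  simp only [Matrix.det_apply]
  exact ContDiff.sum fun σ _ => (contDiff_prod fun i _ => Matrix.contDiff_entry _ _).const_smul _

theorem Matrix.contDiffAt_of_entries {F : X → Matrix ι κ ℝ} {x : X} {n : WithTop ℕ∞}
    (h : ∀ i j, ContDiffAt ℝ n (fun v => F v i j) x) : ContDiffAt ℝ n F x := by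
  have : F = fun v => ∑ i, ∑ j, F v i j • Matrix.single i j (1 : ℝ) := by
    funext v
    conv_lhs => rw [Matrix.matrix_eq_sum_single (F v)]
    simp [Matrix.smul_single]
  rw [this]
  exact ContDiffAt.sum fun i _ => ContDiffAt.sum fun j _ => (h i j).smul contDiffAt_const

/-- Jacobi's formula. The determinant is a polynomial, hence differentiable, so its derivative can
be read off along lines, where det (M + tH) = det M · det (1 + t M⁻¹H) = det M · (1 + t tr (M⁻¹H) +
O(t²)). -/
theorem Matrix.hasFDerivAt_det {M : Matrix ι ι ℝ} (hM : IsUnit M.det) :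
    HasFDerivAt (fun M : Matrix ι ι ℝ => M.det) (M.det • (M⁻¹).tracePairing) M := by
  have hd : HasFDerivAt (fun M : Matrix ι ι ℝ => M.det) _ M :=
    (Matrix.contDiff_det (n := 1)).differentiable (by simp) M |>.hasFDerivAt
  refine hd.congr_fderiv (ContinuousLinearMap.ext fun H => ?_)
  have h1 : HasDerivAt (fun t : ℝ => M + t • H) H 0 := by
    have h := ((hasDerivAt_id (0 : ℝ)).smul_const H).const_add M
    rw [one_smul] at h
    exact h
  have h2 := HasFDerivAt.comp_hasDerivAt_of_eq (0 : ℝ) hd h1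
    (by rw [zero_smul, add_zero])
  have h3 : ((fun M : Matrix ι ι ℝ => M.det) ∘ fun t : ℝ => M + t • H) = fun t : ℝ =>
      M.det * (1 + (M⁻¹ * H).trace * t +
        (Polynomial.eval t (1 + (Polynomial.X : Polynomial ℝ) • (M⁻¹ * H).map Polynomial.C).det.divX.divX) * t ^ 2) := by
    funext t
    have : M + t • H = M * (1 + t • (M⁻¹ * H)) := by
      rw [Matrix.mul_add, Matrix.mul_one, Matrix.mul_smul, Matrix.mul_nonsing_inv_cancel_left _ _ hM]
    simp only [Function.comp_def]
    rw [this, Matrix.det_mul, Matrix.det_one_add_smul]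
  have h4 : HasDerivAt (fun t : ℝ => M.det * (1 + (M⁻¹ * H).trace * t +
        (Polynomial.eval t (1 + (Polynomial.X : Polynomial ℝ) • (M⁻¹ * H).map Polynomial.C).det.divX.divX) * t ^ 2))
      (M.det * (M⁻¹ * H).trace) 0 := by
    set p := (1 + (Polynomial.X : Polynomial ℝ) • (M⁻¹ * H).map Polynomial.C).det.divX.divX
    have h5 := (((hasDerivAt_id (0 : ℝ)).const_mul (M⁻¹ * H).trace).const_add 1).add
      ((p.hasDerivAt 0).mul (hasDerivAt_pow 2 (0 : ℝ)))
    have h6 := h5.const_mul M.det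
    simpa using h6
  rw [h3] at h2
  exact h2.unique h4

theorem HasFDerivAt.log_det {F : X → Matrix ι ι ℝ} {F' : X →L[ℝ] Matrix ι ι ℝ} {x : X}
    (hF : HasFDerivAt F F' x) (hx : (F x).det ≠ 0) :
    HasFDerivAt (fun v => Real.log (F v).det) ((F x)⁻¹.tracePairing.comp F') x := by
  have h := ((Matrix.hasFDerivAt_det (isUnit_iff_ne_zero.mpr hx)).comp x hF).log hx
  refine h.congr_fderiv (ContinuousLinearMap.ext fun b => ?_)
  exact inv_mul_cancel_left₀ hx _

theorem ContDiffAt.matrix_inv {F : X → Matrix ι ι ℝ} {x : X} {n : WithTop ℕ∞}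
    (hF : ContDiffAt ℝ n F x) (hx : IsUnit (F x)) : ContDiffAt ℝ n (fun v => (F v)⁻¹) x := by
  simp only [Matrix.nonsing_inv_eq_ringInverse]
  obtain ⟨u, hu⟩ := hx
  exact ContDiffAt.comp x (hu ▸ contDiffAt_ringInverse ℝ u) hF

theorem HasFDerivAt.matrix_inv {F : X → Matrix ι ι ℝ} {F' : X →L[ℝ] Matrix ι ι ℝ} {x : X}
    (hF : HasFDerivAt F F' x) (hx : IsUnit (F x)) :
    HasFDerivAt (fun v => (F v)⁻¹)
      ((-(ContinuousLinearMap.mulLeftRight ℝ (Matrix ι ι ℝ) (F x)⁻¹ (F x)⁻¹)).comp F') x := by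
  simp only [Matrix.nonsing_inv_eq_ringInverse]
  obtain ⟨u, hu⟩ := hx
  rw [← hu, Ring.inverse_unit]
  have := hasFDerivAt_ringInverse (𝕜 := ℝ) u
  rw [hu] at this
  exact this.comp x hF

end MatrixCalculus

/-! ### Taylor estimates for twice continuously differentiable maps. -/

section SecondOrder

variable {X W : Type*} [NormedAddCommGroup X] [NormedSpace ℝ X]
  [NormedAddCommGroup W] [NormedSpace ℝ W] {F : X → W} {x : X}

theorem ContDiffAt.eventually_hasFDerivAt_fderiv (hF : ContDiffAt ℝ 2 F x) :
    ∀ᶠ v in 𝓝 x, HasFDerivAt F (fderiv ℝ F v) v := by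
  filter_upwards [hF.eventually (by simp)] with v hv
  exact (hv.differentiableAt (by simp)).hasFDerivAt

theorem ContDiffAt.hasStrictFDerivAt_fderiv (hF : ContDiffAt ℝ 2 F x) :
    HasStrictFDerivAt (fderiv ℝ F) (fderiv ℝ (fderiv ℝ F) x) x :=
  (hF.fderiv_right (m := 1) (by norm_num)).hasStrictFDerivAt (by simp)

theorem ContDiffAt.fderiv_fderiv_comm (hF : ContDiffAt ℝ 2 F x) (a b : X) :
    fderiv ℝ (fderiv ℝ F) x a b = fderiv ℝ (fderiv ℝ F) x b a :=
  (hF.isSymmSndFDerivAt (by simp)) a b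

/-- The error of the affine approximation at a nearby point is quadratic. -/
theorem ContDiffAt.exists_norm_sub_sub_fderiv_le (hF : ContDiffAt ℝ 2 F x) :
    ∃ C : ℝ, ∃ δ > 0, ∀ p ∈ Metric.ball x δ, ∀ q ∈ Metric.ball x δ,
      ‖F p - F q - fderiv ℝ F q (p - q)‖ ≤ C * ‖p - q‖ * ‖p - q‖ := by
  -- The derivative is Lipschitz near `x`, being strictly differentiable there; the mean value
  -- inequality turns this into a quadratic error.
  obtain ⟨K, U, hU, hK⟩ := hF.hasStrictFDerivAt_fderiv.exists_lipschitzOnWith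
  obtain ⟨δ, hδ, hball⟩ := Metric.mem_nhds_iff.mp
    (inter_mem hU hF.eventually_hasFDerivAt_fderiv)
  refine ⟨K, δ, hδ, fun p hp q hq => ?_⟩
  have hseg : segment ℝ q p ⊆ Metric.ball x δ := (convex_ball x δ).segment_subset hq hp
  refine (convex_segment q p).norm_image_sub_le_of_norm_hasFDerivWithin_le'
    (f' := fderiv ℝ F) (fun z hz => (hball (hseg hz)).2.hasFDerivWithinAt) (fun z hz => ?_)
    (left_mem_segment ℝ q p) (right_mem_segment ℝ q p)
  have h1 := hK.dist_le_mul z (hball (hseg hz)).1 q (hball hq).1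
  rw [dist_eq_norm, dist_eq_norm] at h1
  refine h1.trans (mul_le_mul_of_nonneg_left ?_ K.2)
  have := (segment_subset_closedBall_left q p) hz
  rwa [Metric.mem_closedBall, dist_comm q p, dist_eq_norm, dist_eq_norm] at this

/-- Second-order Taylor expansion. -/
theorem ContDiffAt.taylor_two (hF : ContDiffAt ℝ 2 F 0) :
    (fun v => F v - F 0 - fderiv ℝ F 0 v - (2⁻¹ : ℝ) • fderiv ℝ (fderiv ℝ F) 0 v v)
      =o[𝓝 0] fun v => ‖v‖ ^ 2 := by
  set F₁ := fderiv ℝ F 0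
  set F₂ := fderiv ℝ (fderiv ℝ F) 0
  rw [Asymptotics.isLittleO_iff]
  intro c hc
  have h1 := (hF.hasStrictFDerivAt_fderiv.hasFDerivAt.isLittleO).def hc
  obtain ⟨δ, hδ, hball⟩ := Metric.mem_nhds_iff.mp
    (inter_mem h1 hF.eventually_hasFDerivAt_fderiv)
  filter_upwards [Metric.ball_mem_nhds 0 hδ] with v hv
  have hseg : segment ℝ 0 v ⊆ Metric.ball 0 δ :=
    (convex_ball 0 δ).segment_subset (Metric.mem_ball_self hδ) hv
  have hder : ∀ z ∈ segment ℝ 0 v, HasFDerivWithinAt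
      (fun v => F v - F 0 - F₁ v - (2⁻¹ : ℝ) • F₂ v v) (fderiv ℝ F z - F₁ - F₂ z)
      (segment ℝ 0 v) z := by
    intro z hz
    -- Symmetry of the second derivative makes `F₂ z` the derivative of the half quadratic form.
    have hq : HasFDerivAt (fun v => (2⁻¹ : ℝ) • F₂ v v) (F₂ z) z := by
      have := (F₂.hasFDerivAt (x := z)).clm_apply (hasFDerivAt_id z)
      refine (this.const_smul (2⁻¹ : ℝ)).congr_fderiv (ContinuousLinearMap.ext fun a => ?_)
      have hs : F₂ a z = F₂ z a := hF.fderiv_fderiv_comm a z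
      simp [hs, ← two_smul ℝ, smul_smul]
    exact ((((hball (hseg hz)).2.sub_const (F 0)).sub F₁.hasFDerivAt).sub hq).hasFDerivWithinAt
  have hbd : ∀ z ∈ segment ℝ 0 v, ‖fderiv ℝ F z - F₁ - F₂ z‖ ≤ c * ‖v‖ := by
    intro z hz
    have h2 := (hball (hseg hz)).1
    simp only [mem_ofPred_eq, sub_zero] at h2
    refine h2.trans (mul_le_mul_of_nonneg_left ?_ hc.le)
    have := (segment_subset_closedBall_left 0 v) hz
    simpa using this
  have := (convex_segment 0 v).norm_image_sub_le_of_norm_hasFDerivWithin_le hder hbd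
    (left_mem_segment ℝ 0 v) (right_mem_segment ℝ 0 v)
  simpa [pow_two, mul_assoc] using this

end SecondOrder

/-! ### Compactness along ultrafilters and scaled difference quotients. -/

section Limits

variable {α X W : Type*} [NormedAddCommGroup X] [NormedSpace ℝ X]
  [NormedAddCommGroup W] [NormedSpace ℝ W]

/-- Ultrafilters take the place of subsequences: bounded quantities converge outright. -/
theorem Ultrafilter.exists_tendsto_of_norm_le [FiniteDimensional ℝ W] (l : Ultrafilter α)
    {u : α → W} {C : ℝ} (h : ∀ᶠ a in l, ‖u a‖ ≤ C) : ∃ w, Tendsto u l (𝓝 w) := by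
  have : ProperSpace W := FiniteDimensional.proper ℝ W
  obtain ⟨w, -, hw⟩ := (isCompact_closedBall (0 : W) C).ultrafilter_le_nhds (l.map u)
    (by
      rw [le_principal_iff, Ultrafilter.mem_coe, Ultrafilter.mem_map]
      exact h.mono fun a ha => by simpa using ha)
  exact ⟨w, hw⟩

/-- Along an ultrafilter, either `u = O(μ)` or `μ = o(u)`. -/
theorem Ultrafilter.norm_le_or_tendsto_div (l : Ultrafilter α) (u : α → X) {μ : α → ℝ}
    (hμ : ∀ᶠ a in l, 0 < μ a) :
    (∃ C : ℝ, ∀ᶠ a in l, ‖(μ a)⁻¹ • u a‖ ≤ C) ∨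
      ((∀ᶠ a in l, 0 < ‖u a‖) ∧ Tendsto (fun a => ‖u a‖⁻¹ * μ a) l (𝓝 0)) := by
  by_cases h : ∃ C : ℝ, ∀ᶠ a in l, ‖(μ a)⁻¹ • u a‖ ≤ C
  · exact Or.inl h
  right
  push Not at h
  have h' : ∀ C : ℝ, ∀ᶠ a in l, C < ‖(μ a)⁻¹ • u a‖ := fun C => h C
  have hpos : ∀ᶠ a in l, 0 < ‖u a‖ := by
    filter_upwards [h' 0] with a ha
    rw [norm_smul] at ha
    exact (pos_iff_pos_of_mul_pos ha).mp (lt_of_le_of_ne (norm_nonneg _) fun h0 => by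
      rw [← h0, zero_mul] at ha; exact lt_irrefl _ ha)
  refine ⟨hpos, ?_⟩
  rw [Metric.tendsto_nhds]
  intro ε hε
  filter_upwards [h' ε⁻¹, hμ, hpos] with a ha hμa hua
  rw [norm_smul, norm_inv, Real.norm_of_nonneg hμa.le] at ha
  rw [dist_zero_right, Real.norm_of_nonneg (by positivity)]
  rw [inv_lt_iff_one_lt_mul₀ hε] at ha
  rw [inv_mul_lt_iff₀ hua]
  have := mul_lt_mul_of_pos_right ha hμa
  calc μ a = 1 * μ a := (one_mul _).symm
    _ < _ := this
    _ = ‖u a‖ * ε := by field_simp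

/-- Both points move and the scale `c` is arbitrary; strict differentiability is what allows the
base point of the quotient to move. -/
theorem HasStrictFDerivAt.tendsto_smul_sub {l : Filter α} {F : X → W} {F' : X →L[ℝ] W} {x e : X}
    (hF : HasStrictFDerivAt F F' x) {p q : α → X} {c : α → ℝ} (hp : Tendsto p l (𝓝 x))
    (hq : Tendsto q l (𝓝 x)) (he : Tendsto (fun a => c a • (p a - q a)) l (𝓝 e)) :
    Tendsto (fun a => c a • (F (p a) - F (q a))) l (𝓝 (F' e)) := by
  have h1 := hF.isLittleO.comp_tendsto (hp.prodMk_nhds hq)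
  have h2 : (fun a => c a • (F (p a) - F (q a) - F' (p a - q a))) =o[l] fun a =>
      c a • (p a - q a) := (Asymptotics.isBigO_refl c l).smul_isLittleO h1
  have h3 : Tendsto (fun a => c a • (F (p a) - F (q a) - F' (p a - q a))) l (𝓝 0) :=
    (Asymptotics.isLittleO_one_iff ℝ).mp (h2.trans_isBigO (he.isBigO_one ℝ))
  have h4 := h3.add ((F'.continuous.tendsto e).comp he)
  rw [zero_add] at h4
  refine h4.congr fun a => ?_
  simp only [Function.comp_apply, map_smul, ← smul_add, sub_add_cancel]

theorem HasStrictFDerivAt.tendsto_smul_sub_self {l : Filter α} {F : X → W} {F' : X →L[ℝ] W}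
    {x e : X} (hF : HasStrictFDerivAt F F' x) {p : α → X} {c : α → ℝ} (hp : Tendsto p l (𝓝 x))
    (he : Tendsto (fun a => c a • (p a - x)) l (𝓝 e)) :
    Tendsto (fun a => c a • (F (p a) - F x)) l (𝓝 (F' e)) :=
  hF.tendsto_smul_sub hp tendsto_const_nhds he

end Limits

/-! ### Vertex barriers: limits of critical points and of their dual matrices. -/

section

open scoped Matrix.Norms.Operator

/-- Data of the barrier problems `f + μ φ - μ log det S` near the point `0`, at which the whole
matrix `S` vanishes. -/
structure VertexBarrier (X κ : Type*) [NormedAddCommGroup X] [NormedSpace ℝ X]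
    [Fintype κ] [DecidableEq κ] where
  f : X → ℝ
  φ : X → ℝ
  S : X → Matrix κ κ ℝ
  symm : ∀ v, (S v)ᵀ = S v
  contDiffAt_f : ContDiffAt ℝ 2 f 0
  contDiffAt_φ : ContDiffAt ℝ 2 φ 0
  contDiffAt_S : ContDiffAt ℝ 2 S 0
  S_zero : S 0 = 0

namespace VertexBarrier

variable {X κ : Type*} [NormedAddCommGroup X] [NormedSpace ℝ X] [FiniteDimensional ℝ X]
  [Fintype κ] [DecidableEq κ] (B : VertexBarrier X κ)

/-- The multipliers at `0`. -/
def multipliers : Set (Matrix κ κ ℝ) :=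
  {Y | Y.PosSemidef ∧ ∀ d, fderiv ℝ B.f 0 d = (Y * fderiv ℝ B.S 0 d).trace}

/-- The Hessian at `0` of the Lagrangian `f - tr (Y S)`. -/
noncomputable def hess (Y : Matrix κ κ ℝ) (a b : X) : ℝ :=
  fderiv ℝ (fderiv ℝ B.f) 0 a b - (Y * fderiv ℝ (fderiv ℝ B.S) 0 a b).trace

/-- The derivative of the barrier function. -/
noncomputable def grad (μ : ℝ) (v b : X) : ℝ :=
  fderiv ℝ B.f v b + μ * fderiv ℝ B.φ v b - μ * ((B.S v)⁻¹ * fderiv ℝ B.S v b).trace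

/-- Critical points of the barrier function. -/
def IsCritical (μ : ℝ) (v : X) : Prop :=
  (B.S v).PosDef ∧ ∀ b, B.grad μ v b = 0

/-- The candidates for the initial direction of the central path. -/
def IsDirection (w : X) : Prop :=
  ∃ Y ∈ B.multipliers, Y * fderiv ℝ B.S 0 w = 1 ∧
    ∀ u, fderiv ℝ B.S 0 u = 0 → B.hess Y w u + fderiv ℝ B.φ 0 u = 0

/-- Strict complementarity, the Mangasarian-Fromovitz condition and the second-order condition. -/
structure Regular : Prop where
  strict : ∃ Y ∈ B.multipliers, Y.PosDef
  mfcq : ∃ d, (fderiv ℝ B.S 0 d).PosDef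
  ssosc : ∀ Y ∈ B.multipliers, ∀ d, d ≠ 0 → fderiv ℝ B.S 0 d = 0 → 0 < B.hess Y d d

variable {B}

theorem hasStrictFDerivAt_S : HasStrictFDerivAt B.S (fderiv ℝ B.S 0) 0 :=
  B.contDiffAt_S.hasStrictFDerivAt (by simp)

theorem hasStrictFDerivAt_f : HasStrictFDerivAt B.f (fderiv ℝ B.f 0) 0 :=
  B.contDiffAt_f.hasStrictFDerivAt (by simp)

theorem tendsto_fderiv_S {α : Type*} {l : Filter α} {v : α → X} (hv : Tendsto v l (𝓝 0)) (b : X) :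
    Tendsto (fun a => fderiv ℝ B.S (v a) b) l (𝓝 (fderiv ℝ B.S 0 b)) :=
  ((ContinuousLinearMap.apply ℝ _ b).continuous.tendsto _).comp
    (B.contDiffAt_S.hasStrictFDerivAt_fderiv.continuousAt.tendsto.comp hv)

theorem tendsto_fderiv_f {α : Type*} {l : Filter α} {v : α → X} (hv : Tendsto v l (𝓝 0)) (b : X) :
    Tendsto (fun a => fderiv ℝ B.f (v a) b) l (𝓝 (fderiv ℝ B.f 0 b)) :=
  ((ContinuousLinearMap.apply ℝ _ b).continuous.tendsto _).comp
    (B.contDiffAt_f.hasStrictFDerivAt_fderiv.continuousAt.tendsto.comp hv)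

theorem tendsto_fderiv_φ {α : Type*} {l : Filter α} {v : α → X} (hv : Tendsto v l (𝓝 0)) (b : X) :
    Tendsto (fun a => fderiv ℝ B.φ (v a) b) l (𝓝 (fderiv ℝ B.φ 0 b)) :=
  ((ContinuousLinearMap.apply ℝ _ b).continuous.tendsto _).comp
    (B.contDiffAt_φ.hasStrictFDerivAt_fderiv.continuousAt.tendsto.comp hv)

theorem transpose_fderiv_S (v d : X) : (fderiv ℝ B.S v d)ᵀ = fderiv ℝ B.S v d := by
  by_cases hd : DifferentiableAt ℝ B.S v
  · have h := hd.hasFDerivAt.lim_real d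
    have h2 : Tendsto (fun t : ℝ => (t • (B.S (v + t⁻¹ • d) - B.S v))ᵀ) atTop
        (𝓝 (fderiv ℝ B.S v d)ᵀ) := by
      have hc : Continuous fun M : Matrix κ κ ℝ => Mᵀ := by fun_prop
      exact (hc.tendsto _).comp h
    refine tendsto_nhds_unique (h2.congr fun t => ?_) h
    rw [Matrix.transpose_smul, Matrix.transpose_sub, B.symm, B.symm]
  -- Where `S` is not differentiable, `fderiv` is zero by convention, which is symmetric too.
  · rw [fderiv_zero_of_not_differentiableAt hd]
    rfl

/-- If Y S'(0) w = 1, then tr (Q Y⁻¹) = f'(0) w for every multiplier Q, so by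
`Matrix.PosDef.det_le_of_trace_eq` Y is the only multiplier of maximal determinant, and two
directions share it. Their difference lies in the kernel of S'(0), where the second-order condition
excludes a nonzero vector. -/
theorem Regular.isDirection_unique (hB : B.Regular) {w w' : X} (hw : B.IsDirection w)
    (hw' : B.IsDirection w') : w = w' := by
  obtain ⟨Y, hY, hYw, hYu⟩ := hw
  obtain ⟨Y', hY', hYw', hYu'⟩ := hw'
  have hpd : ∀ {Z M : Matrix κ κ ℝ}, Z.PosSemidef → Z * M = 1 → Z.PosDef := fun hZ h => by
    rw [hZ.posDef_iff_isUnit]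
    exact IsUnit.of_mul_eq_one _ h
  have hYp := hpd hY.1 hYw
  have hYp' := hpd hY'.1 hYw'
  have h1 := hYp.det_le_of_trace_eq hYw hY'.1 (by rw [← hY'.2, hY.2, hYw, Matrix.trace_one])
  have h2 := hYp'.det_le_of_trace_eq hYw' hY.1 (by rw [← hY.2, hY'.2, hYw', Matrix.trace_one])
  have hYY : Y' = Y := h1.2 h2.1
  subst hYY
  have hA : fderiv ℝ B.S 0 (w - w') = 0 := by
    have h3 : Y' * fderiv ℝ B.S 0 (w - w') = 0 := by
      rw [map_sub, Matrix.mul_sub, hYw, hYw', sub_self]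
    exact (hYp.isUnit.mul_right_eq_zero).mp h3
  by_contra hne
  have h3 := hB.ssosc _ hY _ (sub_ne_zero.mpr hne) hA
  have h4 := hYu _ hA
  have h5 := hYu' _ hA
  have h6 : B.hess Y' (w - w') (w - w') = B.hess Y' w (w - w') - B.hess Y' w' (w - w') := by
    simp only [hess, map_sub, _root_.sub_apply, Matrix.mul_sub, Matrix.trace_sub]
    ring
  linarith

/-- Along critical points, the dual matrices are bounded and accumulate at multipliers. -/
theorem Regular.exists_multiplier (hB : B.Regular) {α : Type*} (l : Ultrafilter α) {μ : α → ℝ}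
    {v : α → X} (hμ0 : Tendsto μ l (𝓝 0)) (hμ : ∀ᶠ a in l, 0 < μ a) (hv : Tendsto v l (𝓝 0))
    (hc : ∀ᶠ a in l, B.IsCritical (μ a) (v a)) :
    ∃ Y ∈ B.multipliers, Tendsto (fun a => μ a • (B.S (v a))⁻¹) l (𝓝 Y) := by
  set Z : α → Matrix κ κ ℝ := fun a => μ a • (B.S (v a))⁻¹ with hZ
  have hZpsd : ∀ᶠ a in l, (Z a).PosSemidef := by
    filter_upwards [hμ, hc] with a ha hca
    exact hca.1.inv.posSemidef.smul ha.le
  have hcrit : ∀ b, Tendsto (fun a => (Z a * fderiv ℝ B.S (v a) b).trace) l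
      (𝓝 (fderiv ℝ B.f 0 b)) := by
    intro b
    have h1 := (tendsto_fderiv_f (B := B) hv b).add (hμ0.mul (tendsto_fderiv_φ (B := B) hv b))
    rw [zero_mul, add_zero] at h1
    refine h1.congr' ?_
    filter_upwards [hc] with a hca
    have h2 := hca.2 b
    rw [grad] at h2
    rw [hZ, Matrix.smul_mul, Matrix.trace_smul, smul_eq_mul]
    linarith
  have hbd : ∃ C : ℝ, ∀ᶠ a in l, ‖Z a‖ ≤ C := by
    -- With constant scale 1 the dichotomy is between bounded and unbounded. In the unbounded case
    -- the normalized limit is a nonzero positive semidefinite matrix with zero pairing against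
    -- S'(0) d ≻ 0, which is impossible.
    rcases l.norm_le_or_tendsto_div Z (μ := fun _ => 1) (by simp) with ⟨C, hC⟩ | ⟨hpos, hinv⟩
    · exact ⟨C, by simpa using hC⟩
    exfalso
    obtain ⟨W, hW⟩ := l.exists_tendsto_of_norm_le (u := fun a => ‖Z a‖⁻¹ • Z a) (C := 1) (by
      filter_upwards [hpos] with a ha
      rw [norm_smul, norm_inv, norm_norm, inv_mul_cancel₀ ha.ne'])
    have hWn : ‖W‖ = 1 := by
      refine tendsto_nhds_unique hW.norm (tendsto_const_nhds.congr' ?_)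
      filter_upwards [hpos] with a ha
      rw [norm_smul, norm_inv, norm_norm, inv_mul_cancel₀ ha.ne']
    have hWpsd : W.PosSemidef := by
      refine Matrix.isClosed_posSemidef.mem_of_tendsto hW ?_
      filter_upwards [hZpsd] with a ha
      exact ha.smul (by positivity)
    obtain ⟨d, hd⟩ := hB.mfcq
    have h0 : (W * fderiv ℝ B.S 0 d).trace = 0 := by
      refine tendsto_nhds_unique (tendsto_trace_mul hW (tendsto_fderiv_S hv d)) ?_
      have h1 := hinv.mul (hcrit d)
      rw [zero_mul] at h1
      refine h1.congr fun a => ?_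
      rw [Matrix.smul_mul (‖Z a‖⁻¹), Matrix.trace_smul, smul_eq_mul, mul_one]
    have := hWpsd.eq_zero_of_trace_mul_nonpos hd h0.le
    rw [this, norm_zero] at hWn
    exact zero_ne_one hWn
  obtain ⟨C, hC⟩ := hbd
  obtain ⟨Y, hY⟩ := l.exists_tendsto_of_norm_le hC
  refine ⟨Y, ⟨Matrix.isClosed_posSemidef.mem_of_tendsto hY hZpsd, fun d => ?_⟩, hY⟩
  exact tendsto_nhds_unique (hcrit d) (tendsto_trace_mul hY (tendsto_fderiv_S hv d))

/-- Critical points of the barrier functions near `0` leave `0` along a direction. -/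
theorem Regular.exists_isDirection (hB : B.Regular) {α : Type*} (l : Ultrafilter α) {μ : α → ℝ}
    {v : α → X} (hμ0 : Tendsto μ l (𝓝 0)) (hμ : ∀ᶠ a in l, 0 < μ a) (hv : Tendsto v l (𝓝 0))
    (hc : ∀ᶠ a in l, B.IsCritical (μ a) (v a)) :
    ∃ w, B.IsDirection w ∧ Tendsto (fun a => (μ a)⁻¹ • v a) l (𝓝 w) := by
  obtain ⟨Y, hY, hYlim⟩ := hB.exists_multiplier l hμ0 hμ hv hc
  obtain ⟨Y₁, hY₁, hY₁p⟩ := hB.strict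
  have hmul : ∀ᶠ a in l, (μ a • (B.S (v a))⁻¹) * B.S (v a) = μ a • 1 := by
    filter_upwards [hc] with a ha
    rw [Matrix.smul_mul, Matrix.nonsing_inv_mul _ (isUnit_iff_ne_zero.mpr ha.1.det_pos.ne')]
  have hker : ∀ u, fderiv ℝ B.S 0 u = 0 → fderiv ℝ B.f 0 u = 0 := fun u hu => by
    rw [hY.2, hu, Matrix.mul_zero, Matrix.trace_zero]
  -- criticality tested against a direction in the kernel, at scale `c`
  have hscale : ∀ (c : α → ℝ) (d u : X) (r : ℝ), fderiv ℝ B.S 0 u = 0 →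
      Tendsto (fun a => c a • v a) l (𝓝 d) → Tendsto (fun a => c a * μ a) l (𝓝 r) →
      B.hess Y d u + r * fderiv ℝ B.φ 0 u = 0 := by
    intro c d u r hu hd hr
    have h1 := (B.contDiffAt_f.hasStrictFDerivAt_fderiv.tendsto_smul_sub_self hv
      (by simpa using hd))
    have h2 := (B.contDiffAt_S.hasStrictFDerivAt_fderiv.tendsto_smul_sub_self hv
      (by simpa using hd))
    have h1u : Tendsto (fun a => c a * fderiv ℝ B.f (v a) u) l
        (𝓝 (fderiv ℝ (fderiv ℝ B.f) 0 d u)) := by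
      refine (((ContinuousLinearMap.apply ℝ ℝ u).continuous.tendsto _).comp h1).congr fun a => ?_
      change c a * (fderiv ℝ B.f (v a) u - fderiv ℝ B.f 0 u) = _
      rw [hker u hu, sub_zero]
    have h2u : Tendsto (fun a => c a • fderiv ℝ B.S (v a) u) l
        (𝓝 (fderiv ℝ (fderiv ℝ B.S) 0 d u)) := by
      refine (((ContinuousLinearMap.apply ℝ (Matrix κ κ ℝ) u).continuous.tendsto _).comp
        h2).congr fun a => ?_
      change c a • (fderiv ℝ B.S (v a) u - fderiv ℝ B.S 0 u) = _
      rw [hu, sub_zero]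
    have h3 := (h1u.sub (tendsto_trace_mul hYlim h2u)).add (hr.mul (tendsto_fderiv_φ (B := B) hv u))
    refine tendsto_nhds_unique h3 (tendsto_const_nhds.congr' ?_)
    filter_upwards [hc] with a ha
    have h4 := ha.2 u
    rw [grad] at h4
    rw [Matrix.smul_mul, Matrix.mul_smul, Matrix.trace_smul, Matrix.trace_smul, smul_eq_mul,
      smul_eq_mul]
    linear_combination (-c a) * h4
  rcases l.norm_le_or_tendsto_div v hμ with ⟨C, hC⟩ | ⟨hpos, hdiv⟩
  · obtain ⟨w, hw⟩ := l.exists_tendsto_of_norm_le hC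
    refine ⟨w, ⟨Y, hY, ?_, fun u hu => ?_⟩, hw⟩
    -- The identity (μ S⁻¹)(S/μ) = 1 passes to the limit.
    · have h1 := hasStrictFDerivAt_S.tendsto_smul_sub_self (F := B.S) hv (by simpa using hw)
      refine tendsto_nhds_unique (hYlim.mul h1) (tendsto_const_nhds.congr' ?_)
      filter_upwards [hmul, hμ] with a ha hμa
      rw [B.S_zero, sub_zero, mul_smul_comm, ha, smul_smul, inv_mul_cancel₀ hμa.ne', one_smul]
    · have := hscale _ w u 1 hu hw (tendsto_const_nhds.congr' (by
        filter_upwards [hμ] with a ha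
        rw [inv_mul_cancel₀ ha.ne']))
      rwa [one_mul] at this
  -- If μ = o(v), the normalized limit `d` has S'(0) d ⪰ 0 with zero pairing against `Y`. That
  -- pairing equals f'(0) d, so it vanishes for the positive definite multiplier as well, and S'(0)
  -- d = 0. Criticality at scale 1/‖v‖ then gives zero curvature along `d`, against the second-order
  -- condition.
  · exfalso
    have hn : ∀ᶠ a in l, ‖‖v a‖⁻¹ • v a‖ = 1 := by
      filter_upwards [hpos] with a ha
      rw [norm_smul, norm_inv, norm_norm, inv_mul_cancel₀ ha.ne']
    obtain ⟨d, hd⟩ := l.exists_tendsto_of_norm_le (hn.mono fun a ha => ha.le)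
    have hdn : ‖d‖ = 1 := tendsto_nhds_unique hd.norm (tendsto_const_nhds.congr' (by
      filter_upwards [hn] with a ha using ha.symm))
    have h1 := hasStrictFDerivAt_S.tendsto_smul_sub_self (F := B.S) hv (by simpa using hd)
    have hpsd : (fderiv ℝ B.S 0 d).PosSemidef := by
      refine Matrix.isClosed_posSemidef.mem_of_tendsto h1 ?_
      filter_upwards [hc] with a ha
      rw [B.S_zero, sub_zero]
      exact ha.1.posSemidef.smul (by positivity)
    have htr : (Y * fderiv ℝ B.S 0 d).trace = 0 := by
      have h2 := hdiv.mul_const ((1 : Matrix κ κ ℝ).trace)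
      rw [zero_mul] at h2
      refine tendsto_nhds_unique (tendsto_trace_mul hYlim h1) (h2.congr' ?_)
      filter_upwards [hmul] with a ha
      rw [B.S_zero, sub_zero, mul_smul_comm, ha, smul_smul, Matrix.trace_smul, smul_eq_mul]
    have hA : fderiv ℝ B.S 0 d = 0 := by
      refine hpsd.eq_zero_of_trace_mul_nonpos hY₁p ?_
      rw [Matrix.trace_mul_comm, ← hY₁.2, hY.2, htr]
    have h3 := hscale _ d d 0 hA hd hdiv
    have h4 := hB.ssosc Y hY d (norm_pos_iff.mp (by rw [hdn]; exact one_pos)) hA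
    linarith

end VertexBarrier

end

/-! ### Vertex barriers: strict monotonicity of the gradient after blow-up. -/

section

open scoped Matrix.Norms.Operator

theorem Filter.Tendsto.continuousLinearMap_apply {α X W : Type*} [NormedAddCommGroup X]
    [NormedSpace ℝ X] [NormedAddCommGroup W] [NormedSpace ℝ W] {l : Filter α} {F : α → X →L[ℝ] W}
    {u : α → X} {F₀ : X →L[ℝ] W} {u₀ : X} (hF : Tendsto F l (𝓝 F₀)) (hu : Tendsto u l (𝓝 u₀)) :
    Tendsto (fun a => F a (u a)) l (𝓝 (F₀ u₀)) :=
  (isBoundedBilinearMap_apply.continuous.tendsto (F₀, u₀)).comp (hF.prodMk_nhds hu)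

namespace VertexBarrier

variable {X κ : Type*} [NormedAddCommGroup X] [NormedSpace ℝ X] [FiniteDimensional ℝ X]
  [Fintype κ] [DecidableEq κ] {B : VertexBarrier X κ}

theorem grad_smul (μ c : ℝ) (v b : X) : B.grad μ v (c • b) = c * B.grad μ v b := by
  simp only [grad, map_smul, Matrix.mul_smul, Matrix.trace_smul, smul_eq_mul]
  ring

theorem IsDirection.posDef {w : X} {Y : Matrix κ κ ℝ} (hY : Y ∈ B.multipliers)
    (h : Y * fderiv ℝ B.S 0 w = 1) : Y.PosDef := by
  rw [hY.1.posDef_iff_isUnit]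
  exact IsUnit.of_mul_eq_one _ h

theorem tendsto_inv_smul_S {α : Type*} {l : Filter α} {μ : α → ℝ} {a : α → X} {w : X}
    (hμ0 : Tendsto μ l (𝓝 0)) (hμ : ∀ᶠ i in l, 0 < μ i) (ha : Tendsto a l (𝓝 w)) :
    Tendsto (fun i => (μ i)⁻¹ • B.S (μ i • a i)) l (𝓝 (fderiv ℝ B.S 0 w)) := by
  have hp : Tendsto (fun i => μ i • a i) l (𝓝 0) := by simpa using hμ0.smul ha
  have h := hasStrictFDerivAt_S.tendsto_smul_sub_self (F := B.S) (c := fun i => (μ i)⁻¹) hp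
    (e := w) (ha.congr' (by
      filter_upwards [hμ] with i hi
      rw [sub_zero, smul_smul, inv_mul_cancel₀ hi.ne', one_smul]))
  refine h.congr fun i => ?_
  rw [B.S_zero, sub_zero]

theorem eventually_posDef {α : Type*} {l : Filter α} {μ : α → ℝ} {a : α → X} {w : X}
    (hμ0 : Tendsto μ l (𝓝 0)) (hμ : ∀ᶠ i in l, 0 < μ i) (ha : Tendsto a l (𝓝 w))
    (hw : (fderiv ℝ B.S 0 w).PosDef) : ∀ᶠ i in l, (B.S (μ i • a i)).PosDef := by
  have h := hw.eventually (tendsto_inv_smul_S (B := B) hμ0 hμ ha) (.of_forall fun i => by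
    rw [Matrix.transpose_smul, B.symm])
  filter_upwards [h, hμ] with i hi hμi
  have := hi.smul hμi
  rwa [smul_smul, mul_inv_cancel₀ hμi.ne', one_smul] at this

/-- The derivative of the barrier function is strictly monotone around the direction of the
central path. -/
theorem Regular.eventually_grad_lt (hB : B.Regular) {w : X} (hw : B.IsDirection w) :
    ∀ᶠ x in 𝓝[>] (0 : ℝ) ×ˢ (𝓝 w ×ˢ 𝓝 w), x.2.1 ≠ x.2.2 →
      B.grad x.1 (x.1 • x.2.2) (x.2.1 - x.2.2) < B.grad x.1 (x.1 • x.2.1) (x.2.1 - x.2.2) := by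
  obtain ⟨Y, hY, hYw, -⟩ := hw
  have hYp := IsDirection.posDef hY hYw
  have hwY : fderiv ℝ B.S 0 w = Y⁻¹ := (Matrix.inv_eq_right_inv hYw).symm
  have hwp : (fderiv ℝ B.S 0 w).PosDef := hwY ▸ hYp.inv
  -- A failure is followed along an ultrafilter; the normalized differences `e` converge to a unit
  -- vector `d` at which the second-order condition will be violated.
  refine Filter.mem_iff_ultrafilter.mpr fun l hl => ?_
  by_contra hcon
  rw [← Ultrafilter.compl_mem_iff_notMem] at hcon
  set μ : ℝ × X × X → ℝ := fun x => x.1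
  set a : ℝ × X × X → X := fun x => x.2.1
  set b : ℝ × X × X → X := fun x => x.2.2
  set p : ℝ × X × X → X := fun x => μ x • a x
  set q : ℝ × X × X → X := fun x => μ x • b x
  have hne : ∀ᶠ x in l, a x ≠ b x ∧
      B.grad (μ x) (p x) (a x - b x) ≤ B.grad (μ x) (q x) (a x - b x) := by
    filter_upwards [hcon] with x hx
    simpa using hx
  have hμ1 : Tendsto μ l (𝓝[>] 0) := tendsto_fst.mono_left hl
  have hμ0 : Tendsto μ l (𝓝 0) := hμ1.mono_right nhdsWithin_le_nhds
  have hμ : ∀ᶠ x in l, 0 < μ x := hμ1.eventually self_mem_nhdsWithin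
  have ha : Tendsto a l (𝓝 w) := (tendsto_fst.comp tendsto_snd).mono_left hl
  have hb : Tendsto b l (𝓝 w) := (tendsto_snd.comp tendsto_snd).mono_left hl
  have hp : Tendsto p l (𝓝 0) := by simpa using hμ0.smul ha
  have hq : Tendsto q l (𝓝 0) := by simpa using hμ0.smul hb
  have hpp := eventually_posDef (B := B) hμ0 hμ ha hwp
  have hqp := eventually_posDef (B := B) hμ0 hμ hb hwp
  have hinvlim : ∀ c : ℝ × X × X → X, Tendsto c l (𝓝 w) →
      Tendsto (fun x => μ x • (B.S (μ x • c x))⁻¹) l (𝓝 Y) := by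
    intro c hc
    have h1 := tendsto_inv_smul_S (B := B) hμ0 hμ hc
    have hu : IsUnit (fderiv ℝ B.S 0 w) := hwp.isUnit
    have h2 : ContinuousAt (fun M : Matrix κ κ ℝ => M⁻¹) (fderiv ℝ B.S 0 w) :=
      (ContDiffAt.matrix_inv (n := 0) contDiffAt_id hu).continuousAt
    have h3 := h2.tendsto.comp h1
    rw [Matrix.inv_eq_left_inv hYw] at h3
    refine h3.congr' ?_
    filter_upwards [hμ, eventually_posDef (B := B) hμ0 hμ hc hwp] with x hx hxp
    refine Matrix.inv_eq_left_inv ?_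
    rw [smul_mul_smul_comm, mul_inv_cancel₀ hx.ne', one_smul,
      Matrix.nonsing_inv_mul _ (isUnit_iff_ne_zero.mpr hxp.det_pos.ne')]
  -- Since S(μ c)/μ → S'(0) w = Y⁻¹ whenever c → w, both dual matrices tend to `Y`.
  set P : ℝ × X × X → Matrix κ κ ℝ := fun x => μ x • (B.S (p x))⁻¹ with hP
  set Q : ℝ × X × X → Matrix κ κ ℝ := fun x => μ x • (B.S (q x))⁻¹ with hQ
  have hPlim : Tendsto P l (𝓝 Y) := hinvlim a ha
  have hQlim : Tendsto Q l (𝓝 Y) := hinvlim b hb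
  set τ : ℝ × X × X → ℝ := fun x => ‖p x - q x‖ with hτ
  have hpq : ∀ x, p x - q x = μ x • (a x - b x) := fun x => by simp only [p, q, smul_sub]
  have hτpos : ∀ᶠ x in l, 0 < τ x := by
    filter_upwards [hμ, hne] with x hx hxne
    rw [hτ, norm_pos_iff, hpq]
    exact smul_ne_zero hx.ne' (sub_ne_zero.mpr hxne.1)
  set e : ℝ × X × X → X := fun x => (τ x)⁻¹ • (p x - q x) with he
  have hen : ∀ᶠ x in l, ‖e x‖ = 1 := by
    filter_upwards [hτpos] with x hx
    rw [he, norm_smul, norm_inv, hτ, norm_norm]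
    exact inv_mul_cancel₀ hx.ne'
  obtain ⟨d, hd⟩ := l.exists_tendsto_of_norm_le (hen.mono fun x hx => hx.le)
  have hdn : ‖d‖ = 1 := tendsto_nhds_unique hd.norm (tendsto_const_nhds.congr' (by
    filter_upwards [hen] with x hx using hx.symm))
  have hgrad : ∀ᶠ x in l, B.grad (μ x) (p x) (e x) ≤ B.grad (μ x) (q x) (e x) := by
    filter_upwards [hne, hμ, hτpos] with x hx hμx hτx
    rw [he]
    simp only [hpq, smul_smul, grad_smul]
    exact mul_le_mul_of_nonneg_left hx.2 (by positivity)
  -- difference quotients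
  have hf := (B.contDiffAt_f.hasStrictFDerivAt_fderiv.tendsto_smul_sub hp hq hd).continuousLinearMap_apply hd
  have hφ := (B.contDiffAt_φ.hasStrictFDerivAt_fderiv.tendsto_smul_sub hp hq hd).continuousLinearMap_apply hd
  have hS := (B.contDiffAt_S.hasStrictFDerivAt_fderiv.tendsto_smul_sub hp hq hd).continuousLinearMap_apply hd
  set K : ℝ × X × X → Matrix κ κ ℝ := fun x => fderiv ℝ B.S (q x) (e x) with hK
  have hKlim : Tendsto K l (𝓝 (fderiv ℝ B.S 0 d)) :=
    (B.contDiffAt_S.hasStrictFDerivAt_fderiv.continuousAt.tendsto.comp hq).continuousLinearMap_apply hd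
  -- The error of replacing the quotient of `S` by its derivative, divided by μ. The quadratic
  -- remainder bounds it by C‖p - q‖/μ = C‖a - b‖, which tends to zero.
  set R : ℝ × X × X → Matrix κ κ ℝ := fun x =>
    (μ x)⁻¹ • ((τ x)⁻¹ • (B.S (p x) - B.S (q x)) - K x) with hR
  have hRlim : Tendsto R l (𝓝 0) := by
    obtain ⟨C, δ, hδ, hC⟩ := B.contDiffAt_S.exists_norm_sub_sub_fderiv_le
    have hlim : Tendsto (fun x => C * ‖a x - b x‖) l (𝓝 0) := by
      simpa using ((ha.sub hb).norm.const_mul C)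
    refine squeeze_zero_norm' ?_ hlim
    filter_upwards [hμ, hτpos, hp.eventually (Metric.ball_mem_nhds 0 hδ),
      hq.eventually (Metric.ball_mem_nhds 0 hδ)] with x hx hτx hpx hqx
    have h1 := hC _ hpx _ hqx
    have h2 : R x = ((μ x)⁻¹ * (τ x)⁻¹) •
        (B.S (p x) - B.S (q x) - fderiv ℝ B.S (q x) (p x - q x)) := by
      simp only [hR, hK, he, map_smul, ← smul_sub, smul_smul]
    have h3 : τ x = μ x * ‖a x - b x‖ := by
      rw [hτ]
      simp only [hpq, norm_smul, Real.norm_of_nonneg hx.le]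
    rw [h2, norm_smul, Real.norm_of_nonneg (by positivity)]
    calc (μ x)⁻¹ * (τ x)⁻¹ * ‖B.S (p x) - B.S (q x) - fderiv ℝ B.S (q x) (p x - q x)‖
        ≤ (μ x)⁻¹ * (τ x)⁻¹ * (C * τ x * τ x) := mul_le_mul_of_nonneg_left h1 (by positivity)
      _ = (μ x)⁻¹ * C * τ x := by field_simp
      _ = C * ‖a x - b x‖ := by rw [h3]; field_simp
  -- The difference quotient of the gradient is `T` plus the singular term μ⁻¹ tr (P K Q K). `T`
  -- gathers the terms that stay bounded, and its limit is the Hessian.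
  set T : ℝ × X × X → ℝ := fun x =>
    ((τ x)⁻¹ • (fderiv ℝ B.f (p x) - fderiv ℝ B.f (q x))) (e x) +
      μ x * ((τ x)⁻¹ • (fderiv ℝ B.φ (p x) - fderiv ℝ B.φ (q x))) (e x) -
      (P x * ((τ x)⁻¹ • (fderiv ℝ B.S (p x) - fderiv ℝ B.S (q x))) (e x)).trace +
      (P x * R x * (Q x * K x)).trace with hT
  have hTlim : Tendsto T l (𝓝 (B.hess Y d d)) := by
    have h := ((hf.add (hμ0.mul hφ)).sub (tendsto_trace_mul hPlim hS)).add
      (tendsto_trace_mul (hPlim.mul hRlim) (hQlim.mul hKlim))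
    rw [zero_mul, add_zero, Matrix.mul_zero, Matrix.zero_mul, Matrix.trace_zero, add_zero] at h
    exact h
  have hTle : ∀ᶠ x in l, T x + (μ x)⁻¹ * (P x * K x * (Q x * K x)).trace ≤ 0 := by
    filter_upwards [hgrad, hμ, hτpos, hpp, hqp] with x hx hμx hτx hppx hqpx
    have hup := isUnit_iff_ne_zero.mpr hppx.det_pos.ne'
    have huq := isUnit_iff_ne_zero.mpr hqpx.det_pos.ne'
    -- The resolvent identity: the change of the inverse produces the singular term.
    have h1 : (B.S (p x))⁻¹ - (B.S (q x))⁻¹ =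
        -((B.S (p x))⁻¹ * (B.S (p x) - B.S (q x)) * (B.S (q x))⁻¹) := by
      rw [Matrix.mul_sub, Matrix.sub_mul, Matrix.nonsing_inv_mul _ hup, Matrix.one_mul,
        Matrix.mul_assoc, Matrix.mul_nonsing_inv _ huq, Matrix.mul_one, neg_sub]
    have h2 : (P x * R x * (Q x * K x)).trace + (μ x)⁻¹ * (P x * K x * (Q x * K x)).trace =
        -((τ x)⁻¹ * μ x * (((B.S (p x))⁻¹ - (B.S (q x))⁻¹) * K x).trace) := by
      have h3 : R x + (μ x)⁻¹ • K x = ((μ x)⁻¹ * (τ x)⁻¹) • (B.S (p x) - B.S (q x)) := by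
        simp only [hR, smul_sub, smul_smul, sub_add_cancel]
      calc _ = (P x * (R x + (μ x)⁻¹ • K x) * (Q x * K x)).trace := by
            simp only [Matrix.mul_add, Matrix.add_mul, Matrix.trace_add, Matrix.mul_smul,
              Matrix.smul_mul, Matrix.trace_smul, smul_eq_mul]
        _ = _ := by
          rw [h3, h1, hP, hQ]
          simp only [Matrix.mul_smul, Matrix.smul_mul, Matrix.trace_smul, smul_eq_mul,
            Matrix.neg_mul, Matrix.trace_neg, Matrix.mul_assoc]
          field_simp
    have h4 : T x + (μ x)⁻¹ * (P x * K x * (Q x * K x)).trace =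
        (τ x)⁻¹ * (B.grad (μ x) (p x) (e x) - B.grad (μ x) (q x) (e x)) := by
      have h5 : (P x * ((τ x)⁻¹ • (fderiv ℝ B.S (p x) - fderiv ℝ B.S (q x))) (e x)).trace =
          (τ x)⁻¹ * μ x * (((B.S (p x))⁻¹ * fderiv ℝ B.S (p x) (e x)).trace -
            ((B.S (p x))⁻¹ * K x).trace) := by
        change (P x * ((τ x)⁻¹ • (fderiv ℝ B.S (p x) (e x) - K x))).trace = _
        rw [hP]
        simp only [Matrix.mul_smul, Matrix.smul_mul, Matrix.trace_smul, smul_eq_mul,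
          Matrix.mul_sub, Matrix.trace_sub]
        ring
      rw [hT]
      simp only [add_assoc]
      rw [h2, h5, grad, grad, Matrix.sub_mul, Matrix.trace_sub]
      simp only [_root_.smul_apply, _root_.sub_apply, smul_eq_mul]
      ring
    rw [h4]
    exact mul_nonpos_of_nonneg_of_nonpos (by positivity) (by linarith)
  have hnn : ∀ᶠ x in l, 0 ≤ (P x * K x * (Q x * K x)).trace := by
    filter_upwards [hpp, hqp, hμ] with x hpx hqx hμx
    have h1 : (P x).PosSemidef := hpx.inv.posSemidef.smul hμx.le
    have h2 : (Q x).PosSemidef := hqx.inv.posSemidef.smul hμx.le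
    have h3 := h1.trace_mul_nonneg (h2.transpose_mul_mul (K x))
    rw [show (K x)ᵀ = K x from transpose_fderiv_S _ _] at h3
    simpa only [Matrix.mul_assoc] using h3
  -- Multiplied by μ, the inequality becomes tr (Y D Y D) ≤ 0 in the limit, and `Y` is positive
  -- definite.
  have hAd : fderiv ℝ B.S 0 d = 0 := by
    set D := fderiv ℝ B.S 0 d
    have hDt : Dᵀ = D := transpose_fderiv_S _ _
    have h1 : Tendsto (fun x => μ x * T x + (P x * K x * (Q x * K x)).trace) l
        (𝓝 (Y * D * (Y * D)).trace) := by
      simpa using (hμ0.mul hTlim).add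
        (tendsto_trace_mul (hPlim.mul hKlim) (hQlim.mul hKlim))
    have h2 : (Y * D * (Y * D)).trace ≤ 0 := by
      refine le_of_tendsto h1 ?_
      filter_upwards [hTle, hμ] with x hx hμx
      have := mul_nonpos_of_nonneg_of_nonpos hμx.le hx
      rwa [mul_add, mul_inv_cancel_left₀ hμx.ne'] at this
    have h3 : (Dᵀ * Y * D).PosSemidef := hY.1.transpose_mul_mul D
    have h4 : Dᵀ * Y * D = 0 := by
      refine h3.eq_zero_of_trace_mul_nonpos hYp ?_
      rw [Matrix.trace_mul_comm, hDt]
      simpa only [Matrix.mul_assoc] using h2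
    have h5 : (D * Dᵀ).PosSemidef := by
      simpa [conjTranspose_eq_transpose_of_trivial] using Matrix.posSemidef_self_mul_conjTranspose D
    have h6 : D * Dᵀ = 0 := by
      refine h5.eq_zero_of_trace_mul_nonpos hYp (le_of_eq ?_)
      rw [Matrix.mul_assoc, Matrix.trace_mul_comm, h4, Matrix.trace_zero]
    exact Matrix.self_mul_conjTranspose_eq_zero.mp
      (by rwa [conjTranspose_eq_transpose_of_trivial])
  -- The singular term is nonnegative, so it can be dropped.
  have h7 : B.hess Y d d ≤ 0 := by
    refine le_of_tendsto hTlim ?_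
    filter_upwards [hTle, hnn, hμ] with x hx hnx hμx
    have : 0 ≤ (μ x)⁻¹ * (P x * K x * (Q x * K x)).trace := by positivity
    linarith
  exact absurd (hB.ssosc Y hY d (norm_pos_iff.mp (by rw [hdn]; exact one_pos)) hAd) h7.not_gt

end VertexBarrier

end

/-! ### Vertex barriers: existence of critical points and the central path. -/

section

open scoped Matrix.Norms.Operator

theorem Asymptotics.IsLittleO.tendsto_inv_sq_smul {X W : Type*} [NormedAddCommGroup X]
    [NormedAddCommGroup W] [NormedSpace ℝ W] {l : Filter X} {r : X → W}
    (hr : r =o[l] fun v => ‖v‖ ^ 2) : Tendsto (fun v => (‖v‖ ^ 2)⁻¹ • r v) l (𝓝 0) := by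
  have h := (Asymptotics.isBigO_refl (fun v : X => (‖v‖ ^ 2)⁻¹) l).smul_isLittleO hr
  refine (Asymptotics.isLittleO_one_iff ℝ).mp (h.trans_isBigO ?_)
  refine Asymptotics.IsBigO.of_bound 1 (Eventually.of_forall fun v => ?_)
  rw [smul_eq_mul, norm_one, mul_one, norm_mul, norm_inv]
  exact inv_mul_le_one

namespace VertexBarrier

variable {X κ : Type*} [NormedAddCommGroup X] [NormedSpace ℝ X] [FiniteDimensional ℝ X]
  [Fintype κ] [DecidableEq κ] {B : VertexBarrier X κ}

variable (B) in
/-- The barrier function. -/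
noncomputable def barrier (μ : ℝ) (v : X) : ℝ :=
  B.f v + μ * B.φ v - μ * Real.log (B.S v).det

variable (B) in
/-- The data of the barrier function are twice continuously differentiable at `v`. -/
def SmoothAt (v : X) : Prop :=
  ContDiffAt ℝ 2 B.f v ∧ ContDiffAt ℝ 2 B.φ v ∧ ContDiffAt ℝ 2 B.S v

theorem eventually_smoothAt : ∀ᶠ v in 𝓝 0, B.SmoothAt v :=
  (B.contDiffAt_f.eventually (by simp)).and
    ((B.contDiffAt_φ.eventually (by simp)).and (B.contDiffAt_S.eventually (by simp)))

theorem SmoothAt.hasFDerivAt_barrier {v : X} (hv : B.SmoothAt v) (hS : (B.S v).PosDef) (μ : ℝ) :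
    ∃ L : X →L[ℝ] ℝ, HasFDerivAt (B.barrier μ) L v ∧ ∀ b, L b = B.grad μ v b := by
  have h1 := (hv.1.differentiableAt (by simp)).hasFDerivAt
  have h2 := (hv.2.1.differentiableAt (by simp)).hasFDerivAt
  have h3 := (hv.2.2.differentiableAt (by simp)).hasFDerivAt.log_det hS.det_pos.ne'
  exact ⟨_, (h1.add (h2.const_mul μ)).sub (h3.const_mul μ), fun b => rfl⟩

/-- The point `0` is a strict local minimizer of `f` over the region where `S` is positive
semidefinite. -/
theorem Regular.eventually_lt (hB : B.Regular) :
    ∀ᶠ v in 𝓝 0, (B.S v).PosSemidef → v ≠ 0 → B.f 0 < B.f v := by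
  refine Filter.mem_iff_ultrafilter.mpr fun l hl => ?_
  by_contra hcon
  rw [← Ultrafilter.compl_mem_iff_notMem] at hcon
  have hbad : ∀ᶠ v in (l : Filter X), (B.S v).PosSemidef ∧ v ≠ 0 ∧ B.f v ≤ B.f 0 := by
    filter_upwards [hcon] with v hv
    simpa using hv
  obtain ⟨Y, hY, hYp⟩ := hB.strict
  have hv : Tendsto (fun v : X => v) l (𝓝 0) := hl
  have hn : ∀ᶠ v in (l : Filter X), ‖‖v‖⁻¹ • v‖ = 1 := by
    filter_upwards [hbad] with v hv
    rw [norm_smul, norm_inv, norm_norm, inv_mul_cancel₀ (norm_ne_zero_iff.mpr hv.2.1)]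
  obtain ⟨d, hd⟩ := l.exists_tendsto_of_norm_le (hn.mono fun a ha => ha.le)
  have hdn : ‖d‖ = 1 := tendsto_nhds_unique hd.norm (tendsto_const_nhds.congr' (by
    filter_upwards [hn] with a ha using ha.symm))
  have hS1 := hasStrictFDerivAt_S.tendsto_smul_sub_self (F := B.S) hv (by simpa using hd)
  have hf1 := hasStrictFDerivAt_f.tendsto_smul_sub_self (F := B.f) hv (by simpa using hd)
  have hpsd : (fderiv ℝ B.S 0 d).PosSemidef := by
    refine Matrix.isClosed_posSemidef.mem_of_tendsto hS1 ?_
    filter_upwards [hbad] with v hv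
    rw [B.S_zero, sub_zero]
    exact hv.1.smul (by positivity)
  have hf0 : fderiv ℝ B.f 0 d ≤ 0 := by
    refine le_of_tendsto hf1 ?_
    filter_upwards [hbad] with v hv
    exact mul_nonpos_of_nonneg_of_nonpos (by positivity) (by linarith [hv.2.2])
  have hA : fderiv ℝ B.S 0 d = 0 := by
    refine hpsd.eq_zero_of_trace_mul_nonpos hYp ?_
    rw [Matrix.trace_mul_comm, ← hY.2]
    exact hf0
  have hfq := (B.contDiffAt_f.taylor_two.mono hl).tendsto_inv_sq_smul
  have hSq : Tendsto (fun v => (‖v‖ ^ 2)⁻¹ • (B.S v - B.S 0 - fderiv ℝ B.S 0 v -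
      (2⁻¹ : ℝ) • fderiv ℝ (fderiv ℝ B.S) 0 v v)) l (𝓝 0) :=
    (B.contDiffAt_S.taylor_two.mono hl).tendsto_inv_sq_smul
  have hf2 : Tendsto (fun v => fderiv ℝ (fderiv ℝ B.f) 0 (‖v‖⁻¹ • v) (‖v‖⁻¹ • v)) l
      (𝓝 (fderiv ℝ (fderiv ℝ B.f) 0 d d)) :=
    (((fderiv ℝ (fderiv ℝ B.f) 0).continuous.tendsto d).comp hd).continuousLinearMap_apply hd
  have hS2 : Tendsto (fun v => fderiv ℝ (fderiv ℝ B.S) 0 (‖v‖⁻¹ • v) (‖v‖⁻¹ • v)) l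
      (𝓝 (fderiv ℝ (fderiv ℝ B.S) 0 d d)) :=
    (((fderiv ℝ (fderiv ℝ B.S) 0).continuous.tendsto d).comp hd).continuousLinearMap_apply hd
  -- Subtracting tr (Y S) from f cancels the first-order terms, so division by ‖v‖² leaves half the
  -- Hessian. Its sign comes from f v ≤ f 0 and tr (Y S) ≥ 0.
  have hlim := (hfq.sub (tendsto_trace_mul (tendsto_const_nhds (x := Y)) hSq)).add
    ((hf2.sub (tendsto_trace_mul (tendsto_const_nhds (x := Y)) hS2)).const_mul (2⁻¹ : ℝ))
  rw [Matrix.mul_zero, Matrix.trace_zero, sub_zero, zero_add] at hlim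
  have hle : 2⁻¹ * B.hess Y d d ≤ 0 := by
    refine le_of_tendsto hlim ?_
    filter_upwards [hbad] with v hv
    have h1 : (Y * B.S v).trace ≥ 0 := hY.1.trace_mul_nonneg hv.1
    have h2 := hY.2 v
    have h3 : B.S 0 = 0 := B.S_zero
    have e1 : fderiv ℝ (fderiv ℝ B.S) 0 (‖v‖⁻¹ • v) (‖v‖⁻¹ • v) =
        (‖v‖⁻¹ * ‖v‖⁻¹) • fderiv ℝ (fderiv ℝ B.S) 0 v v := by
      rw [map_smul, map_smul, mul_smul]
      rfl
    rw [e1, h3, sub_zero, Matrix.mul_smul, Matrix.trace_smul, Matrix.mul_sub, Matrix.mul_sub,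
      Matrix.trace_sub, Matrix.trace_sub, ← h2, Matrix.mul_smul, Matrix.trace_smul,
      Matrix.mul_smul, Matrix.trace_smul]
    simp only [map_smul, _root_.smul_apply, smul_eq_mul]
    have h4 : (‖v‖ ^ 2)⁻¹ * (B.f v - B.f 0 - (Y * B.S v).trace) ≤ 0 :=
      mul_nonpos_of_nonneg_of_nonpos (by positivity) (by linarith [hv.2.2])
    refine le_of_eq_of_le ?_ h4
    rw [pow_two, mul_inv]
    ring
  have := hB.ssosc Y hY d (norm_pos_iff.mp (by rw [hdn]; exact one_pos)) hA
  linarith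

/-- Critical points of the barrier functions exist near `0`. -/
theorem Regular.exists_isCritical (hB : B.Regular) {η : ℝ} (hη : 0 < η) :
    ∃ δ > 0, ∀ μ, 0 < μ → μ < δ → ∃ v, ‖v‖ < η ∧ B.IsCritical μ v := by
  have : ProperSpace X := FiniteDimensional.proper ℝ X
  obtain ⟨r, hr, hball⟩ := Metric.mem_nhds_iff.mp
    (inter_mem (B.eventually_smoothAt) hB.eventually_lt)
  set ρ : ℝ := min (r / 2) (η / 2) with hρ
  have hρ0 : 0 < ρ := by positivity
  have hρr : ρ < r := (min_le_left _ _).trans_lt (by linarith)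
  have hρη : ρ < η := (min_le_right _ _).trans_lt (by linarith)
  have hsub : Metric.closedBall (0 : X) ρ ⊆ Metric.ball 0 r := Metric.closedBall_subset_ball hρr
  have hsm : ∀ v ∈ Metric.closedBall (0 : X) ρ, B.SmoothAt v := fun v hv => (hball (hsub hv)).1
  have hcf : ContinuousOn B.f (Metric.closedBall 0 ρ) := fun v hv =>
    (hsm v hv).1.continuousAt.continuousWithinAt
  have hcφ : ContinuousOn B.φ (Metric.closedBall 0 ρ) := fun v hv =>
    (hsm v hv).2.1.continuousAt.continuousWithinAt
  have hcS : ContinuousOn B.S (Metric.closedBall 0 ρ) := fun v hv =>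
    (hsm v hv).2.2.continuousAt.continuousWithinAt
  have hcdet : ContinuousOn (fun v => (B.S v).det) (Metric.closedBall 0 ρ) :=
    (Matrix.contDiff_det (n := 0)).continuous.comp_continuousOn hcS
  set K : Set X := Metric.closedBall 0 ρ ∩ B.S ⁻¹' {M | M.PosSemidef} with hK
  have hKc : IsCompact K := by
    refine (isCompact_closedBall (0 : X) ρ).of_isClosed_subset ?_ inter_subset_left
    exact hcS.preimage_isClosed_of_isClosed Metric.isClosed_closedBall Matrix.isClosed_posSemidef
  have h0K : (0 : X) ∈ K := ⟨Metric.mem_closedBall_self hρ0.le, by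
    simpa [B.S_zero] using Matrix.PosSemidef.zero⟩
  -- the values of `f` on the boundary of the ball are bounded away from `f 0`
  obtain ⟨m, hm0, hm⟩ : ∃ m, B.f 0 < m ∧ ∀ v ∈ K ∩ Metric.sphere 0 ρ, m ≤ B.f v := by
    rcases (K ∩ Metric.sphere (0 : X) ρ).eq_empty_or_nonempty with he | hne
    · exact ⟨B.f 0 + 1, by linarith, fun v hv => by simp [he] at hv⟩
    · obtain ⟨u, hu, hmin⟩ := (hKc.inter_right Metric.isClosed_sphere).exists_isMinOn hne
        (hcf.mono (inter_subset_left.trans inter_subset_left))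
      refine ⟨B.f u, ?_, fun v hv => hmin hv⟩
      refine (hball (hsub hu.1.1)).2 hu.1.2 fun h => ?_
      have := hu.2
      rw [h, mem_sphere_zero_iff_norm, norm_zero] at this
      exact hρ0.ne this
  -- A short move along the Mangasarian-Fromovitz direction is strictly feasible and barely changes
  -- `f`.
  obtain ⟨p, hpK, hpS, hpf⟩ : ∃ p ∈ K, (B.S p).PosDef ∧ B.f p < m := by
    obtain ⟨d, hd⟩ := hB.mfcq
    have ht : Tendsto (fun t : ℝ => t) (𝓝[>] 0) (𝓝 0) := nhdsWithin_le_nhds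
    have h1 := eventually_posDef (B := B) ht self_mem_nhdsWithin
      (tendsto_const_nhds (x := d)) hd
    have h2 : Tendsto (fun t : ℝ => t • d) (𝓝[>] 0) (𝓝 0) := by
      simpa using ht.smul_const d
    have h3 := h2.eventually (B.contDiffAt_f.continuousAt.eventually (gt_mem_nhds hm0))
    have h4 := h2.eventually (Metric.closedBall_mem_nhds (0 : X) hρ0)
    obtain ⟨t, h1, h3, h4⟩ := (h1.and (h3.and h4)).exists
    exact ⟨t • d, ⟨h4, h1.posSemidef⟩, h1, h3⟩
  obtain ⟨u₀, -, hmax⟩ := hKc.exists_isMaxOn ⟨0, h0K⟩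
    (f := fun v => (B.S v).det * Real.exp (-B.φ v))
    ((hcdet.mul (Real.continuous_exp.comp_continuousOn hcφ.neg)).mono inter_subset_left)
  set D : ℝ := (B.S u₀).det * Real.exp (-B.φ u₀)
  set c : ℝ := (B.S p).det * Real.exp (-B.φ p)
  have hc0 : 0 < c := mul_pos hpS.det_pos (Real.exp_pos _)
  have hcD : c ≤ D := hmax hpK
  have hD0 : 0 < D := hc0.trans_le hcD
  -- For μ below this bound, exp t ≥ 1 + t shows that c · exp (-f p/μ) exceeds D · exp (-m/μ), so
  -- the maximizer below cannot lie on the sphere.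
  refine ⟨c * (m - B.f p) / D, by have := sub_pos.mpr hpf; positivity, fun μ hμ hμδ => ?_⟩
  -- The function maximized is exp (-barrier/μ). Unlike the logarithm it is continuous up to the
  -- points with det S = 0, and positivity of its maximum keeps the maximizer away from them.
  obtain ⟨v, hvK, hvmax⟩ := hKc.exists_isMaxOn ⟨0, h0K⟩
    (f := fun v => (B.S v).det * Real.exp (-B.φ v) * Real.exp (-(μ⁻¹ * B.f v)))
    (((hcdet.mul (Real.continuous_exp.comp_continuousOn hcφ.neg)).mul
      (Real.continuous_exp.comp_continuousOn (hcf.const_mul μ⁻¹).neg)).mono inter_subset_left)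
  have hvp : c * Real.exp (-(μ⁻¹ * B.f p)) ≤
      (B.S v).det * Real.exp (-B.φ v) * Real.exp (-(μ⁻¹ * B.f v)) := hvmax hpK
  have hvS : (B.S v).PosDef := by
    rw [hvK.2.posDef_iff_det_ne_zero]
    intro h0
    rw [h0, zero_mul, zero_mul] at hvp
    exact absurd hvp (not_le.mpr (by positivity))
  have hvρ : ‖v‖ < ρ := by
    refine lt_of_le_of_ne (mem_closedBall_zero_iff.mp hvK.1) fun heq => ?_
    have h1 := hm v ⟨hvK, mem_sphere_zero_iff_norm.mpr heq⟩
    have h2 : c * Real.exp (-(μ⁻¹ * B.f p)) ≤ D * Real.exp (-(μ⁻¹ * m)) := by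
      refine hvp.trans (mul_le_mul (hmax hvK) ?_ (Real.exp_pos _).le hD0.le)
      exact Real.exp_le_exp.mpr (neg_le_neg (mul_le_mul_of_nonneg_left h1 (by positivity)))
    have h3 : c * Real.exp (μ⁻¹ * (m - B.f p)) ≤ D := by
      have h4 := mul_le_mul_of_nonneg_right h2 (Real.exp_pos (μ⁻¹ * m)).le
      rwa [mul_assoc c, mul_assoc D, ← Real.exp_add, ← Real.exp_add, neg_add_cancel, Real.exp_zero,
        mul_one, neg_add_eq_sub, ← mul_sub] at h4
    have h4 := Real.add_one_le_exp (μ⁻¹ * (m - B.f p))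
    have h5 : c * (μ⁻¹ * (m - B.f p)) < D := by nlinarith
    rw [lt_div_iff₀ hD0] at hμδ
    have h6 : c * (m - B.f p) < μ * D := by
      have := mul_lt_mul_of_pos_left h5 hμ
      calc c * (m - B.f p) = μ * (c * (μ⁻¹ * (m - B.f p))) := by field_simp
        _ < _ := this
    linarith
  refine ⟨v, hvρ.trans hρη, hvS, fun b => ?_⟩
  obtain ⟨L, hL, hLb⟩ := (hsm v hvK.1).hasFDerivAt_barrier hvS μ
  have hlm : IsLocalMin (B.barrier μ) v := by
    have h1 : ∀ᶠ u in 𝓝 v, (B.S u).PosDef :=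
      hvS.eventually (hsm v hvK.1).2.2.continuousAt (.of_forall fun u => B.symm u)
    have h2 : ∀ᶠ u in 𝓝 v, u ∈ Metric.ball (0 : X) ρ :=
      Metric.isOpen_ball.mem_nhds (mem_ball_zero_iff.mpr hvρ)
    filter_upwards [h1, h2] with u hu1 hu2
    have h3 : (B.S u).det * Real.exp (-B.φ u) * Real.exp (-(μ⁻¹ * B.f u)) ≤
        (B.S v).det * Real.exp (-B.φ v) * Real.exp (-(μ⁻¹ * B.f v)) :=
      hvmax ⟨Metric.ball_subset_closedBall hu2, hu1.posSemidef⟩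
    have hud := hu1.det_pos
    have hvd := hvS.det_pos
    have h4 := Real.log_le_log (by positivity) h3
    rw [Real.log_mul (by positivity) (by positivity), Real.log_mul hud.ne' (by positivity),
      Real.log_mul (by positivity) (by positivity), Real.log_mul hvd.ne' (by positivity)] at h4
    simp only [Real.log_exp] at h4
    have h5 := mul_le_mul_of_nonneg_left h4 hμ.le
    have h6 : ∀ z : X, μ * (Real.log (B.S z).det + -B.φ z + -(μ⁻¹ * B.f z)) = -B.barrier μ z := by
      intro z
      rw [barrier]
      field_simp
      ring
    rw [h6, h6] at h5
    linarith
  rw [← hLb, hlm.hasFDerivAt_eq_zero hL]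
  rfl

/-- Existence, uniqueness, asymptotics and strict local optimality of the central path. -/
theorem Regular.exists_centralPath (hB : B.Regular) : ∃ w, B.IsDirection w ∧
    ∀ ε > 0, ∃ η₀ > 0, ∀ η, 0 < η → η ≤ η₀ → ∃ δ > 0, ∀ μ, 0 < μ → μ < δ →
      ∃ v, B.IsCritical μ v ∧ ‖v - μ • w‖ < ε * μ ∧ ‖v‖ < η ∧
      (∀ u, ‖u‖ < η → B.IsCritical μ u → u = v) ∧
      ∀ᶠ u in 𝓝 v, u ≠ v → B.barrier μ v < B.barrier μ u := by
  -- Pairs of a parameter and a critical point tending to (0, 0). All ultrafilters below `L` give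
  -- v/μ the same limit, so v/μ converges along `L` itself.
  set L : Filter (ℝ × X) := (𝓝[>] 0 ×ˢ 𝓝 0) ⊓ 𝓟 {x | B.IsCritical x.1 x.2} with hL
  have hLb : (𝓝[>] (0 : ℝ) ×ˢ 𝓝 (0 : X)).HasBasis (fun δ : ℝ => 0 < δ)
      fun δ => Ioo 0 δ ×ˢ Metric.ball 0 δ := by
    refine (nhdsGT_basis (0 : ℝ)).prod_same_index Metric.nhds_basis_ball ?_
    intro i j hi hj
    exact ⟨min i j, lt_min hi hj, Ioo_subset_Ioo_right (min_le_left _ _),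
      Metric.ball_subset_ball (min_le_right _ _)⟩
  have hne : NeBot L := by
    rw [hL, (hLb.inf_principal _).neBot_iff]
    intro δ hδ
    obtain ⟨δ', hδ', h⟩ := hB.exists_isCritical hδ
    obtain ⟨v, hv, hc⟩ := h (min δ δ' / 2) (by positivity)
      (by have := min_le_right δ δ'; have : 0 < min δ δ' := by positivity
          linarith)
    refine ⟨(min δ δ' / 2, v), ⟨⟨by positivity, ?_⟩, by simpa using hv⟩, hc⟩
    have := min_le_left δ δ'
    have : 0 < min δ δ' := by positivity
    show min δ δ' / 2 < δ
    linarith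
  have hdir : ∀ l : Ultrafilter (ℝ × X), ↑l ≤ L →
      ∃ w, B.IsDirection w ∧ Tendsto (fun x : ℝ × X => x.1⁻¹ • x.2) l (𝓝 w) := by
    intro l hl
    have h1 : Tendsto (fun x : ℝ × X => x.1) l (𝓝[>] 0) :=
      tendsto_fst.mono_left (hl.trans inf_le_left)
    refine hB.exists_isDirection l (h1.mono_right nhdsWithin_le_nhds)
      (h1.eventually self_mem_nhdsWithin) (tendsto_snd.mono_left (hl.trans inf_le_left)) ?_
    exact hl.trans inf_le_right (mem_principal_self _)
  obtain ⟨w, hw, -⟩ := hdir (Ultrafilter.of L) (Ultrafilter.of_le L)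
  refine ⟨w, hw, fun ε hε => ?_⟩
  have hlim : Tendsto (fun x : ℝ × X => x.1⁻¹ • x.2) L (𝓝 w) := by
    rw [tendsto_iff_ultrafilter]
    intro l hl
    obtain ⟨w', hw', hlim⟩ := hdir l hl
    rwa [hB.isDirection_unique hw hw']
  -- a ball on which the gradient is strictly monotone
  have hmono : ∃ ε' > 0, ∃ δ > 0, ∀ μ, 0 < μ → μ < δ → ∀ a ∈ Metric.ball w ε',
      (B.S (μ • a)).PosDef ∧ B.SmoothAt (μ • a) ∧ ∀ b ∈ Metric.ball w ε', a ≠ b →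
        B.grad μ (μ • b) (a - b) < B.grad μ (μ • a) (a - b) := by
    obtain ⟨Y, hY, hYw, -⟩ := id hw
    have hwp : (fderiv ℝ B.S 0 w).PosDef := by
      rw [← Matrix.inv_eq_right_inv hYw]
      exact (IsDirection.posDef hY hYw).inv
    have ht : Tendsto (fun x : ℝ × X => x.1) (𝓝[>] 0 ×ˢ 𝓝 w) (𝓝[>] 0) := tendsto_fst
    have ht0 := ht.mono_right nhdsWithin_le_nhds
    have h1 : ∀ᶠ x in 𝓝[>] (0 : ℝ) ×ˢ 𝓝 w, (B.S (x.1 • x.2)).PosDef :=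
      eventually_posDef ht0 (ht.eventually self_mem_nhdsWithin) tendsto_snd hwp
    have h2 : ∀ᶠ x in 𝓝[>] (0 : ℝ) ×ˢ 𝓝 w, B.SmoothAt (x.1 • x.2) := by
      have : Tendsto (fun x : ℝ × X => x.1 • x.2) (𝓝[>] 0 ×ˢ 𝓝 w) (𝓝 0) := by
        simpa using ht0.smul (tendsto_snd (f := 𝓝[>] (0 : ℝ)) (g := 𝓝 w))
      exact this.eventually eventually_smoothAt
    obtain ⟨⟨δ₁, ε₁⟩, ⟨hδ₁, hε₁⟩, h12⟩ :=
      (((nhdsGT_basis (0 : ℝ)).prod Metric.nhds_basis_ball).mem_iff).mp (h1.and h2)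
    obtain ⟨⟨δ₂, ε₂⟩, ⟨hδ₂, hε₂⟩, h3⟩ :=
      (((nhdsGT_basis (0 : ℝ)).prod Metric.nhds_basis_ball.prod_self).mem_iff).mp
        (hB.eventually_grad_lt hw)
    refine ⟨min ε₁ ε₂, lt_min hε₁ hε₂, min δ₁ δ₂, lt_min hδ₁ hδ₂, fun μ hμ hμδ a ha => ?_⟩
    have h4 := h12 (show (μ, a) ∈ _ from ⟨⟨hμ, hμδ.trans_le (min_le_left _ _)⟩,
      Metric.ball_subset_ball (min_le_left _ _) ha⟩)
    refine ⟨h4.1, h4.2, fun b hb => ?_⟩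
    exact h3 (show (μ, a, b) ∈ _ from ⟨⟨hμ, hμδ.trans_le (min_le_right _ _)⟩,
      Metric.ball_subset_ball (min_le_right _ _) ha, Metric.ball_subset_ball (min_le_right _ _) hb⟩)
  obtain ⟨ε', hε', δ₁, hδ₁, hmono⟩ := hmono
  obtain ⟨δ₂, hδ₂, hnear⟩ := ((hLb.inf_principal _).mem_iff).mp
    (hlim (Metric.ball_mem_nhds w (lt_min hε hε')))
  -- For `η` up to this radius and small μ, every critical point `u` of norm below `η` has u/μ in
  -- the ball around `w` where the gradient is monotone.
  refine ⟨min δ₁ δ₂, lt_min hδ₁ hδ₂, fun η hη hηδ => ?_⟩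
  obtain ⟨δ₃, hδ₃, hex⟩ := hB.exists_isCritical hη
  refine ⟨min (min δ₁ δ₂) δ₃, by positivity, fun μ hμ hμδ => ?_⟩
  have hμ1 : μ < δ₁ := hμδ.trans_le ((min_le_left _ _).trans (min_le_left _ _))
  have hμ2 : μ < δ₂ := hμδ.trans_le ((min_le_left _ _).trans (min_le_right _ _))
  obtain ⟨v, hvη, hvc⟩ := hex μ hμ (hμδ.trans_le (min_le_right _ _))
  have hcrit : ∀ u, ‖u‖ < η → B.IsCritical μ u → μ⁻¹ • u ∈ Metric.ball w (min ε ε') :=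
    fun u hu hc => hnear (show (μ, u) ∈ _ from ⟨⟨⟨hμ, hμ2⟩, by
      simpa using hu.trans_le (hηδ.trans (min_le_right _ _))⟩, hc⟩)
  have hback : ∀ u : X, μ • μ⁻¹ • u = u := fun u => by
    rw [smul_smul, mul_inv_cancel₀ hμ.ne', one_smul]
  have hva := hcrit v hvη hvc
  have hva' := Metric.ball_subset_ball (min_le_right ε ε') hva
  refine ⟨v, hvc, ?_, hvη, fun u hu hc => ?_, ?_⟩
  · have h1 := Metric.ball_subset_ball (min_le_left ε ε') hva
    rw [mem_ball_iff_norm] at h1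
    calc ‖v - μ • w‖ = ‖μ • (μ⁻¹ • v - w)‖ := by rw [smul_sub, hback]
      _ = μ * ‖μ⁻¹ • v - w‖ := by rw [norm_smul, Real.norm_of_nonneg hμ.le]
      _ < ε * μ := by rw [mul_comm]; exact mul_lt_mul_of_pos_right h1 hμ
  -- At two critical points the gradients agree, being zero, against strict monotonicity.
  · by_contra hne
    have h1 := Metric.ball_subset_ball (min_le_right ε ε') (hcrit u hu hc)
    have h2 := (hmono μ hμ hμ1 _ h1).2.2 _ hva' fun h => hne (by
      rw [← hback u, h, hback])
    rw [hback, hback, hc.2, hvc.2] at h2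
    exact lt_irrefl _ h2
  · have hopen : ∀ᶠ u in 𝓝 v, μ⁻¹ • u ∈ Metric.ball w ε' :=
      (continuous_const_smul μ⁻¹).continuousAt.eventually (Metric.isOpen_ball.mem_nhds hva')
    filter_upwards [hopen] with u hu huv
    set a := μ⁻¹ • v
    set b := μ⁻¹ • u
    -- The gradient vanishes at `v`, so by monotonicity the barrier function has positive derivative
    -- along the segment leaving `v`.
    set c : ℝ → X := fun t => a + t • (b - a)
    have hcb : ∀ t ∈ Icc (0 : ℝ) 1, c t ∈ Metric.ball w ε' := fun t ht =>
      (convex_ball w ε').add_smul_sub_mem hva' hu ht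
    have hder : ∀ t ∈ Icc (0 : ℝ) 1, HasDerivAt (fun t => B.barrier μ (μ • c t))
        (μ * B.grad μ (μ • c t) (b - a)) t := by
      intro t ht
      obtain ⟨hS, hs, -⟩ := hmono μ hμ hμ1 _ (hcb t ht)
      obtain ⟨L, hL, hLb⟩ := hs.hasFDerivAt_barrier hS μ
      have h1 : HasDerivAt (fun t => μ • c t) (μ • (b - a)) t := by
        have := (((hasDerivAt_id t).smul_const (b - a)).const_add a).const_smul μ
        rwa [one_smul] at this
      have h2 := hL.comp_hasDerivAt t h1
      rwa [hLb, grad_smul] at h2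
    have hsm : StrictMonoOn (fun t => B.barrier μ (μ • c t)) (Icc 0 1) := by
      refine strictMonoOn_of_deriv_pos (convex_Icc 0 1)
        (fun t ht => (hder t ht).continuousAt.continuousWithinAt) fun t ht => ?_
      rw [interior_Icc] at ht
      have htI := Ioo_subset_Icc_self ht
      rw [(hder t htI).deriv]
      refine mul_pos hμ ?_
      have h0 : c t - a = t • (b - a) := by simp [c]
      have hba : b - a ≠ 0 := by
        rw [sub_ne_zero]
        intro h
        exact huv (by rw [← hback u, ← hback v]; exact congrArg (μ • ·) h)
      have h1 := (hmono μ hμ hμ1 _ (hcb t htI)).2.2 a hva' (by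
        rw [← sub_ne_zero, h0]
        exact smul_ne_zero ht.1.ne' hba)
      rw [hback, hvc.2, h0, grad_smul] at h1
      exact (pos_iff_pos_of_mul_pos h1).mp ht.1
    have h1 := hsm (left_mem_Icc.mpr zero_le_one) (right_mem_Icc.mpr zero_le_one) zero_lt_one
    have hc0 : μ • c 0 = v := by simp only [c, zero_smul, add_zero]; exact hback v
    have hc1 : μ • c 1 = u := by simp only [c, one_smul, add_sub_cancel]; exact hback u
    simpa only [hc0, hc1] using h1

end VertexBarrier

end

/-! ### Reduction to a vertex barrier by the Schur complement. -/

section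

open scoped Matrix.Norms.Operator

namespace IsOrthonormalKernelBasis

variable {m k : ℕ} {M : Matrix (Fin m) (Fin m) ℝ} {E : Matrix (Fin m) (Fin k) ℝ}

theorem mul_eq_zero (hE : IsOrthonormalKernelBasis M E) : M * E = 0 := by
  ext i j
  have := (hE.2 (E *ᵥ Pi.single j 1)).mpr ⟨_, rfl⟩
  rw [Matrix.mulVec_mulVec] at this
  simpa using congrFun this i

theorem transpose_mul_eq_zero (hE : IsOrthonormalKernelBasis M E) (hM : M.IsSymm) :
    Eᵀ * M = 0 := by
  have := congrArg Matrix.transpose hE.mul_eq_zero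
  rwa [Matrix.transpose_mul, hM.eq, Matrix.transpose_zero] at this

/-- The columns of `Y` lie in the null space, on which E Eᵀ is the identity. -/
theorem proj_mul_of_mul_eq_zero (hE : IsOrthonormalKernelBasis M E) {Y : Matrix (Fin m) (Fin m) ℝ}
    (h : M * Y = 0) : E * Eᵀ * Y = Y := by
  ext i j
  have h1 : M *ᵥ (Y *ᵥ Pi.single j 1) = 0 := by rw [Matrix.mulVec_mulVec, h, Matrix.zero_mulVec]
  obtain ⟨u, hu⟩ := (hE.2 _).mp h1
  have h2 : (E * Eᵀ * Y) *ᵥ Pi.single j 1 = Y *ᵥ Pi.single j 1 := by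
    rw [← Matrix.mulVec_mulVec, hu, Matrix.mulVec_mulVec, Matrix.mul_assoc, hE.1, Matrix.mul_one]
  simpa using congrFun h2 i

theorem injective_mulVec (hE : IsOrthonormalKernelBasis M E) : Function.Injective E.mulVec := by
  intro u v h
  have := congrArg (Eᵀ *ᵥ ·) h
  simpa [Matrix.mulVec_mulVec, hE.1] using this

/-- A vector on which both quadratic forms vanish lies in the null space of `M` and is orthogonal to
it. -/
theorem posDef_add (hE : IsOrthonormalKernelBasis M E) (hM : M.PosSemidef) :
    (M + E * Eᵀ).PosDef := by
  have h1 : (E * Eᵀ).PosSemidef := by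
    simpa [conjTranspose_eq_transpose_of_trivial] using Matrix.posSemidef_self_mul_conjTranspose E
  refine Matrix.PosDef.of_dotProduct_mulVec_pos (hM.add h1).1 fun {x} hx => ?_
  have hn := hM.dotProduct_mulVec_nonneg x
  have hn1 := h1.dotProduct_mulVec_nonneg x
  rw [Matrix.add_mulVec, dotProduct_add]
  refine lt_of_le_of_ne (add_nonneg hn hn1) fun h => hx ?_
  have h2 : star x ⬝ᵥ M *ᵥ x = 0 := by linarith
  have h3 : star x ⬝ᵥ (E * Eᵀ) *ᵥ x = 0 := by linarith
  rw [hM.dotProduct_mulVec_zero_iff] at h2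
  rw [h1.dotProduct_mulVec_zero_iff] at h3
  obtain ⟨u, rfl⟩ := (hE.2 x).mp h2
  rwa [Matrix.mulVec_mulVec, Matrix.mul_assoc, hE.1, Matrix.mul_one] at h3

theorem inv_mul (hE : IsOrthonormalKernelBasis M E) (hM : M.PosSemidef) :
    (M + E * Eᵀ)⁻¹ * E = E := by
  have h := isUnit_iff_ne_zero.mpr (hE.posDef_add hM).det_pos.ne'
  have h1 : (M + E * Eᵀ) * E = E := by
    rw [Matrix.add_mul, hE.mul_eq_zero, Matrix.mul_assoc, hE.1, Matrix.mul_one, zero_add]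
  calc (M + E * Eᵀ)⁻¹ * E = (M + E * Eᵀ)⁻¹ * ((M + E * Eᵀ) * E) := by rw [h1]
    _ = E := Matrix.nonsing_inv_mul_cancel_left _ _ h

theorem transpose_mul_inv (hE : IsOrthonormalKernelBasis M E) (hM : M.PosSemidef) :
    Eᵀ * (M + E * Eᵀ)⁻¹ = Eᵀ := by
  have h := congrArg Matrix.transpose (hE.inv_mul hM)
  rwa [Matrix.transpose_mul, (hE.posDef_add hM).inv.posSemidef.transpose_eq] at h

/-- The inverse acts as M† on the range of `M` and as the identity on its null space. This is how
the Moore-Penrose inverse of Ω enters the derivatives of the Schur complement. -/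
theorem inv_eq_pinv_add (hE : IsOrthonormalKernelBasis M E) (hM : M.PosSemidef) :
    (M + E * Eᵀ)⁻¹ = pinv M + E * Eᵀ := by
  set N := M + E * Eᵀ with hN
  have hu := isUnit_iff_ne_zero.mpr (hE.posDef_add hM).det_pos.ne'
  have h1 : N⁻¹ * (E * Eᵀ) = E * Eᵀ := by rw [← Matrix.mul_assoc, hE.inv_mul hM]
  have h2 : E * Eᵀ * N⁻¹ = E * Eᵀ := by rw [Matrix.mul_assoc, hE.transpose_mul_inv hM]
  have h3 : E * Eᵀ * (E * Eᵀ) = E * Eᵀ := by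
    rw [Matrix.mul_assoc, ← Matrix.mul_assoc Eᵀ, hE.1, Matrix.one_mul]
  have h4 : M * (E * Eᵀ) = 0 := by rw [← Matrix.mul_assoc, hE.mul_eq_zero, Matrix.zero_mul]
  have h5 : E * Eᵀ * M = 0 := by
    rw [Matrix.mul_assoc, hE.transpose_mul_eq_zero hM.transpose_eq, Matrix.mul_zero]
  have h6 : M * N⁻¹ = 1 - E * Eᵀ := by
    rw [eq_sub_iff_add_eq, ← Matrix.mul_nonsing_inv _ hu, ← hN]
    nth_rewrite 2 [hN]
    rw [Matrix.add_mul, h2]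
  have h7 : N⁻¹ * M = 1 - E * Eᵀ := by
    rw [eq_sub_iff_add_eq, ← Matrix.nonsing_inv_mul _ hu, ← hN]
    nth_rewrite 2 [hN]
    rw [Matrix.mul_add, h1]
  have h8 : (E * Eᵀ)ᵀ = E * Eᵀ := by rw [Matrix.transpose_mul, Matrix.transpose_transpose]
  have h9 : M * (N⁻¹ - E * Eᵀ) = 1 - E * Eᵀ := by rw [Matrix.mul_sub, h4, sub_zero, h6]
  have h10 : (N⁻¹ - E * Eᵀ) * M = 1 - E * Eᵀ := by rw [Matrix.sub_mul, h5, sub_zero, h7]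
  have hmp : IsMoorePenroseInverse M (N⁻¹ - E * Eᵀ) := by
    refine ⟨?_, ?_, ?_, ?_⟩
    · rw [h9, Matrix.sub_mul, h5, Matrix.one_mul, sub_zero]
    · rw [h10, Matrix.sub_mul, Matrix.one_mul, Matrix.mul_sub, h2, h3, sub_self, sub_zero]
    · rw [h9, Matrix.transpose_sub, Matrix.transpose_one, h8]
    · rw [h10, Matrix.transpose_sub, Matrix.transpose_one, h8]
  rw [(isMoorePenroseInverse_pinv (A := M) hM.transpose_eq).unique hmp, sub_add_cancel]

end IsOrthonormalKernelBasis

/-- Data of a semidefinite problem `min f` subject to `g ⪰ 0` near the feasible point `0`. -/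
structure ReducedProblem (X : Type*) [NormedAddCommGroup X] [NormedSpace ℝ X] (m k : ℕ) where
  f : X → ℝ
  g : X → Matrix (Fin m) (Fin m) ℝ
  E : Matrix (Fin m) (Fin k) ℝ
  symm : ∀ v, (g v)ᵀ = g v
  contDiffAt_f : ContDiffAt ℝ 2 f 0
  contDiffAt_g : ContDiffAt ℝ 2 g 0
  posSemidef : (g 0).PosSemidef
  basis : IsOrthonormalKernelBasis (g 0) E

namespace ReducedProblem

variable {X : Type*} [NormedAddCommGroup X] [NormedSpace ℝ X] [FiniteDimensional ℝ X] {m k : ℕ}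
  (R : ReducedProblem X m k)

/-- The constraint matrix with its null space at `0` filled up. -/
noncomputable def N (v : X) : Matrix (Fin m) (Fin m) ℝ := R.g v + R.E * R.Eᵀ

theorem N_zero : R.N 0 = R.g 0 + R.E * R.Eᵀ := rfl

theorem posDef_N_zero : (R.N 0).PosDef := R.basis.posDef_add R.posSemidef

theorem transpose_N (v : X) : (R.N v)ᵀ = R.N v := by
  rw [N, Matrix.transpose_add, R.symm, Matrix.transpose_mul, Matrix.transpose_transpose]

theorem contDiffAt_N : ContDiffAt ℝ 2 R.N 0 := R.contDiffAt_g.add contDiffAt_const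

theorem eventually_posDef_N : ∀ᶠ v in 𝓝 0, (R.N v).PosDef :=
  R.posDef_N_zero.eventually R.contDiffAt_N.continuousAt (.of_forall R.transpose_N)

/-- Splitting `log det g` into a part that is smooth at `0` and the logarithm of the determinant of
a matrix `S` that vanishes at `0`. -/
noncomputable def toVertexBarrier : VertexBarrier X (Fin k) where
  f := R.f
  φ v := -Real.log (R.N v).det
  -- The Schur complement belonging to g = N - E Eᵀ; it vanishes at 0 because N(0)⁻¹ fixes `E`.
  S v := 1 - R.E.congruence (R.N v)⁻¹
  symm v := by
    rw [Matrix.congruence_apply, Matrix.transpose_sub, Matrix.transpose_one, Matrix.transpose_mul,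
      Matrix.transpose_mul, Matrix.transpose_nonsing_inv, R.transpose_N, Matrix.transpose_transpose,
      Matrix.mul_assoc]
  contDiffAt_f := R.contDiffAt_f
  contDiffAt_φ := ((Matrix.contDiff_det.contDiffAt.comp 0 R.contDiffAt_N).log
    R.posDef_N_zero.det_pos.ne').neg
  contDiffAt_S := contDiffAt_const.sub (R.E.congruence.contDiff.contDiffAt.comp 0
    (R.contDiffAt_N.matrix_inv R.posDef_N_zero.isUnit))
  S_zero := by
    rw [Matrix.congruence_apply, N_zero, R.basis.transpose_mul_inv R.posSemidef, R.basis.1, sub_self]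

theorem S_apply (v : X) : R.toVertexBarrier.S v = 1 - R.Eᵀ * (R.N v)⁻¹ * R.E := rfl

theorem posDef_iff {v : X} (hv : (R.N v).PosDef) :
    (R.g v).PosDef ↔ (R.toVertexBarrier.S v).PosDef := by
  rw [S_apply, ← hv.sub_mul_transpose_iff, N, add_sub_cancel_right]

theorem det_eq {v : X} (hv : (R.N v).PosDef) :
    (R.g v).det = (R.N v).det * (R.toVertexBarrier.S v).det := by
  rw [S_apply, ← hv.det_sub_mul_transpose, N, add_sub_cancel_right]

theorem barrier_eq {v : X} (hv : (R.N v).PosDef) (hg : (R.g v).PosDef) (μ : ℝ) :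
    R.toVertexBarrier.barrier μ v = R.f v - μ * Real.log (R.g v).det := by
  have hS := (R.posDef_iff hv).mp hg
  rw [VertexBarrier.barrier, R.det_eq hv, Real.log_mul hv.det_pos.ne' hS.det_pos.ne']
  change R.f v + μ * -Real.log (R.N v).det - _ = _
  ring

theorem eventually_hasFDerivAt_g : ∀ᶠ v in 𝓝 0, HasFDerivAt R.g (fderiv ℝ R.g v) v :=
  R.contDiffAt_g.eventually_hasFDerivAt_fderiv

theorem hasFDerivAt_N {v : X} (h : HasFDerivAt R.g (fderiv ℝ R.g v) v) :
    HasFDerivAt R.N (fderiv ℝ R.g v) v := h.add_const _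

/-- Both forms of the barrier function agree near a point with g ≻ 0, so uniqueness of the
derivative compares the two critical point equations without differentiating `S`. -/
theorem eventually_isCritical_iff : ∀ᶠ v in 𝓝 0, ∀ μ, R.toVertexBarrier.IsCritical μ v ↔
    (R.g v).PosDef ∧ ∀ b, fderiv ℝ R.f v b = μ * ((R.g v)⁻¹ * fderiv ℝ R.g v b).trace := by
  filter_upwards [R.eventually_posDef_N.eventually_nhds, R.eventually_hasFDerivAt_g,
    VertexBarrier.eventually_smoothAt (B := R.toVertexBarrier)] with v hN hg hsm μ
  have hNv := hN.self_of_nhds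
  rw [VertexBarrier.IsCritical, ← R.posDef_iff hNv]
  refine and_congr_right fun hpd => forall_congr' fun b => ?_
  obtain ⟨L, hL, hLb⟩ := hsm.hasFDerivAt_barrier ((R.posDef_iff hNv).mp hpd) μ
  have hpde : ∀ᶠ u in 𝓝 v, (R.g u).PosDef :=
    hpd.eventually hg.continuousAt (.of_forall R.symm)
  have h1 : HasFDerivAt (fun u => R.f u - μ * Real.log (R.g u).det) L v := by
    refine hL.congr_of_eventuallyEq ?_
    filter_upwards [hN, hpde] with u hu1 hu2
    exact (R.barrier_eq hu1 hu2 μ).symm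
  have h2 := (hsm.1.differentiableAt (by simp)).hasFDerivAt.sub
    ((hg.log_det hpd.det_pos.ne').const_mul μ)
  have h3 : L b = fderiv ℝ R.f v b - μ * ((R.g v)⁻¹ * fderiv ℝ R.g v b).trace :=
    DFunLike.congr_fun (h1.unique h2) b
  rw [← hLb, h3, sub_eq_zero]

theorem fderiv_φ (b : X) : fderiv ℝ R.toVertexBarrier.φ 0 b =
    -((R.N 0)⁻¹ * fderiv ℝ R.g 0 b).trace := by
  have h := ((R.hasFDerivAt_N R.eventually_hasFDerivAt_g.self_of_nhds).log_det
    R.posDef_N_zero.det_pos.ne').neg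
  exact DFunLike.congr_fun h.fderiv b

theorem fderiv_S {v : X} (hv : (R.N v).PosDef) (h : HasFDerivAt R.g (fderiv ℝ R.g v) v) (b : X) :
    fderiv ℝ R.toVertexBarrier.S v b =
      R.Eᵀ * ((R.N v)⁻¹ * fderiv ℝ R.g v b * (R.N v)⁻¹) * R.E := by
  have h1 := (R.E.congruence.hasFDerivAt.comp v ((R.hasFDerivAt_N h).matrix_inv hv.isUnit)).const_sub
    (1 : Matrix (Fin k) (Fin k) ℝ)
  refine (DFunLike.congr_fun h1.fderiv b).trans ?_
  change -(R.Eᵀ * -((R.N v)⁻¹ * fderiv ℝ R.g v b * (R.N v)⁻¹) * R.E) = _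
  rw [Matrix.mul_neg, Matrix.neg_mul, neg_neg]

theorem fderiv_S_zero (b : X) : fderiv ℝ R.toVertexBarrier.S 0 b = R.Eᵀ * fderiv ℝ R.g 0 b * R.E := by
  rw [R.fderiv_S R.posDef_N_zero R.eventually_hasFDerivAt_g.self_of_nhds, ← Matrix.mul_assoc,
    ← Matrix.mul_assoc, N_zero, R.basis.transpose_mul_inv R.posSemidef, Matrix.mul_assoc,
    R.basis.inv_mul R.posSemidef]

/-- N(0)⁻¹ fixes `E`, so the outer inverses disappear. The two products that remain from
differentiating the inverse are the source of the sigma term. -/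
theorem fderiv_fderiv_S_zero (a b : X) : fderiv ℝ (fderiv ℝ R.toVertexBarrier.S) 0 a b =
    R.Eᵀ * fderiv ℝ (fderiv ℝ R.g) 0 a b * R.E -
      R.Eᵀ * (fderiv ℝ R.g 0 a * (R.N 0)⁻¹ * fderiv ℝ R.g 0 b) * R.E -
      R.Eᵀ * (fderiv ℝ R.g 0 b * (R.N 0)⁻¹ * fderiv ℝ R.g 0 a) * R.E := by
  have hS := R.toVertexBarrier.contDiffAt_S.hasStrictFDerivAt_fderiv.hasFDerivAt
  have hSb : HasFDerivAt (fun v => fderiv ℝ R.toVertexBarrier.S v b)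
      ((ContinuousLinearMap.apply ℝ (Matrix (Fin k) (Fin k) ℝ) b).comp
        (fderiv ℝ (fderiv ℝ R.toVertexBarrier.S) 0)) 0 :=
    (ContinuousLinearMap.apply ℝ (Matrix (Fin k) (Fin k) ℝ) b).hasFDerivAt.comp 0 hS
  have hg := R.contDiffAt_g.hasStrictFDerivAt_fderiv.hasFDerivAt
  have hgb : HasFDerivAt (fun v => fderiv ℝ R.g v b)
      ((ContinuousLinearMap.apply ℝ (Matrix (Fin m) (Fin m) ℝ) b).comp
        (fderiv ℝ (fderiv ℝ R.g) 0)) 0 :=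
    (ContinuousLinearMap.apply ℝ (Matrix (Fin m) (Fin m) ℝ) b).hasFDerivAt.comp 0 hg
  have hinv := (R.hasFDerivAt_N R.eventually_hasFDerivAt_g.self_of_nhds).matrix_inv
    R.posDef_N_zero.isUnit
  have hprod := R.E.congruence.hasFDerivAt.comp 0 ((hinv.mul' hgb).mul' hinv)
  have hSb' := hSb.congr_of_eventuallyEq (f₁ := fun v => R.E.congruence
    ((R.N v)⁻¹ * fderiv ℝ R.g v b * (R.N v)⁻¹)) (by
      filter_upwards [R.eventually_posDef_N, R.eventually_hasFDerivAt_g] with v h1 h2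
      rw [R.fderiv_S h1 h2]
      rfl)
  refine (DFunLike.congr_fun (hSb'.unique hprod) a).trans ?_
  set D := (R.N 0)⁻¹ with hD
  set A := fderiv ℝ R.g 0 a
  set C := fderiv ℝ R.g 0 b
  set H := fderiv ℝ (fderiv ℝ R.g) 0 a b
  have h1 : D * R.E = R.E := R.basis.inv_mul R.posSemidef
  have h2 : R.Eᵀ * D = R.Eᵀ := R.basis.transpose_mul_inv R.posSemidef
  change R.Eᵀ * (D * C * -(D * A * D) + (D * H + -(D * A * D) * C) * D) * R.E = _
  have h3 : D * C * -(D * A * D) + (D * H + -(D * A * D) * C) * D =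
      D * H * D - D * (A * D * C) * D - D * (C * D * A) * D := by noncomm_ring
  have h4 : ∀ Z : Matrix (Fin m) (Fin m) ℝ, R.Eᵀ * (D * Z * D) * R.E = R.Eᵀ * Z * R.E := by
    intro Z
    rw [← Matrix.mul_assoc, ← Matrix.mul_assoc, h2, Matrix.mul_assoc, h1]
  rw [h3, Matrix.mul_sub, Matrix.mul_sub, Matrix.sub_mul, Matrix.sub_mul, h4, h4, h4]

/-- The pairing of `Eᵀ M E` with `Y`. -/
theorem trace_mul_congruence (Y : Matrix (Fin k) (Fin k) ℝ) (M : Matrix (Fin m) (Fin m) ℝ) :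
    (Y * (R.Eᵀ * M * R.E)).trace = (R.E * Y * R.Eᵀ * M).trace := by
  rw [← Matrix.mul_assoc, Matrix.trace_mul_comm]
  simp only [Matrix.mul_assoc]

theorem hess_eq (Y : Matrix (Fin k) (Fin k) ℝ) (a b : X) : R.toVertexBarrier.hess Y a b =
    fderiv ℝ (fderiv ℝ R.f) 0 a b - (R.E * Y * R.Eᵀ * fderiv ℝ (fderiv ℝ R.g) 0 a b).trace +
      (R.E * Y * R.Eᵀ * (fderiv ℝ R.g 0 a * (R.N 0)⁻¹ * fderiv ℝ R.g 0 b)).trace +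
      (R.E * Y * R.Eᵀ * (fderiv ℝ R.g 0 b * (R.N 0)⁻¹ * fderiv ℝ R.g 0 a)).trace := by
  rw [VertexBarrier.hess, fderiv_fderiv_S_zero, Matrix.mul_sub, Matrix.mul_sub, Matrix.trace_sub,
    Matrix.trace_sub, trace_mul_congruence, trace_mul_congruence, trace_mul_congruence]
  change fderiv ℝ (fderiv ℝ R.f) 0 a b - _ = _
  ring

/-- The Hessian of the Schur complement, in terms of the Moore-Penrose inverse, along directions of
which one is flat. -/
theorem hess_eq_pinv (Y : Matrix (Fin k) (Fin k) ℝ) {a b : X}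
    (hb : fderiv ℝ R.toVertexBarrier.S 0 b = 0) : R.toVertexBarrier.hess Y a b =
    fderiv ℝ (fderiv ℝ R.f) 0 a b - (R.E * Y * R.Eᵀ * fderiv ℝ (fderiv ℝ R.g) 0 a b).trace +
      (R.E * Y * R.Eᵀ * (fderiv ℝ R.g 0 a * pinv (R.g 0) * fderiv ℝ R.g 0 b)).trace +
      (R.E * Y * R.Eᵀ * (fderiv ℝ R.g 0 b * pinv (R.g 0) * fderiv ℝ R.g 0 a)).trace := by
  rw [fderiv_S_zero] at hb
  rw [hess_eq, N_zero, R.basis.inv_eq_pinv_add R.posSemidef]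
  set A := fderiv ℝ R.g 0 a
  set C := fderiv ℝ R.g 0 b
  -- The summand E Eᵀ of N(0)⁻¹ contributes nothing, since Eᵀ C E = 0 for the flat direction.
  have h1 : (R.E * Y * R.Eᵀ * (A * (R.E * R.Eᵀ) * C)).trace = 0 := by
    rw [← trace_mul_congruence]
    have : R.Eᵀ * (A * (R.E * R.Eᵀ) * C) * R.E = R.Eᵀ * A * R.E * (R.Eᵀ * C * R.E) := by
      simp only [Matrix.mul_assoc]
    rw [this, hb, Matrix.mul_zero, Matrix.mul_zero, Matrix.trace_zero]
  have h2 : (R.E * Y * R.Eᵀ * (C * (R.E * R.Eᵀ) * A)).trace = 0 := by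
    rw [← trace_mul_congruence]
    have : R.Eᵀ * (C * (R.E * R.Eᵀ) * A) * R.E = R.Eᵀ * C * R.E * (R.Eᵀ * A * R.E) := by
      simp only [Matrix.mul_assoc]
    rw [this, hb, Matrix.zero_mul, Matrix.mul_zero, Matrix.trace_zero]
  have h3 : ∀ Z W : Matrix (Fin m) (Fin m) ℝ,
      (R.E * Y * R.Eᵀ * (Z * (pinv (R.g 0) + R.E * R.Eᵀ) * W)).trace =
      (R.E * Y * R.Eᵀ * (Z * pinv (R.g 0) * W)).trace +
        (R.E * Y * R.Eᵀ * (Z * (R.E * R.Eᵀ) * W)).trace := fun Z W => by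
    rw [Matrix.mul_add, Matrix.add_mul, Matrix.mul_add, Matrix.trace_add]
  rw [h3, h3, h1, h2, add_zero, add_zero]

theorem fderiv_φ_eq_pinv {b : X} (hb : fderiv ℝ R.toVertexBarrier.S 0 b = 0) :
    fderiv ℝ R.toVertexBarrier.φ 0 b = -(pinv (R.g 0) * fderiv ℝ R.g 0 b).trace := by
  rw [fderiv_S_zero] at hb
  rw [fderiv_φ, N_zero, R.basis.inv_eq_pinv_add R.posSemidef, Matrix.add_mul, Matrix.trace_add]
  have : (R.E * R.Eᵀ * fderiv ℝ R.g 0 b).trace = 0 := by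
    rw [Matrix.mul_assoc, Matrix.trace_mul_comm, hb, Matrix.trace_zero]
  rw [this, add_zero]

theorem mem_multipliers_iff (Y : Matrix (Fin k) (Fin k) ℝ) : Y ∈ R.toVertexBarrier.multipliers ↔
    Y.PosSemidef ∧ ∀ d, fderiv ℝ R.f 0 d = (R.E * Y * R.Eᵀ * fderiv ℝ R.g 0 d).trace := by
  refine and_congr_right fun _ => forall_congr' fun d => ?_
  rw [fderiv_S_zero, trace_mul_congruence]
  rfl

end ReducedProblem

end

/-! ### Gradients, Lagrangian and charts of the feasible manifold. -/

theorem inner_gradient_eq_fderiv {F : Type*} [NormedAddCommGroup F] [InnerProductSpace ℝ F]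
    [CompleteSpace F] (f : F → ℝ) (x d : F) : inner ℝ (gradient f x) d = fderiv ℝ f x d := by
  rw [← toDual_gradient]
  rfl

/-- A vector orthogonal to the common orthogonal complement of finitely many vectors is a
combination of them. -/
theorem exists_eq_sum_of_forall_inner_eq_zero {F ι : Type*} [NormedAddCommGroup F]
    [InnerProductSpace ℝ F] [FiniteDimensional ℝ F] [Fintype ι] (g : ι → F) (u : F)
    (h : ∀ d, (∀ i, inner ℝ (g i) d = 0) → inner ℝ u d = 0) : ∃ c : ι → ℝ, ∑ i, c i • g i = u := by
  rw [← Submodule.mem_span_range_iff_exists_fun, ← Submodule.orthogonal_orthogonal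
    (Submodule.span ℝ (range g)), Submodule.mem_orthogonal']
  intro d hd
  refine h d fun i => ?_
  exact (Submodule.mem_orthogonal _ _).mp hd _ (Submodule.subset_span (mem_range_self i))

/-- The chain rule for second derivatives at a critical point of the outer function. -/
theorem fderiv_fderiv_comp_of_fderiv_eq_zero {X Z W : Type*} [NormedAddCommGroup X]
    [NormedSpace ℝ X] [NormedAddCommGroup Z] [NormedSpace ℝ Z] [NormedAddCommGroup W]
    [NormedSpace ℝ W] {F : Z → W} {Ψ : X → Z} {x : X} (hF : ContDiffAt ℝ 2 F (Ψ x))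
    (hΨ : ContDiffAt ℝ 2 Ψ x) (h0 : fderiv ℝ F (Ψ x) = 0) (a b : X) :
    fderiv ℝ (fderiv ℝ (F ∘ Ψ)) x a b =
      fderiv ℝ (fderiv ℝ F) (Ψ x) (fderiv ℝ Ψ x a) (fderiv ℝ Ψ x b) := by
  have h1 : fderiv ℝ (F ∘ Ψ) =ᶠ[𝓝 x] fun v => (fderiv ℝ F (Ψ v)).comp (fderiv ℝ Ψ v) := by
    filter_upwards [hΨ.eventually_hasFDerivAt_fderiv,
      hΨ.continuousAt.eventually hF.eventually_hasFDerivAt_fderiv] with v hv1 hv2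
    exact (hv2.comp v hv1).fderiv
  have h2 := (hF.hasStrictFDerivAt_fderiv.hasFDerivAt.comp x
    hΨ.eventually_hasFDerivAt_fderiv.self_of_nhds).clm_comp
      hΨ.hasStrictFDerivAt_fderiv.hasFDerivAt
  rw [h1.fderiv_eq]
  refine (congrArg (fun L => L a b) (HasFDerivAt.fderiv h2)).trans ?_
  -- The term with the second derivative of `Ψ` carries the factor F' = 0.
  simp [h0]

section

open scoped Matrix.Norms.Operator

namespace NSDP

variable {n m s k : ℕ} (P : NSDP n m s)

theorem contDiff_matrix : ContDiff ℝ 2 P.G :=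
  contDiff_iff_contDiffAt.mpr fun _ =>
    Matrix.contDiffAt_of_entries fun i j => (P.contDiff_G i j).contDiffAt

theorem hasFDerivAt_G (x : EuclideanSpace ℝ (Fin n)) : HasFDerivAt P.G (fderiv ℝ P.G x) x :=
  (P.contDiff_matrix.differentiable (by simp) x).hasFDerivAt

theorem fderiv_G_apply (x d : EuclideanSpace ℝ (Fin n)) : fderiv ℝ P.G x d = P.dG x d := by
  ext i j
  have h := ((Matrix.entryL i j).hasFDerivAt (x := P.G x)).comp x (P.hasFDerivAt_G x)
  exact (DFunLike.congr_fun h.fderiv d).symm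

theorem transpose_dG (x d : EuclideanSpace ℝ (Fin n)) : (P.dG x d)ᵀ = P.dG x d := by
  ext i j
  have : (fun y => P.G y j i) = fun y => P.G y i j := funext fun y => (P.symm_G y).apply i j
  simp only [Matrix.transpose_apply, dG, Matrix.of_apply, this]

theorem dG_eq_sum (x d : EuclideanSpace ℝ (Fin n)) : P.dG x d = ∑ i, d i • P.partialG x i := by
  simp only [partialG, ← fderiv_G_apply]
  rw [← Finset.sum_congr rfl fun i _ => (fderiv ℝ P.G x).map_smul (d i) _, ← map_sum]
  congr 1
  ext j
  simp [Finset.sum_apply, Pi.single_apply]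

theorem inner_adjG (x d : EuclideanSpace ℝ (Fin n)) (Y : Matrix (Fin m) (Fin m) ℝ) :
    inner ℝ d (P.adjG x Y) = (P.dG x d * Y).trace := by
  rw [dG_eq_sum, Finset.sum_mul, Matrix.trace_sum, PiLp.inner_apply]
  refine Finset.sum_congr rfl fun i _ => ?_
  rw [Matrix.smul_mul, Matrix.trace_smul, smul_eq_mul, adjG]
  simp [mul_comm]

theorem dotProduct_sigmaMatrix (x d : EuclideanSpace ℝ (Fin n)) (Y : Matrix (Fin m) (Fin m) ℝ) :
    d.ofLp ⬝ᵥ (P.sigmaMatrix x Y *ᵥ d.ofLp) =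
      2 * (Y * (P.dG x d * pinv (P.G x) * P.dG x d)).trace := by
  rw [dG_eq_sum]
  simp only [dotProduct, Matrix.mulVec, sigmaMatrix, Matrix.of_apply, Finset.sum_mul,
    Finset.mul_sum, Matrix.trace_sum, Matrix.smul_mul, Matrix.mul_smul, Matrix.trace_smul,
    smul_eq_mul]
  rw [Finset.sum_comm]
  refine Finset.sum_congr rfl fun i _ => Finset.sum_congr rfl fun j _ => ?_
  ring

theorem differentiableAt_h (x : EuclideanSpace ℝ (Fin n)) : DifferentiableAt ℝ P.h x :=
  P.contDiff_h.differentiable (by simp) x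

theorem contDiff_h_apply (i : Fin s) : ContDiff ℝ 2 fun y => P.h y i :=
  contDiff_euclidean.mp P.contDiff_h i

theorem inner_gradH (x d : EuclideanSpace ℝ (Fin n)) (i : Fin s) :
    inner ℝ (P.gradH x i) d = fderiv ℝ P.h x d i := by
  rw [gradH, inner_gradient_eq_fderiv]
  have h := ((EuclideanSpace.proj (𝕜 := ℝ) i).hasFDerivAt (x := P.h x)).comp x
    (P.differentiableAt_h x).hasFDerivAt
  exact DFunLike.congr_fun h.fderiv d

theorem contDiff_lagrangian (Y : Matrix (Fin m) (Fin m) ℝ) (z : EuclideanSpace ℝ (Fin s)) :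
    ContDiff ℝ 2 fun y => P.lagrangian y Y z := by
  refine (P.contDiff_f.sub ?_).add (ContDiff.sum fun i _ => (P.contDiff_h_apply i).mul contDiff_const)
  have : (fun y => (P.G y * Y).trace) = fun y => Y.tracePairing (P.G y) :=
    funext fun y => Matrix.trace_mul_comm _ _
  rw [this]
  exact Y.tracePairing.contDiff.comp P.contDiff_matrix

theorem inner_gradL (x d : EuclideanSpace ℝ (Fin n)) (Y : Matrix (Fin m) (Fin m) ℝ)
    (z : EuclideanSpace ℝ (Fin s)) : inner ℝ (P.gradL x Y z) d =
      fderiv ℝ P.f x d - (Y * P.dG x d).trace + ∑ i, inner ℝ (P.gradH x i) d * z i := by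
  rw [gradL, inner_gradient_eq_fderiv]
  have hf := (P.contDiff_f.differentiable (by simp) x).hasFDerivAt
  have hG := (Y.tracePairing.hasFDerivAt (x := P.G x)).comp x (P.hasFDerivAt_G x)
  have hh : HasFDerivAt (fun y => ∑ i, P.h y i * z i)
      (∑ i, z i • fderiv ℝ (fun y => P.h y i) x) x :=
    HasFDerivAt.fun_sum fun i _ =>
      ((P.contDiff_h_apply i).differentiable (by simp) x).hasFDerivAt.mul_const (z i)
  have h := (hf.sub hG).add hh
  have hL : (fun y => P.lagrangian y Y z) =
      (P.f - ⇑Y.tracePairing ∘ P.G) + fun y => ∑ i, P.h y i * z i := by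
    funext y
    rw [lagrangian, Matrix.trace_mul_comm]
    rfl
  rw [hL, h.fderiv]
  rw [_root_.add_apply, _root_.sub_apply, _root_.sum_apply]
  change fderiv ℝ P.f x d - (Y * fderiv ℝ P.G x d).trace + _ = _
  rw [fderiv_G_apply]
  congr 1
  refine Finset.sum_congr rfl fun i _ => ?_
  rw [gradH, inner_gradient_eq_fderiv, _root_.smul_apply, smul_eq_mul, mul_comm]

theorem inner_hessL (x a b : EuclideanSpace ℝ (Fin n)) (Y : Matrix (Fin m) (Fin m) ℝ)
    (z : EuclideanSpace ℝ (Fin s)) : inner ℝ b (P.hessL x Y z a) =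
      fderiv ℝ (fderiv ℝ fun y => P.lagrangian y Y z) x a b := by
  have h1 : HasFDerivAt (fun y => P.gradL y Y z) (P.hessL x Y z) x := by
    refine DifferentiableAt.hasFDerivAt ?_
    have h2 := (P.contDiff_lagrangian Y z).contDiffAt.hasStrictFDerivAt_fderiv (x := x)
    exact ((InnerProductSpace.toDual ℝ (EuclideanSpace ℝ (Fin n))).symm.toContinuousLinearEquiv
      |>.differentiableAt).comp x h2.hasFDerivAt.differentiableAt
  have h3 : HasFDerivAt (fun y => inner ℝ b (P.gradL y Y z))
      ((innerSL ℝ b).comp (P.hessL x Y z)) x := (innerSL ℝ b).hasFDerivAt.comp x h1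
  have h4 := (P.contDiff_lagrangian Y z).contDiffAt.hasStrictFDerivAt_fderiv (x := x)
  have h5 := ((ContinuousLinearMap.apply ℝ ℝ b).hasFDerivAt).comp x h4.hasFDerivAt
  have h6 : (fun y => inner ℝ b (P.gradL y Y z)) =
      ⇑(ContinuousLinearMap.apply ℝ ℝ b) ∘ fderiv ℝ fun y => P.lagrangian y Y z := by
    funext y
    rw [real_inner_comm, gradL, inner_gradient_eq_fderiv]
    rfl
  rw [h6] at h3
  exact DFunLike.congr_fun (h3.unique h5) a

/-- Stationarity on the tangent space yields multipliers for the equality constraints. -/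
theorem exists_gradL_eq_zero {x : EuclideanSpace ℝ (Fin n)} {Y : Matrix (Fin m) (Fin m) ℝ}
    (h : ∀ d, (∀ i, inner ℝ (P.gradH x i) d = 0) → fderiv ℝ P.f x d = (Y * P.dG x d).trace) :
    ∃ z, P.gradL x Y z = 0 := by
  obtain ⟨c, hc⟩ := exists_eq_sum_of_forall_inner_eq_zero (P.gradH x) (-P.gradL x Y 0) (by
    intro d hd
    rw [inner_neg_left, inner_gradL, h d hd]
    simp)
  refine ⟨WithLp.toLp 2 c, ext_inner_right ℝ fun d => ?_⟩
  have h1 := congrArg (inner ℝ · d) hc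
  simp only [sum_inner, inner_smul_left, inner_neg_left, inner_gradL] at h1
  rw [inner_gradL, inner_zero_left]
  simp only [PiLp.zero_apply, mul_zero, Finset.sum_const_zero, add_zero, conj_trivial] at h1
  have : ∑ i, inner ℝ (P.gradH x i) d * (WithLp.toLp 2 c : EuclideanSpace ℝ (Fin s)) i =
      ∑ i, c i * inner ℝ (P.gradH x i) d :=
    Finset.sum_congr rfl fun i _ => mul_comm _ _
  rw [this, h1]
  ring

theorem continuous_gradH (i : Fin s) : Continuous fun x => P.gradH x i :=
  (InnerProductSpace.toDual ℝ (EuclideanSpace ℝ (Fin n))).symm.continuous.comp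
    ((P.contDiff_h_apply i).continuous_fderiv (by simp))

/-- `Ψ` is a parametrization of `{h = 0}` around `xs = Ψ 0`, at which the equality constraints are
regular. -/
structure IsChart (xs : EuclideanSpace ℝ (Fin n))
    (Ψ : EuclideanSpace ℝ (Fin (n - s)) → EuclideanSpace ℝ (Fin n)) : Prop where
  contDiffAt : ContDiffAt ℝ 2 Ψ 0
  map_zero : Ψ 0 = xs
  h_eq_zero : ∀ᶠ v in 𝓝 0, P.h (Ψ v) = 0
  injective : ∀ᶠ v in 𝓝 0, Function.Injective (fderiv ℝ Ψ v)
  linearIndependent : LinearIndependent ℝ (P.gradH xs)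

variable {P} {xs : EuclideanSpace ℝ (Fin n)}
  {Ψ : EuclideanSpace ℝ (Fin (n - s)) → EuclideanSpace ℝ (Fin n)}

theorem IsChart.eventually_hasFDerivAt (hΨ : P.IsChart xs Ψ) :
    ∀ᶠ v in 𝓝 0, HasFDerivAt Ψ (fderiv ℝ Ψ v) v :=
  hΨ.contDiffAt.eventually_hasFDerivAt_fderiv

/-- The derivative of the chart maps onto the tangent space of `{h = 0}`. -/
theorem IsChart.eventually_range (hΨ : P.IsChart xs Ψ) : ∀ᶠ v in 𝓝 0, ∀ d,
    (∀ i, inner ℝ (P.gradH (Ψ v) i) d = 0) ↔ ∃ w, fderiv ℝ Ψ v w = d := by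
  -- Linear independence of the gradients is an open condition.
  have hli : ∀ᶠ v in 𝓝 0, LinearIndependent ℝ (P.gradH (Ψ v)) := by
    have hc : ContinuousAt (fun v => P.gradH (Ψ v)) 0 := by
      refine continuousAt_pi.mpr fun i => ?_
      exact (P.continuous_gradH i).continuousAt.comp hΨ.contDiffAt.continuousAt
    refine hc.eventually (isOpen_setOfPred_linearIndependent.mem_nhds ?_)
    show LinearIndependent ℝ (P.gradH (Ψ 0))
    rw [hΨ.map_zero]
    exact hΨ.linearIndependent
  filter_upwards [hli, hΨ.injective, hΨ.eventually_hasFDerivAt,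
    hΨ.h_eq_zero.eventually_nhds] with v hlv hinj hd hh
  set K : Submodule ℝ (EuclideanSpace ℝ (Fin n)) := (Submodule.span ℝ (range (P.gradH (Ψ v))))ᗮ
  have hK : ∀ d, d ∈ K ↔ ∀ i, inner ℝ (P.gradH (Ψ v) i) d = 0 := by
    intro d
    constructor
    · intro hd i
      exact (Submodule.mem_orthogonal _ _).mp hd _ (Submodule.subset_span (mem_range_self i))
    · intro hd
      rw [Submodule.mem_orthogonal]
      intro u hu
      obtain ⟨c, rfl⟩ := (Submodule.mem_span_range_iff_exists_fun ℝ).mp hu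
      simp [sum_inner, inner_smul_left, hd]
  have hle : LinearMap.range (fderiv ℝ Ψ v).toLinearMap ≤ K := by
    rintro _ ⟨w, rfl⟩
    rw [hK]
    intro i
    rw [inner_gradH]
    have h1 := (P.differentiableAt_h (Ψ v)).hasFDerivAt.comp v hd
    have h2 : (P.h ∘ Ψ) =ᶠ[𝓝 v] fun _ => 0 := hh
    have h3 := h1.unique ((hasFDerivAt_const (0 : EuclideanSpace ℝ (Fin s)) v).congr_of_eventuallyEq h2)
    have h4 := DFunLike.congr_fun h3 w
    exact congrArg (fun y : EuclideanSpace ℝ (Fin s) => y i) h4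
  -- Independence of the gradients gives s ≤ n, so the truncated n - s is the true dimension of the
  -- tangent space.
  have hrank : Module.finrank ℝ (LinearMap.range (fderiv ℝ Ψ v).toLinearMap) =
      Module.finrank ℝ K := by
    rw [LinearMap.finrank_range_of_inj hinj, finrank_euclideanSpace_fin]
    have h1 := (Submodule.span ℝ (range (P.gradH (Ψ v)))).finrank_add_finrank_orthogonal
    rw [finrank_span_eq_card hlv, finrank_euclideanSpace_fin, Fintype.card_fin] at h1
    change n - s = Module.finrank ℝ (Submodule.span ℝ (range (P.gradH (Ψ v))))ᗮ
    omega
  have heq := Submodule.eq_of_le_of_finrank_eq hle hrank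
  intro d
  rw [← hK, ← heq]
  rfl

end NSDP

end

/-! ### The linearized complementarity equation in blocks. -/

namespace IsOrthonormalKernelBasis

variable {m k : ℕ} {M : Matrix (Fin m) (Fin m) ℝ} {E : Matrix (Fin m) (Fin k) ℝ}

theorem proj_mul_proj (hE : IsOrthonormalKernelBasis M E) : E * Eᵀ * (E * Eᵀ) = E * Eᵀ := by
  rw [Matrix.mul_assoc, ← Matrix.mul_assoc Eᵀ, hE.1, Matrix.one_mul]

theorem mul_proj (hE : IsOrthonormalKernelBasis M E) : M * (E * Eᵀ) = 0 := by
  rw [← Matrix.mul_assoc, hE.mul_eq_zero, Matrix.zero_mul]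

theorem proj_mul (hE : IsOrthonormalKernelBasis M E) (hM : M.PosSemidef) : E * Eᵀ * M = 0 := by
  rw [Matrix.mul_assoc, hE.transpose_mul_eq_zero hM.transpose_eq, Matrix.mul_zero]

theorem pinv_mul_basis (hE : IsOrthonormalKernelBasis M E) (hM : M.PosSemidef) :
    pinv M * E = 0 := by
  rw [← sub_eq_iff_eq_add.mpr (hE.inv_eq_pinv_add hM), Matrix.sub_mul, hE.inv_mul hM,
    Matrix.mul_assoc, hE.1, Matrix.mul_one, sub_self]

theorem transpose_pinv (hE : IsOrthonormalKernelBasis M E) (hM : M.PosSemidef) :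
    (pinv M)ᵀ = pinv M := by
  rw [← sub_eq_iff_eq_add.mpr (hE.inv_eq_pinv_add hM), Matrix.transpose_sub,
    (hE.posDef_add hM).inv.posSemidef.transpose_eq, Matrix.transpose_mul,
    Matrix.transpose_transpose]

theorem basis_mul_pinv (hE : IsOrthonormalKernelBasis M E) (hM : M.PosSemidef) :
    Eᵀ * pinv M = 0 := by
  have := congrArg Matrix.transpose (hE.pinv_mul_basis hM)
  rwa [Matrix.transpose_mul, hE.transpose_pinv hM, Matrix.transpose_zero] at this

theorem mul_pinv (hE : IsOrthonormalKernelBasis M E) (hM : M.PosSemidef) :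
    M * pinv M = 1 - E * Eᵀ := by
  have h := Matrix.mul_nonsing_inv _ (isUnit_iff_ne_zero.mpr (hE.posDef_add hM).det_pos.ne')
  rw [hE.inv_eq_pinv_add hM, Matrix.add_mul, Matrix.mul_add, Matrix.mul_add, hE.mul_proj,
    Matrix.mul_assoc E, hE.basis_mul_pinv hM, Matrix.mul_zero, hE.proj_mul_proj, add_zero,
    zero_add] at h
  exact eq_sub_of_add_eq h

theorem pinv_mul (hE : IsOrthonormalKernelBasis M E) (hM : M.PosSemidef) :
    pinv M * M = 1 - E * Eᵀ := by
  have := congrArg Matrix.transpose (hE.mul_pinv hM)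
  rwa [Matrix.transpose_mul, hE.transpose_pinv hM, hM.transpose_eq, Matrix.transpose_sub,
    Matrix.transpose_one, Matrix.transpose_mul, Matrix.transpose_transpose] at this

/-- The symmetric solutions of the linearized symmetrized complementarity system, tested against a
flat direction. -/
theorem trace_mul_of_linearized (hE : IsOrthonormalKernelBasis M E) (hM : M.PosSemidef)
    {Y₁ : Matrix (Fin k) (Fin k) ℝ} {X Δ D : Matrix (Fin m) (Fin m) ℝ} (hΔ : Δᵀ = Δ)
    (hsys : M * Δ + Δ * M + (E * Y₁ * Eᵀ * X + X * (E * Y₁ * Eᵀ)) =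
      (2 : ℝ) • (1 : Matrix (Fin m) (Fin m) ℝ)) (hD : Eᵀ * D * E = 0) :
    (D * Δ).trace = (pinv M * D).trace - (E * Y₁ * Eᵀ * (X * pinv M * D)).trace -
      (E * Y₁ * Eᵀ * (D * pinv M * X)).trace := by
  set Y := E * Y₁ * Eᵀ with hY
  set T := E * Eᵀ with hT
  set B := pinv M with hB
  have hYT : Y * T = Y := by
    rw [hY, hT, Matrix.mul_assoc _ Eᵀ, ← Matrix.mul_assoc Eᵀ, hE.1, Matrix.one_mul]
  have hTY : T * Y = Y := by
    rw [hY, hT, Matrix.mul_assoc E Eᵀ, ← Matrix.mul_assoc Eᵀ, ← Matrix.mul_assoc Eᵀ, hE.1,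
      Matrix.one_mul, Matrix.mul_assoc]
  have hBT : B * T = 0 := by rw [hT, ← Matrix.mul_assoc, hE.pinv_mul_basis hM, Matrix.zero_mul]
  have hTB : T * B = 0 := by rw [hT, Matrix.mul_assoc, hE.basis_mul_pinv hM, Matrix.mul_zero]
  have hMT : M * T = 0 := hE.mul_proj
  have hTM : T * M = 0 := hE.proj_mul hM
  have hBM : B * M = 1 - T := hE.pinv_mul hM
  have hMB : M * B = 1 - T := hE.mul_pinv hM
  have hTT : T * T = T := hE.proj_mul_proj
  have hBY : B * Y = 0 := by rw [← hTY, ← Matrix.mul_assoc, hBT, Matrix.zero_mul]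
  have hYB : Y * B = 0 := by rw [← hYT, Matrix.mul_assoc, hTB, Matrix.mul_zero]
  have hTt : Tᵀ = T := by rw [hT, Matrix.transpose_mul, Matrix.transpose_transpose]
  -- Δ is split along the projection `T` onto the null space and 1 - T. Multiplying the equation by
  -- `B` and `T` from the two sides gives the mixed blocks.
  have h12 : (1 - T) * Δ * T = -(B * X * Y) := by
    have h : B * (M * Δ + Δ * M + (Y * X + X * Y)) * T =
        (B * M) * Δ * T + B * Δ * (M * T) + (B * Y) * X * T + B * X * (Y * T) := by noncomm_ring
    rw [hsys, hBM, hMT, hBY, hYT, Matrix.mul_smul, Matrix.mul_one, Matrix.smul_mul, hBT, smul_zero,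
      Matrix.mul_zero, Matrix.zero_mul, Matrix.zero_mul, add_zero, add_zero] at h
    exact eq_neg_of_add_eq_zero_left h.symm
  have h21 : T * Δ * (1 - T) = -(Y * X * B) := by
    have h : T * (M * Δ + Δ * M + (Y * X + X * Y)) * B =
        (T * M) * Δ * B + T * Δ * (M * B) + (T * Y) * X * B + T * X * (Y * B) := by noncomm_ring
    rw [hsys, hTM, hMB, hTY, hYB, Matrix.mul_smul, Matrix.mul_one, Matrix.smul_mul, hTB, smul_zero,
      Matrix.mul_zero, Matrix.zero_mul, Matrix.zero_mul, add_zero, zero_add] at h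
    exact eq_neg_of_add_eq_zero_left h.symm
  -- On the range of `M` both this block and `B` solve the same Lyapunov equation, so their
  -- difference solves the homogeneous one with M + T ≻ 0.
  have h22 : (1 - T) * Δ * (1 - T) = B := by
    set W := (1 - T) * Δ * (1 - T) - B with hW
    have hWt : Wᵀ = W := by
      rw [hW, Matrix.transpose_sub, Matrix.transpose_mul, Matrix.transpose_mul,
        Matrix.transpose_sub, Matrix.transpose_one, hTt, hΔ, hE.transpose_pinv hM,
        Matrix.mul_assoc]
    have h1 : (M + T) * W + W * (M + T) = 0 := by
      have e1 : (M + T) * W = M * Δ * (1 - T) - (1 - T) := by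
        have : (M + T) * W = (M - M * T + (T - T * T)) * Δ * (1 - T) - (M * B + T * B) := by
          rw [hW]; noncomm_ring
        rw [this, hMT, hTT, hMB, hTB, sub_zero, sub_self, add_zero, add_zero]
      have e2 : W * (M + T) = (1 - T) * Δ * M - (1 - T) := by
        have : W * (M + T) = (1 - T) * Δ * (M - T * M + (T - T * T)) - (B * M + B * T) := by
          rw [hW]; noncomm_ring
        rw [this, hTM, hTT, hBM, hBT, sub_zero, sub_self, add_zero, add_zero]
      have e3 : (1 - T) * (M * Δ + Δ * M + (Y * X + X * Y)) * (1 - T) =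
          (M - T * M) * Δ * (1 - T) + (1 - T) * Δ * (M - M * T) +
            (Y - T * Y) * X * (1 - T) + (1 - T) * X * (Y - Y * T) := by noncomm_ring
      have e4 : (1 - T) * (1 - T) = 1 - T := by
        rw [Matrix.mul_sub, Matrix.mul_one, Matrix.sub_mul, Matrix.one_mul, hTT, sub_self, sub_zero]
      rw [hsys, hTM, hMT, hTY, hYT, sub_self, sub_zero, Matrix.zero_mul, Matrix.zero_mul,
        Matrix.mul_zero, add_zero, add_zero, Matrix.mul_smul, Matrix.mul_one, Matrix.smul_mul, e4,
        two_smul] at e3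
      rw [e1, e2, sub_add_sub_comm, ← e3, sub_self]
    have := (hE.posDef_add hM).lyapunov_eq_zero hWt h1
    rwa [hW, sub_eq_zero] at this
  have hdec : Δ = T * Δ * T - B * X * Y - Y * X * B + B := by
    calc Δ = T * Δ * T + (1 - T) * Δ * T + T * Δ * (1 - T) + (1 - T) * Δ * (1 - T) := by
          noncomm_ring
      _ = _ := by rw [h12, h21, h22]; abel
  -- The block on the null space is not determined by the system, but a flat `D` does not see it.
  have h11 : (D * (T * Δ * T)).trace = 0 := by
    calc (D * (T * Δ * T)).trace = (Eᵀ * D * E * (Eᵀ * Δ * E)).trace := by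
          rw [hT, Matrix.mul_assoc Eᵀ D E, Matrix.mul_assoc Eᵀ, Matrix.trace_mul_comm Eᵀ]
          simp only [Matrix.mul_assoc]
      _ = 0 := by rw [hD, Matrix.zero_mul, Matrix.trace_zero]
  have hBXY : (D * (B * X * Y)).trace = (Y * (D * B * X)).trace := by
    rw [Matrix.trace_mul_comm Y]
    simp only [Matrix.mul_assoc]
  have hYXB : (D * (Y * X * B)).trace = (Y * (X * B * D)).trace := by
    rw [Matrix.trace_mul_comm D]
    simp only [Matrix.mul_assoc]
  rw [hdec, Matrix.mul_add, Matrix.mul_sub, Matrix.mul_sub, Matrix.trace_add, Matrix.trace_sub,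
    Matrix.trace_sub, h11, hBXY, hYXB, Matrix.trace_mul_comm D]
  ring

/-- A solution of the linearized symmetrized complementarity system. -/
theorem linearized_of_mul_eq_one (hE : IsOrthonormalKernelBasis M E) (hM : M.PosSemidef)
    {Y₁ : Matrix (Fin k) (Fin k) ℝ} {X : Matrix (Fin m) (Fin m) ℝ}
    (h : Y₁ * (Eᵀ * X * E) = 1) :
    M * (pinv M - pinv M * X * (E * Y₁ * Eᵀ) - E * Y₁ * Eᵀ * X * pinv M) +
      (pinv M - pinv M * X * (E * Y₁ * Eᵀ) - E * Y₁ * Eᵀ * X * pinv M) * M +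
      (E * Y₁ * Eᵀ * X + X * (E * Y₁ * Eᵀ)) = (2 : ℝ) • (1 : Matrix (Fin m) (Fin m) ℝ) := by
  set Y := E * Y₁ * Eᵀ with hY
  set T := E * Eᵀ with hT
  set B := pinv M with hB
  have hMY : M * Y = 0 := by
    rw [hY, ← Matrix.mul_assoc, ← Matrix.mul_assoc, hE.mul_eq_zero, Matrix.zero_mul,
      Matrix.zero_mul]
  have hYM : Y * M = 0 := by
    rw [hY, Matrix.mul_assoc, hE.transpose_mul_eq_zero hM.transpose_eq, Matrix.mul_zero]
  have hBM : B * M = 1 - T := hE.pinv_mul hM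
  have hMB : M * B = 1 - T := hE.mul_pinv hM
  have hTXY : T * X * Y = T := by
    calc T * X * Y = E * ((Eᵀ * X * E) * Y₁) * Eᵀ := by
          rw [hT, hY]; simp only [Matrix.mul_assoc]
      _ = T := by rw [mul_eq_one_comm.mp h, Matrix.mul_one]
  have hYXT : Y * X * T = T := by
    calc Y * X * T = E * (Y₁ * (Eᵀ * X * E)) * Eᵀ := by
          rw [hT, hY]; simp only [Matrix.mul_assoc]
      _ = T := by rw [h, Matrix.mul_one]
  have e1 : M * (B - B * X * Y - Y * X * B) + (B - B * X * Y - Y * X * B) * M + (Y * X + X * Y) =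
      M * B - (M * B) * X * Y - (M * Y) * X * B + (B * M - B * X * (Y * M) - Y * X * (B * M)) +
        (Y * X + X * Y) := by noncomm_ring
  have e2 : (1 - T) * X * Y = X * Y - T := by
    rw [Matrix.sub_mul, Matrix.sub_mul, Matrix.one_mul, hTXY]
  have e3 : Y * X * (1 - T) = Y * X - T := by rw [Matrix.mul_sub, Matrix.mul_one, hYXT]
  rw [e1, hMB, hBM, hMY, hYM, e2, e3, Matrix.zero_mul, Matrix.zero_mul, Matrix.mul_zero, sub_zero,
    sub_zero, two_smul]
  abel

end IsOrthonormalKernelBasis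

/-! ### Transfer between the original problem and the reduced one. -/

section

open scoped Matrix.Norms.Operator

namespace NSDP

theorem negLogDet_le_negLogDet {k : ℕ} {A B : Matrix (Fin k) (Fin k) ℝ} (h : B.det ≤ A.det) :
    negLogDet A ≤ negLogDet B :=
  EReal.neg_le_neg_iff.mpr (ENNReal.log_le_log_iff.mpr (ENNReal.ofReal_le_ofReal h))

theorem det_pos_of_negLogDet_le {k : ℕ} {A B : Matrix (Fin k) (Fin k) ℝ}
    (h : negLogDet A ≤ negLogDet B) (hB : 0 < B.det) : 0 < A.det := by
  have h1 := ENNReal.log_le_log_iff.mp (EReal.neg_le_neg_iff.mp h)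
  exact ENNReal.ofReal_pos.mp ((ENNReal.ofReal_pos.mpr hB).trans_le h1)

namespace IsChart

variable {n m s k : ℕ} {P : NSDP n m s}
  {Ψ : EuclideanSpace ℝ (Fin (n - s)) → EuclideanSpace ℝ (Fin n)}
  {E : Matrix (Fin m) (Fin k) ℝ}

/-- The problem in the coordinates of the chart. -/
noncomputable def reduced (hΨ : P.IsChart (Ψ 0) Ψ) (hG : (P.G (Ψ 0)).PosSemidef)
    (hE : IsOrthonormalKernelBasis (P.G (Ψ 0)) E) :
    ReducedProblem (EuclideanSpace ℝ (Fin (n - s))) m k where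
  f := P.f ∘ Ψ
  g := P.G ∘ Ψ
  E := E
  symm _ := P.symm_G _
  contDiffAt_f := P.contDiff_f.contDiffAt.comp 0 hΨ.contDiffAt
  contDiffAt_g := P.contDiff_matrix.contDiffAt.comp 0 hΨ.contDiffAt
  posSemidef := hG
  basis := hE

variable (hΨ : P.IsChart (Ψ 0) Ψ) (hG : (P.G (Ψ 0)).PosSemidef)
  (hE : IsOrthonormalKernelBasis (P.G (Ψ 0)) E)

theorem fderiv_reduced_f {v : EuclideanSpace ℝ (Fin (n - s))} (hv : HasFDerivAt Ψ (fderiv ℝ Ψ v) v)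
    (b : EuclideanSpace ℝ (Fin (n - s))) :
    fderiv ℝ (hΨ.reduced hG hE).f v b = fderiv ℝ P.f (Ψ v) (fderiv ℝ Ψ v b) :=
  DFunLike.congr_fun ((P.contDiff_f.differentiable (by simp) (Ψ v)).hasFDerivAt.comp v hv).fderiv b

theorem fderiv_reduced_g {v : EuclideanSpace ℝ (Fin (n - s))} (hv : HasFDerivAt Ψ (fderiv ℝ Ψ v) v)
    (b : EuclideanSpace ℝ (Fin (n - s))) :
    fderiv ℝ (hΨ.reduced hG hE).g v b = P.dG (Ψ v) (fderiv ℝ Ψ v b) := by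
  rw [← fderiv_G_apply]
  exact DFunLike.congr_fun ((P.hasFDerivAt_G (Ψ v)).comp v hv).fderiv b

theorem hasFDerivAt_zero (hΨ : P.IsChart (Ψ 0) Ψ) : HasFDerivAt Ψ (fderiv ℝ Ψ 0) 0 :=
  hΨ.eventually_hasFDerivAt.self_of_nhds

/-- G Y = μ I forces Y = μ G⁻¹, and testing ∇L = 0 on the tangent space, which is the range of the
derivative of the chart, eliminates `z`. -/
theorem eventually_isBKKTPoint_iff : ∀ᶠ v in 𝓝 0, ∀ μ, 0 < μ →
    (P.IsBKKTPoint μ (Ψ v) ↔ (hΨ.reduced hG hE).toVertexBarrier.IsCritical μ v) := by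
  filter_upwards [(hΨ.reduced hG hE).eventually_isCritical_iff, hΨ.eventually_hasFDerivAt,
    hΨ.eventually_range, hΨ.h_eq_zero] with v hcrit hd hrange hh μ hμ
  rw [hcrit μ]
  have hpair : ∀ b, ((P.G (Ψ v))⁻¹ * fderiv ℝ (hΨ.reduced hG hE).g v b).trace =
      ((P.G (Ψ v))⁻¹ * P.dG (Ψ v) (fderiv ℝ Ψ v b)).trace := fun b => by
    rw [hΨ.fderiv_reduced_g hG hE hd]
  constructor
  · rintro ⟨Y, z, hL, hGY, hGp, hYp, -⟩
    refine ⟨hGp, fun b => ?_⟩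
    have hu := isUnit_iff_ne_zero.mpr hGp.det_pos.ne'
    have hY : Y = μ • (P.G (Ψ v))⁻¹ := by
      rw [← Matrix.nonsing_inv_mul_cancel_left _ Y hu, hGY, Matrix.mul_smul, Matrix.mul_one]
    have h1 := P.inner_gradL (Ψ v) (fderiv ℝ Ψ v b) Y z
    have h2 := (hrange (fderiv ℝ Ψ v b)).mpr ⟨b, rfl⟩
    rw [hL, inner_zero_left, Finset.sum_eq_zero fun i _ => by rw [h2 i, zero_mul], add_zero, hY,
      Matrix.smul_mul, Matrix.trace_smul, smul_eq_mul] at h1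
    rw [hΨ.fderiv_reduced_f hG hE hd]
    change _ = μ * ((P.G (Ψ v))⁻¹ * fderiv ℝ (hΨ.reduced hG hE).g v b).trace
    rw [hpair]
    linarith
  · rintro ⟨hGp, hst⟩
    have hGp' : (P.G (Ψ v)).PosDef := hGp
    obtain ⟨z, hz⟩ := P.exists_gradL_eq_zero (x := Ψ v) (Y := μ • (P.G (Ψ v))⁻¹) (by
      intro d hd'
      obtain ⟨b, rfl⟩ := (hrange d).mp hd'
      have h1 := hst b
      rw [hΨ.fderiv_reduced_f hG hE hd] at h1
      change _ = μ * ((P.G (Ψ v))⁻¹ * fderiv ℝ (hΨ.reduced hG hE).g v b).trace at h1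
      rw [h1, hpair, Matrix.smul_mul, Matrix.trace_smul, smul_eq_mul])
    refine ⟨_, z, hz, ?_, hGp', hGp'.inv.smul hμ, hh⟩
    rw [Matrix.mul_smul, Matrix.mul_nonsing_inv _ (isUnit_iff_ne_zero.mpr hGp'.det_pos.ne')]

include hΨ hG in
-- Complementarity of positive semidefinite matrices gives G Y = 0, so a multiplier is supported on
-- the null space and is recovered from its compression by `E`.
theorem multipliers_eq {p : Matrix (Fin m) (Fin m) ℝ × EuclideanSpace ℝ (Fin s)}
    (hE : IsOrthonormalKernelBasis (P.G (Ψ 0)) E) (hp : p ∈ P.multipliers (Ψ 0)) :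
    E * (Eᵀ * p.1 * E) * Eᵀ = p.1 := by
  obtain ⟨-, htr, -, hY, -⟩ := hp
  have h1 := hE.proj_mul_of_mul_eq_zero (hG.mul_eq_zero_of_trace_eq_zero hY htr)
  have h2 := congrArg Matrix.transpose h1
  rw [Matrix.transpose_mul, Matrix.transpose_mul, Matrix.transpose_transpose, hY.transpose_eq] at h2
  calc E * (Eᵀ * p.1 * E) * Eᵀ = (E * Eᵀ * p.1) * (E * Eᵀ) := by simp only [Matrix.mul_assoc]
    _ = p.1 := by rw [h1, h2]

theorem mem_multipliers_reduced {p : Matrix (Fin m) (Fin m) ℝ × EuclideanSpace ℝ (Fin s)}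
    (hp : p ∈ P.multipliers (Ψ 0)) :
    Eᵀ * p.1 * E ∈ (hΨ.reduced hG hE).toVertexBarrier.multipliers := by
  rw [ReducedProblem.mem_multipliers_iff]
  refine ⟨hp.2.2.2.1.transpose_mul_mul E, fun b => ?_⟩
  change _ = (E * (Eᵀ * p.1 * E) * Eᵀ * _).trace
  rw [multipliers_eq hΨ hG hE hp, hΨ.fderiv_reduced_f hG hE hΨ.hasFDerivAt_zero,
    hΨ.fderiv_reduced_g hG hE hΨ.hasFDerivAt_zero]
  have h1 := P.inner_gradL (Ψ 0) (fderiv ℝ Ψ 0 b) p.1 p.2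
  have h2 := (hΨ.eventually_range.self_of_nhds (fderiv ℝ Ψ 0 b)).mpr ⟨b, rfl⟩
  rw [hp.1, inner_zero_left, Finset.sum_eq_zero fun i _ => by rw [h2 i, zero_mul], add_zero] at h1
  linarith

/-- Together with `mem_multipliers_reduced`, this makes compression by `E` a map of Λ(x*) onto the
reduced multipliers. -/
theorem exists_mem_multipliers {Y : Matrix (Fin k) (Fin k) ℝ}
    (hY : Y ∈ (hΨ.reduced hG hE).toVertexBarrier.multipliers) :
    ∃ z, (E * Y * Eᵀ, z) ∈ P.multipliers (Ψ 0) := by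
  rw [ReducedProblem.mem_multipliers_iff] at hY
  obtain ⟨z, hz⟩ := P.exists_gradL_eq_zero (x := Ψ 0) (Y := E * Y * Eᵀ) (by
    intro d hd
    obtain ⟨b, rfl⟩ := (hΨ.eventually_range.self_of_nhds d).mp hd
    have h1 := hY.2 b
    rwa [hΨ.fderiv_reduced_f hG hE hΨ.hasFDerivAt_zero,
      hΨ.fderiv_reduced_g hG hE hΨ.hasFDerivAt_zero] at h1)
  refine ⟨z, hz, ?_, hG, hY.1.mul_mul_transpose E, hΨ.h_eq_zero.self_of_nhds⟩
  rw [← Matrix.mul_assoc, ← Matrix.mul_assoc, hE.mul_eq_zero, Matrix.zero_mul, Matrix.zero_mul,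
    Matrix.trace_zero]

/-- On h = 0 the Lagrangian is f - tr (Y G), and since its gradient vanishes at x*, the curvature of
the chart does not enter. -/
theorem hessian_reduced {Y : Matrix (Fin m) (Fin m) ℝ} {z : EuclideanSpace ℝ (Fin s)}
    (hL : P.gradL (Ψ 0) Y z = 0) (a b : EuclideanSpace ℝ (Fin (n - s))) :
    fderiv ℝ (fderiv ℝ (hΨ.reduced hG hE).f) 0 a b -
      (Y * fderiv ℝ (fderiv ℝ (hΨ.reduced hG hE).g) 0 a b).trace =
      inner ℝ (fderiv ℝ Ψ 0 b) (P.hessL (Ψ 0) Y z (fderiv ℝ Ψ 0 a)) := by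
  set R := hΨ.reduced hG hE
  have hL0 : fderiv ℝ (fun y => P.lagrangian y Y z) (Ψ 0) = 0 := by
    ext d
    rw [← inner_gradient_eq_fderiv]
    change inner ℝ (P.gradL (Ψ 0) Y z) d = 0
    rw [hL, inner_zero_left]
  have hLc := (P.contDiff_lagrangian Y z).contDiffAt (x := Ψ 0)
  rw [inner_hessL, ← fderiv_fderiv_comp_of_fderiv_eq_zero hLc hΨ.contDiffAt hL0]
  have h1 : ∀ᶠ v in 𝓝 0, ((fun y => P.lagrangian y Y z) ∘ Ψ) v =
      R.f v - Y.tracePairing (R.g v) := by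
    filter_upwards [hΨ.h_eq_zero] with v hv
    rw [Matrix.tracePairing_apply, Matrix.trace_mul_comm]
    change P.lagrangian (Ψ v) Y z = P.f (Ψ v) - (P.G (Ψ v) * Y).trace
    rw [lagrangian, hv]
    simp
  have h2 : ∀ᶠ v in 𝓝 0, fderiv ℝ ((fun y => P.lagrangian y Y z) ∘ Ψ) v b =
      fderiv ℝ R.f v b - Y.tracePairing (fderiv ℝ R.g v b) := by
    filter_upwards [h1.eventually_nhds, R.contDiffAt_f.eventually_hasFDerivAt_fderiv,
      R.eventually_hasFDerivAt_g] with v hv1 hv2 hv3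
    have h3 := (hv2.sub ((Y.tracePairing.hasFDerivAt).comp v hv3)).congr_of_eventuallyEq
      (f₁ := (fun y => P.lagrangian y Y z) ∘ Ψ) hv1
    exact DFunLike.congr_fun h3.fderiv b
  have h4 := (ContinuousLinearMap.apply ℝ ℝ b).hasFDerivAt.comp 0
    (hLc.comp 0 hΨ.contDiffAt).hasStrictFDerivAt_fderiv.hasFDerivAt
  have h5 := (ContinuousLinearMap.apply ℝ ℝ b).hasFDerivAt.comp 0
    R.contDiffAt_f.hasStrictFDerivAt_fderiv.hasFDerivAt
  have h6 := Y.tracePairing.hasFDerivAt.comp 0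
    ((ContinuousLinearMap.apply ℝ (Matrix (Fin m) (Fin m) ℝ) b).hasFDerivAt.comp 0
      R.contDiffAt_g.hasStrictFDerivAt_fderiv.hasFDerivAt)
  have h7 := (h5.sub h6).congr_of_eventuallyEq
    (f₁ := fun v => fderiv ℝ ((fun y => P.lagrangian y Y z) ∘ Ψ) v b) h2
  exact (DFunLike.congr_fun (h4.unique h7) a).symm

theorem fderiv_S_eq (b : EuclideanSpace ℝ (Fin (n - s))) :
    fderiv ℝ (hΨ.reduced hG hE).toVertexBarrier.S 0 b =
      Eᵀ * P.dG (Ψ 0) (fderiv ℝ Ψ 0 b) * E := by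
  rw [ReducedProblem.fderiv_S_zero, hΨ.fderiv_reduced_g hG hE hΨ.hasFDerivAt_zero]
  rfl

/-- The reduced Hessian along directions of which one is flat. -/
theorem hess_reduced {Y : Matrix (Fin k) (Fin k) ℝ} {z : EuclideanSpace ℝ (Fin s)}
    (hL : P.gradL (Ψ 0) (E * Y * Eᵀ) z = 0) {a b : EuclideanSpace ℝ (Fin (n - s))}
    (hb : fderiv ℝ (hΨ.reduced hG hE).toVertexBarrier.S 0 b = 0) :
    (hΨ.reduced hG hE).toVertexBarrier.hess Y a b =
      inner ℝ (fderiv ℝ Ψ 0 b) (P.hessL (Ψ 0) (E * Y * Eᵀ) z (fderiv ℝ Ψ 0 a)) +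
        (E * Y * Eᵀ * (P.dG (Ψ 0) (fderiv ℝ Ψ 0 a) * pinv (P.G (Ψ 0)) *
          P.dG (Ψ 0) (fderiv ℝ Ψ 0 b))).trace +
        (E * Y * Eᵀ * (P.dG (Ψ 0) (fderiv ℝ Ψ 0 b) * pinv (P.G (Ψ 0)) *
          P.dG (Ψ 0) (fderiv ℝ Ψ 0 a))).trace := by
  rw [ReducedProblem.hess_eq_pinv _ Y hb, hΨ.fderiv_reduced_g hG hE hΨ.hasFDerivAt_zero,
    hΨ.fderiv_reduced_g hG hE hΨ.hasFDerivAt_zero, ← hessian_reduced hΨ hG hE hL]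
  rfl

/-- Compression by `E` annihilates G(x*) and keeps definiteness, which transfers the first two
conditions. A direction in the kernel of S'(0) is mapped into the critical cone, and there the
reduced Hessian is that of the Lagrangian plus the sigma term. -/
theorem regular_reduced (hSC : P.StrictComplementarity (Ψ 0)) (hSSOSC : P.SSOSC (Ψ 0) E)
    (hMFCQ : P.MFCQ (Ψ 0)) : (hΨ.reduced hG hE).toVertexBarrier.Regular where
  strict := by
    obtain ⟨p, hp, hpd⟩ := hSC
    refine ⟨_, mem_multipliers_reduced hΨ hG hE hp, ?_⟩
    have h := hpd.conjTranspose_mul_mul_same hE.injective_mulVec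
    rwa [conjTranspose_eq_transpose_of_trivial, Matrix.mul_add, Matrix.add_mul, Matrix.mul_assoc,
      hE.mul_eq_zero, Matrix.mul_zero, zero_add] at h
  mfcq := by
    obtain ⟨-, d, hd, hdh⟩ := hMFCQ
    obtain ⟨w, rfl⟩ := (hΨ.eventually_range.self_of_nhds d).mp hdh
    refine ⟨w, ?_⟩
    rw [fderiv_S_eq]
    have h := hd.conjTranspose_mul_mul_same hE.injective_mulVec
    rwa [conjTranspose_eq_transpose_of_trivial, Matrix.mul_add, Matrix.add_mul, Matrix.mul_assoc,
      hE.mul_eq_zero, Matrix.mul_zero, zero_add] at h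
  ssosc := by
    intro Y hY w hw hS
    obtain ⟨z, hz⟩ := exists_mem_multipliers hΨ hG hE hY
    have hfd : fderiv ℝ (hΨ.reduced hG hE).f 0 w = 0 := by
      have h1 := hY.2 w
      rwa [hS, Matrix.mul_zero, Matrix.trace_zero] at h1
    rw [hΨ.fderiv_reduced_f hG hE hΨ.hasFDerivAt_zero] at hfd
    have hS' := hS
    rw [fderiv_S_eq] at hS'
    have h2 := hSSOSC _ hz (fderiv ℝ Ψ 0 w) ⟨by rw [inner_gradient_eq_fderiv, hfd],
      (hΨ.eventually_range.self_of_nhds _).mpr ⟨w, rfl⟩, by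
        rw [hS']; exact Matrix.PosSemidef.zero⟩ (by
        intro h
        exact hw (hΨ.injective.self_of_nhds (h.trans (_root_.map_zero _).symm)))
    rw [dotProduct_sigmaMatrix] at h2
    rw [hess_reduced hΨ hG hE hz.1 hS]
    linarith

/-- The equation Y S'(0) w = 1 makes Y maximize the determinant, so E Y Eᵀ is an analytic center. An
explicit ΔY built from G(x*)† solves the matrix equation, and the orthogonality relation is the
kernel equation of `IsDirection`. -/
theorem isPathDirection_of_isDirection {w : EuclideanSpace ℝ (Fin (n - s))}
    (hw : (hΨ.reduced hG hE).toVertexBarrier.IsDirection w) :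
    P.IsPathDirection (Ψ 0) E (fderiv ℝ Ψ 0 w) := by
  obtain ⟨Y, hY, hYw, hYu⟩ := hw
  obtain ⟨z, hz⟩ := exists_mem_multipliers hΨ hG hE hY
  have hYp := VertexBarrier.IsDirection.posDef hY hYw
  have hcomp : Eᵀ * (E * Y * Eᵀ) * E = Y := by
    calc Eᵀ * (E * Y * Eᵀ) * E = (Eᵀ * E) * Y * (Eᵀ * E) := by simp only [Matrix.mul_assoc]
      _ = Y := by rw [hE.1, Matrix.one_mul, Matrix.mul_one]
  have hYX := hYw
  rw [fderiv_S_eq] at hYX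
  have hsys := hE.linearized_of_mul_eq_one hG hYX
  set X := P.dG (Ψ 0) (fderiv ℝ Ψ 0 w) with hX
  set Δ := pinv (P.G (Ψ 0)) - pinv (P.G (Ψ 0)) * X * (E * Y * Eᵀ) -
    E * Y * Eᵀ * X * pinv (P.G (Ψ 0)) with hΔ
  have hΔt : Δᵀ = Δ := by
    rw [hΔ]
    simp only [Matrix.transpose_sub, Matrix.transpose_mul, hE.transpose_pinv hG,
      Matrix.transpose_transpose, hYp.posSemidef.transpose_eq, hX, transpose_dG, Matrix.mul_assoc]
    abel
  refine ⟨E * Y * Eᵀ, z, Δ, ⟨hz, fun q hq => ?_⟩, hΔt, fun d hd => ?_, hsys,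
    (hΨ.eventually_range.self_of_nhds _).mpr ⟨w, rfl⟩⟩
  · refine negLogDet_le_negLogDet ?_
    have hq' := mem_multipliers_reduced hΨ hG hE hq
    change (Eᵀ * q.1 * E).det ≤ (Eᵀ * (E * Y * Eᵀ) * E).det
    rw [hcomp]
    refine (hYp.det_le_of_trace_eq hYw hq'.1 ?_).1
    rw [← hq'.2, hY.2, hYw, Matrix.trace_one]
  · obtain ⟨u, rfl⟩ := (hΨ.eventually_range.self_of_nhds d).mp hd.2
    have hu : fderiv ℝ (hΨ.reduced hG hE).toVertexBarrier.S 0 u = 0 := by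
      rw [fderiv_S_eq]; exact hd.1
    have h1 := hYu u hu
    rw [hess_reduced hΨ hG hE hz.1 hu, ReducedProblem.fderiv_φ_eq_pinv _ hu,
      hΨ.fderiv_reduced_g hG hE hΨ.hasFDerivAt_zero] at h1
    rw [inner_sub_right, inner_adjG, hE.trace_mul_of_linearized hG hΔt hsys hd.1]
    change _ + _ + _ + -(pinv (P.G (Ψ 0)) * _).trace = _ at h1
    linarith

/-- The compression of an analytic center is positive definite, since a strictly complementary
multiplier has a finite value. Compressing the matrix equation by `E` leaves a Lyapunov equation for
Eᵀ ΔG(ξ) E, whose only symmetric solution is the inverse of that compression. -/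
theorem exists_isDirection_of_isPathDirection
    (hB : (hΨ.reduced hG hE).toVertexBarrier.Regular) {ξ : EuclideanSpace ℝ (Fin n)}
    (hξ : P.IsPathDirection (Ψ 0) E ξ) :
    ∃ w, (hΨ.reduced hG hE).toVertexBarrier.IsDirection w ∧ fderiv ℝ Ψ 0 w = ξ := by
  obtain ⟨Y, z, Δ, ⟨hYz, hmin⟩, hΔ, horth, hsys, hξh⟩ := hξ
  obtain ⟨w, rfl⟩ := (hΨ.eventually_range.self_of_nhds ξ).mp hξh
  have hY₁ := mem_multipliers_reduced hΨ hG hE hYz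
  have hYeq := multipliers_eq hΨ hG hE hYz
  set Y₁ := Eᵀ * Y * E with hY₁def
  obtain ⟨Q, hQ, hQp⟩ := hB.strict
  obtain ⟨zQ, hzQ⟩ := exists_mem_multipliers hΨ hG hE hQ
  have hY₁p : Y₁.PosDef := by
    rw [hY₁.1.posDef_iff_det_ne_zero]
    refine (det_pos_of_negLogDet_le (hmin _ hzQ) ?_).ne'
    have : Eᵀ * (E * Q * Eᵀ) * E = Q := by
      calc Eᵀ * (E * Q * Eᵀ) * E = (Eᵀ * E) * Q * (Eᵀ * E) := by simp only [Matrix.mul_assoc]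
        _ = Q := by rw [hE.1, Matrix.one_mul, Matrix.mul_one]
    change 0 < (Eᵀ * (E * Q * Eᵀ) * E).det
    rw [this]
    exact hQp.det_pos
  change E * Y₁ * Eᵀ = Y at hYeq
  rw [← hYeq] at hsys
  set X := P.dG (Ψ 0) (fderiv ℝ Ψ 0 w) with hX
  have hu := isUnit_iff_ne_zero.mpr hY₁p.det_pos.ne'
  have hA : Eᵀ * X * E = Y₁⁻¹ := by
    have h1 : Y₁ * (Eᵀ * X * E) + Eᵀ * X * E * Y₁ = (2 : ℝ) • 1 := by
      have h2 := congrArg (fun Z => Eᵀ * Z * E) hsys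
      have h3 : Eᵀ * (P.G (Ψ 0) * Δ + Δ * P.G (Ψ 0) +
          (E * Y₁ * Eᵀ * X + X * (E * Y₁ * Eᵀ))) * E =
          (Eᵀ * P.G (Ψ 0)) * Δ * E + Eᵀ * Δ * (P.G (Ψ 0) * E) +
            ((Eᵀ * E) * (Y₁ * (Eᵀ * X * E)) + Eᵀ * X * E * Y₁ * (Eᵀ * E)) := by
        simp only [Matrix.mul_add, Matrix.add_mul, Matrix.mul_assoc]
      beta_reduce at h2
      rw [h3, hE.1, hE.mul_eq_zero, hE.transpose_mul_eq_zero hG.transpose_eq, Matrix.mul_zero,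
        Matrix.zero_mul, Matrix.zero_mul, add_zero, zero_add, Matrix.one_mul, Matrix.mul_one,
        Matrix.mul_smul, Matrix.mul_one, Matrix.smul_mul, hE.1] at h2
      exact h2
    rw [← sub_eq_zero]
    refine hY₁p.lyapunov_eq_zero ?_ ?_
    · rw [Matrix.transpose_sub, Matrix.transpose_mul, Matrix.transpose_mul,
        Matrix.transpose_transpose, hY₁p.inv.posSemidef.transpose_eq, hX, transpose_dG,
        Matrix.mul_assoc]
    · rw [Matrix.mul_sub, Matrix.sub_mul, Matrix.mul_nonsing_inv _ hu, Matrix.nonsing_inv_mul _ hu,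
        sub_add_sub_comm, h1, two_smul, sub_self]
  refine ⟨w, ⟨Y₁, hY₁, ?_, fun u hu => ?_⟩, rfl⟩
  · rw [fderiv_S_eq, ← hX, hA, Matrix.mul_nonsing_inv _ hu]
  · have hflat : Eᵀ * P.dG (Ψ 0) (fderiv ℝ Ψ 0 u) * E = 0 := by
      rw [← fderiv_S_eq hΨ hG hE]; exact hu
    have h1 := horth (fderiv ℝ Ψ 0 u)
      ⟨hflat, (hΨ.eventually_range.self_of_nhds _).mpr ⟨u, rfl⟩⟩
    rw [inner_sub_right, inner_adjG, hE.trace_mul_of_linearized hG hΔ hsys hflat] at h1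
    have hL : P.gradL (Ψ 0) (E * Y₁ * Eᵀ) z = 0 := by rw [hYeq]; exact hYz.1
    rw [hess_reduced hΨ hG hE hL hu, ReducedProblem.fderiv_φ_eq_pinv _ hu,
      hΨ.fderiv_reduced_g hG hE hΨ.hasFDerivAt_zero]
    change _ + _ + _ + -(pinv (P.G (Ψ 0)) * _).trace = _
    rw [hYeq] at h1 ⊢
    linarith

end IsChart

end NSDP

end

/-! ### The central path in the given parametrization and the main theorem. -/

section

open scoped Matrix.Norms.Operator

namespace NSDP

variable {n m s k : ℕ} {P : NSDP n m s}

namespace IsChart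

variable {Ψ : EuclideanSpace ℝ (Fin (n - s)) → EuclideanSpace ℝ (Fin n)}
  {E : Matrix (Fin m) (Fin k) ℝ} (hΨ : P.IsChart (Ψ 0) Ψ) (hG : (P.G (Ψ 0)).PosSemidef)
  (hE : IsOrthonormalKernelBasis (P.G (Ψ 0)) E)

/-- If the base point is not a barrier critical point, the direction of the path is nonzero. -/
theorem isDirection_ne_zero (hne : ∀ μ : ℝ, 0 < μ → ¬ P.IsBKKTPoint μ (Ψ 0))
    {w : EuclideanSpace ℝ (Fin (n - s))}
    (hw : (hΨ.reduced hG hE).toVertexBarrier.IsDirection w) : w ≠ 0 := by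
  rintro rfl
  obtain ⟨Y, hY, hYw, hYu⟩ := hw
  rw [_root_.map_zero, Matrix.mul_zero] at hYw
  -- For w = 0 the first equation reads 0 = 1 in size `k`, so k = 0. The kernel equation then holds
  -- in all directions and says that 0 is critical for the parameter 1.
  have hk : IsEmpty (Fin k) := by
    refine ⟨fun i => ?_⟩
    simpa using congrFun (congrFun hYw i) i
  refine hne 1 one_pos (((hΨ.eventually_isBKKTPoint_iff hG hE).self_of_nhds 1 one_pos).mpr ?_)
  refine ⟨?_, fun b => ?_⟩
  · rw [Subsingleton.elim ((hΨ.reduced hG hE).toVertexBarrier.S 0) 1]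
    exact Matrix.PosDef.one
  · have h1 := hYu b (Subsingleton.elim _ _)
    have h2 := hY.2 b
    rw [VertexBarrier.hess, _root_.map_zero, _root_.zero_apply, _root_.map_zero] at h1
    rw [VertexBarrier.grad, h2]
    simp only [Matrix.trace, Finset.univ_eq_empty, Finset.sum_empty, _root_.zero_apply] at h1 ⊢
    linarith

/-- Points close to the ray of direction `w` are mapped close to the ray in the image direction. -/
theorem exists_mem_pathBall (hΨ : P.IsChart (Ψ 0) Ψ) {w : EuclideanSpace ℝ (Fin (n - s))}
    (hw : w ≠ 0) {ρ : ℝ} (hρ : 0 < ρ) : ∃ ε > 0, ∃ η > 0, ∀ μ, 0 < μ → ∀ v, ‖v‖ < η →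
      ‖v - μ • w‖ < ε * μ → Ψ v ∈ pathBall (Ψ 0) (fderiv ℝ Ψ 0 w) ρ μ := by
  set J := fderiv ℝ Ψ 0
  have hξ : 0 < ‖J w‖ := norm_pos_iff.mpr fun h =>
    hw (hΨ.injective.self_of_nhds (h.trans (_root_.map_zero _).symm))
  set a := ρ * ‖J w‖ with ha
  have ha0 : 0 < a := mul_pos hρ hξ
  -- `ε` controls the linear error and `c` below the first-order Taylor remainder, each by half of
  -- the radius ρ μ ‖J w‖.
  set ε := a / (2 * (‖J‖ + 1)) with hε
  have hJ : 0 < ‖J‖ + 1 := by positivity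
  have hε0 : 0 < ε := by positivity
  set c := a / (2 * (‖w‖ + ε)) with hc
  have hwε : 0 < ‖w‖ + ε := by positivity
  have hc0 : 0 < c := by positivity
  have h1 := hΨ.hasFDerivAt_zero.isLittleO.def hc0
  obtain ⟨η, hη, hball⟩ := Metric.eventually_nhds_iff.mp h1
  refine ⟨ε, hε0, η, hη, fun μ hμ v hv hvw => ?_⟩
  have h2 := hball (y := v) (by simpa using hv)
  simp only [sub_zero] at h2
  have hvn : ‖v‖ ≤ (‖w‖ + ε) * μ := by
    calc ‖v‖ = ‖(v - μ • w) + μ • w‖ := by rw [sub_add_cancel]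
      _ ≤ ‖v - μ • w‖ + ‖μ • w‖ := norm_add_le _ _
      _ ≤ ε * μ + μ * ‖w‖ := by
        rw [norm_smul, Real.norm_of_nonneg hμ.le]
        linarith
      _ = _ := by ring
  have h3 : ‖Ψ v - Ψ 0 - J v‖ ≤ a / 2 * μ := by
    calc _ ≤ c * ‖v‖ := h2
      _ ≤ c * ((‖w‖ + ε) * μ) := by gcongr
      _ = a / 2 * μ := by rw [hc]; field_simp
  have h4 : ‖J (v - μ • w)‖ < a / 2 * μ := by
    calc _ ≤ ‖J‖ * ‖v - μ • w‖ := J.le_opNorm _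
      _ ≤ ‖J‖ * (ε * μ) := by gcongr
      _ < (‖J‖ + 1) * (ε * μ) := by
        have : 0 < ε * μ := by positivity
        gcongr
        linarith
      _ = a / 2 * μ := by rw [hε]; field_simp
  show ‖Ψ 0 + μ • J w - Ψ v‖ < ρ * μ * ‖J w‖
  have h5 : Ψ 0 + μ • J w - Ψ v = -((Ψ v - Ψ 0 - J v) + J (v - μ • w)) := by
    rw [map_sub, map_smul]
    abel
  rw [h5, norm_neg]
  calc _ ≤ ‖Ψ v - Ψ 0 - J v‖ + ‖J (v - μ • w)‖ := norm_add_le _ _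
    _ < a / 2 * μ + a / 2 * μ := by linarith
    _ = ρ * μ * ‖J w‖ := by rw [ha]; ring

include hΨ hG hE in
/-- The central path in a chart. -/
theorem exists_centralPath (hSC : P.StrictComplementarity (Ψ 0)) (hSSOSC : P.SSOSC (Ψ 0) E)
    (hMFCQ : P.MFCQ (Ψ 0)) (hne : ∀ μ : ℝ, 0 < μ → ¬ P.IsBKKTPoint μ (Ψ 0)) :
    ∃ ξ, (P.IsPathDirection (Ψ 0) E ξ ∧ ∀ η, P.IsPathDirection (Ψ 0) E η → η = ξ) ∧
      ∀ ρ > 0, ∃ η₀ > 0, ∀ η, 0 < η → η ≤ η₀ → ∃ δ > 0, ∀ μ, 0 < μ → μ < δ → ∃ v, ‖v‖ < η ∧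
        Ψ v ∈ pathBall (Ψ 0) ξ ρ μ ∧ P.IsBKKTPoint μ (Ψ v) ∧
        (∀ u, ‖u‖ < η → P.IsBKKTPoint μ (Ψ u) → u = v) ∧
        ∀ᶠ u in 𝓝 v, (P.G (Ψ u)).PosDef → u ≠ v →
          P.reducedBarrier μ Ψ v < P.reducedBarrier μ Ψ u := by
  have hB := regular_reduced hΨ hG hE hSC hSSOSC hMFCQ
  obtain ⟨w, hw, hpath⟩ := hB.exists_centralPath
  -- Without this the image direction would be zero and all path balls empty.
  have hw0 := isDirection_ne_zero hΨ hG hE hne hw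
  refine ⟨fderiv ℝ Ψ 0 w, ⟨isPathDirection_of_isDirection hΨ hG hE hw, fun ξ hξ => ?_⟩,
    fun ρ hρ => ?_⟩
  · obtain ⟨w', hw', rfl⟩ := exists_isDirection_of_isPathDirection hΨ hG hE hB hξ
    rw [hB.isDirection_unique hw' hw]
  obtain ⟨ε, hε, η₁, hη₁, hmem⟩ := exists_mem_pathBall hΨ hw0 hρ
  obtain ⟨η₂, hη₂, hloc⟩ := hpath ε hε
  obtain ⟨η₃, hη₃, hnear⟩ := Metric.eventually_nhds_iff.mp
    ((hΨ.eventually_isBKKTPoint_iff hG hE).and (hΨ.reduced hG hE).eventually_posDef_N)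
  refine ⟨min η₁ (min η₂ η₃), by positivity, fun η hη hle => ?_⟩
  obtain ⟨hle₁, hle₂, hle₃⟩ : η ≤ η₁ ∧ η ≤ η₂ ∧ η ≤ η₃ := by simpa using hle
  obtain ⟨δ, hδ, hδη⟩ := hloc η hη hle₂
  refine ⟨δ, hδ, fun μ hμ hμδ => ?_⟩
  obtain ⟨v, hcrit, hvw, hvη, huniq, hmin⟩ := hδη μ hμ hμδ
  have hv3 : ∀ u : EuclideanSpace ℝ (Fin (n - s)), ‖u‖ < η → dist u 0 < η₃ := fun u hu => by
    rw [dist_zero_right]; exact hu.trans_le hle₃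
  have hvB := ((hnear (hv3 v hvη)).1 μ hμ).mpr hcrit
  have hvG : (P.G (Ψ v)).PosDef := by
    obtain ⟨_, _, -, -, h, -⟩ := hvB
    exact h
  refine ⟨v, hvη, hmem μ hμ v (hvη.trans_le hle₁) hvw, hvB,
    fun u hu hub => huniq u hu (((hnear (hv3 u hu)).1 μ hμ).mp hub), ?_⟩
  filter_upwards [hmin, continuous_norm.continuousAt.eventually_lt_const hvη] with u hu hun hug huv
  have := hu huv
  rw [(hΨ.reduced hG hE).barrier_eq (hnear (hv3 v hvη)).2 hvG,
    (hΨ.reduced hG hE).barrier_eq (hnear (hv3 u hun)).2 hug] at this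
  exact this

end IsChart

namespace IsLocalParametrization

variable {xs : EuclideanSpace ℝ (Fin n)} {V : Set (EuclideanSpace ℝ (Fin (n - s)))}
  {Φ : EuclideanSpace ℝ (Fin (n - s)) → EuclideanSpace ℝ (Fin n)}

/-- Φ(V) need not be open, so the inverse is differentiated within Φ(V); by the chain rule this
derivative is a left inverse. -/
theorem injective_fderiv (hΦ : P.IsLocalParametrization xs V Φ) (hV : IsOpen V)
    {v : EuclideanSpace ℝ (Fin (n - s))} (hv : v ∈ V) : Function.Injective (fderiv ℝ Φ v) := by
  obtain ⟨Θ, hΘ, hinv⟩ := hΦ.contDiffOn_inverse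
  have h1 := ((hΦ.contDiffOn.contDiffAt (hV.mem_nhds hv)).differentiableAt (by simp)).hasFDerivAt
  have h2 := (hΘ.differentiableOn (by simp) (Φ v) (mem_image_of_mem Φ hv)).hasFDerivWithinAt
  have h3 := (h2.comp v h1.hasFDerivWithinAt (mapsTo_image Φ V)).hasFDerivAt (hV.mem_nhds hv)
  have h4 := (hasFDerivAt_id (𝕜 := ℝ) v).congr_of_eventuallyEq (f₁ := Θ ∘ Φ)
    (by filter_upwards [hV.mem_nhds hv] with u hu using hinv hu)
  refine Function.LeftInverse.injective (g := fderivWithin ℝ Θ (Φ '' V) (Φ v)) fun d => ?_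
  exact DFunLike.congr_fun (h3.unique h4) d

theorem isChart (hΦ : P.IsLocalParametrization xs V Φ) (hV : IsOpen V)
    (hli : LinearIndependent ℝ (P.gradH xs)) {v₀ : EuclideanSpace ℝ (Fin (n - s))} (hv₀ : v₀ ∈ V)
    (hx : Φ v₀ = xs) : P.IsChart xs (fun v => Φ (v₀ + v)) := by
  have hc : ContinuousAt (fun v => v₀ + v) 0 := (continuous_const_add v₀).continuousAt
  have hmem : ∀ᶠ v in 𝓝 (0 : EuclideanSpace ℝ (Fin (n - s))), v₀ + v ∈ V :=
    hc.eventually_mem (by simpa using hV.mem_nhds hv₀)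
  refine ⟨?_, by simpa using hx, ?_, ?_, hli⟩
  · refine ContDiffAt.comp (g := Φ) 0 ?_ (contDiffAt_const.add contDiffAt_id)
    exact hΦ.contDiffOn.contDiffAt (by simpa using hV.mem_nhds hv₀)
  · filter_upwards [hmem] with v hv using hΦ.subset _ hv
  · filter_upwards [hmem] with v hv
    rw [fderiv_comp_add_left]
    exact hΦ.injective_fderiv hV hv

/-- The parametrization is a homeomorphism onto its image. -/
theorem exists_norm_sub_lt (hΦ : P.IsLocalParametrization xs V Φ)
    {v₀ : EuclideanSpace ℝ (Fin (n - s))} (hv₀ : v₀ ∈ V) {η : ℝ} (hη : 0 < η) :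
    ∃ δ > 0, ∀ v ∈ V, ‖Φ v - Φ v₀‖ < δ → ‖v - v₀‖ < η := by
  obtain ⟨Θ, hΘ, hinv⟩ := hΦ.contDiffOn_inverse
  obtain ⟨δ, hδ, h⟩ := Metric.continuousWithinAt_iff.mp
    (hΘ.continuousOn (Φ v₀) (mem_image_of_mem Φ hv₀)) η hη
  refine ⟨δ, hδ, fun v hv hlt => ?_⟩
  have := h (mem_image_of_mem Φ hv) (by rwa [dist_eq_norm])
  rwa [hinv hv, hinv hv₀, dist_eq_norm] at this

end IsLocalParametrization

end NSDP

end

/-- All path balls with parameter up to μ̄ lie within O(μ̄) of x*, so uniqueness near x* yields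
uniqueness in their union. -/
theorem norm_sub_le_of_mem_pathBall {n : ℕ} {xs ξ x : EuclideanSpace ℝ (Fin n)} {ρ ν : ℝ}
    (hν : 0 < ν) (hx : x ∈ pathBall xs ξ ρ ν) : ‖x - xs‖ ≤ (1 + ρ) * ‖ξ‖ * ν := by
  have h : ‖xs + ν • ξ - x‖ < ρ * ν * ‖ξ‖ := hx
  calc ‖x - xs‖ = ‖ν • ξ - (xs + ν • ξ - x)‖ := by congr 1; abel
    _ ≤ ‖ν • ξ‖ + ‖xs + ν • ξ - x‖ := norm_sub_le _ _
    _ ≤ ν * ‖ξ‖ + ρ * ν * ‖ξ‖ := by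
      rw [norm_smul, Real.norm_of_nonneg hν.le]
      linarith
    _ = _ := by ring

theorem theorem3p3 {n m s k : ℕ} (P : NSDP n m s) (xs : EuclideanSpace ℝ (Fin n))
    (E : Matrix (Fin m) (Fin k) ℝ) (hE : IsOrthonormalKernelBasis (P.G xs) E)
    (hKKT : P.IsKKTPoint xs)
    (hSC : P.StrictComplementarity xs)
    (hSSOSC : P.SSOSC xs E)
    (hMFCQ : P.MFCQ xs)
    (hne : ∀ μ : ℝ, 0 < μ → ¬ P.IsBKKTPoint μ xs)
    (c : EuclideanSpace ℝ (Fin (n - s))) (r : ℝ)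
    (Φ : EuclideanSpace ℝ (Fin (n - s)) → EuclideanSpace ℝ (Fin n))
    (hΦ : P.IsLocalParametrization xs (Metric.ball c r) Φ) :
    ∃ ξ : EuclideanSpace ℝ (Fin n),
      (P.IsPathDirection xs E ξ ∧ ∀ η, P.IsPathDirection xs E η → η = ξ) ∧
      ∀ ρ : ℝ, 0 < ρ → ∃ μ₀ : ℝ, 0 < μ₀ ∧ ∀ μb : ℝ, 0 < μb → μb ≤ μ₀ →
        ∀ μ : ℝ, 0 < μ → μ ≤ μb →
          ∃ x ∈ Φ '' Metric.ball c r ∩ ⋃ ν ∈ Set.Ioc 0 μb, pathBall xs ξ ρ ν,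
            P.IsBKKTPoint μ x ∧
            (∀ y ∈ Φ '' Metric.ball c r ∩ ⋃ ν ∈ Set.Ioc 0 μb, pathBall xs ξ ρ ν,
              P.IsBKKTPoint μ y → y = x) ∧
            ∃ v ∈ Metric.ball c r, Φ v = x ∧
              IsStrictLocalOptimum (P.reducedBarrier μ Φ)
                (P.reducedFeasible (Metric.ball c r) Φ) v := by
  obtain ⟨v₀, hv₀, hx⟩ := hΦ.mem
  have hG : (P.G xs).PosSemidef := hKKT.some_mem.2.2.1
  have hopen : IsOpen (Metric.ball c r) := Metric.isOpen_ball
  have hchart := hΦ.isChart hopen hMFCQ.1 hv₀ hx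
  set Ψ : EuclideanSpace ℝ (Fin (n - s)) → EuclideanSpace ℝ (Fin n) := fun v => Φ (v₀ + v) with hΨdef
  have h0 : Ψ 0 = xs := hchart.map_zero
  obtain ⟨ξ, hξ, hpath⟩ : ∃ ξ, (P.IsPathDirection xs E ξ ∧ ∀ η, P.IsPathDirection xs E η → η = ξ) ∧
      ∀ ρ > 0, ∃ η₀ > 0, ∀ η, 0 < η → η ≤ η₀ → ∃ δ > 0, ∀ μ, 0 < μ → μ < δ → ∃ v, ‖v‖ < η ∧
        Ψ v ∈ pathBall xs ξ ρ μ ∧ P.IsBKKTPoint μ (Ψ v) ∧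
        (∀ u, ‖u‖ < η → P.IsBKKTPoint μ (Ψ u) → u = v) ∧
        ∀ᶠ u in 𝓝 v, (P.G (Ψ u)).PosDef → u ≠ v →
          P.reducedBarrier μ Ψ v < P.reducedBarrier μ Ψ u := by
    -- Forgetting how `Ψ` is built allows x* to be replaced by `Ψ 0`.
    clear_value Ψ
    subst h0
    exact hchart.exists_centralPath hG hE hSC hSSOSC hMFCQ hne
  refine ⟨ξ, hξ, fun ρ hρ => ?_⟩
  obtain ⟨η₀, hη₀, hη₀'⟩ := hpath ρ hρ
  obtain ⟨η₁, hη₁, hball⟩ := Metric.isOpen_iff.mp hopen v₀ hv₀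
  set η := min η₀ η₁ with hη
  have hη_pos : 0 < η := lt_min hη₀ hη₁
  obtain ⟨δ, hδ, hδ'⟩ := hη₀' η hη_pos (min_le_left _ _)
  obtain ⟨τ, hτ, hτ'⟩ := hΦ.exists_norm_sub_lt hv₀ hη_pos
  have hK : 0 < (1 + ρ) * ‖ξ‖ + 1 := by positivity
  -- The first bound gives μ < δ. The second keeps the union of path balls within τ of x*, so that
  -- points of Φ(V) in it have preimages within `η` of `v₀`; the added 1 keeps the denominator
  -- positive.
  refine ⟨min (δ / 2) (τ / (2 * ((1 + ρ) * ‖ξ‖ + 1))), by positivity,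
    fun μb hμb hle μ hμ hμle => ?_⟩
  have hμδ : μ < δ := by
    have := hle.trans (min_le_left _ _)
    linarith
  obtain ⟨v, hvη, hvmem, hvB, huniq, hmin⟩ := hδ' μ hμ hμδ
  have hvV : v₀ + v ∈ Metric.ball c r := hball (by
    simpa [dist_eq_norm] using hvη.trans_le (min_le_right _ _))
  refine ⟨Ψ v, ⟨mem_image_of_mem Φ hvV, mem_biUnion ⟨hμ, hμle⟩ hvmem⟩, hvB, ?_,
    v₀ + v, hvV, rfl, ⟨hvV, ?_⟩, ?_⟩
  · rintro _ ⟨⟨v', hv', rfl⟩, hy⟩ hyB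
    obtain ⟨ν, hν, hνmem⟩ := mem_iUnion₂.mp hy
    have h1 := norm_sub_le_of_mem_pathBall hν.1 hνmem
    have h2 : ν ≤ τ / (2 * ((1 + ρ) * ‖ξ‖ + 1)) := hν.2.trans (hle.trans (min_le_right _ _))
    have h3 : ‖Φ v' - Φ v₀‖ < τ := by
      rw [hx]
      calc _ ≤ (1 + ρ) * ‖ξ‖ * ν := h1
        _ ≤ ((1 + ρ) * ‖ξ‖ + 1) * ν := by nlinarith [hν.1]
        _ ≤ ((1 + ρ) * ‖ξ‖ + 1) * (τ / (2 * ((1 + ρ) * ‖ξ‖ + 1))) := by gcongr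
        _ = τ / 2 := by field_simp
        _ < τ := half_lt_self hτ
    have h4 : Ψ (v' - v₀) = Φ v' := by simp [hΨdef]
    rw [← h4, huniq (v' - v₀) (hτ' v' hv' h3) (by rwa [h4])]
  · obtain ⟨_, _, -, -, h, -⟩ := hvB
    exact h
  · have hc : Tendsto (fun u => u - v₀) (𝓝 (v₀ + v)) (𝓝 v) :=
      (continuous_sub_right v₀).tendsto' _ _ (by simp)
    filter_upwards [hc.eventually hmin] with u hu hfeas hne'
    have h4 : Ψ (u - v₀) = Φ u := by simp [hΨdef]
    have h5 := hu (by rw [h4]; exact hfeas.2) (fun h => hne' (by rw [← h]; abel))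
    simpa only [NSDP.reducedBarrier, h4] using h5
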